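/- Let $d\in\{2,3\}$, $T>0$, $\mathbb T^d=\mathbb R^d/\mathbb Z^d$. Vector fields on $\mathbb T^d$ take values in $\mathbb R^3$; for $d=2$ they do not depend on the third variable ($\partial_3=0$). Let $h\in C([0,T];L^2(\mathbb T^d))$ be a weak solution of the inviscid E-MHD equations $h_t+\nabla\times[(\nabla\times h)\times h]=0$, $\operatorname{div}h=0$, that is, $h(t)$ is divergence-free in the sense of distributions for every $t\in[0,T]$, and $$\int_0^T\!\!\int_{\mathbb T^d}\partial_t\varphi\cdot h+(h\otimes h):\nabla(\nabla\times\varphi)\,dx\,dt=0$$ for all divergence-free $\varphi\in C_c^\infty((0,T)\times\mathbb T^d;\mathbb R^3)$. Write $\vec j=\operatorname{curl}h$ (in the sense of distributions). Function spaces, for $s\in\mathbb R$ and $r,p\in[1,\infty]$ (with $1/\infty=0$ and the usual changes for infinite exponents): * $\|f\|_{B^s_{p,\infty}}=\|f\|_{L^p(\mathbb T^d)}+\big\||y|^{-s}\|f(\cdot-y)-f\|_{L^p(\mathbb T^d)}\big\|_{L^\infty_y(\mathbb T^d)}$, where $|y|$ is the length of the shortest representative of $y$. * $f\in L^r(0,T;\underline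 B^s_{p,VMO})$ means $\|f\|_{L^r(0,T;L^p)}<\infty$ and $$\lim_{\varepsilon\to0^+}\varepsilon^{-s}\Big(\int_0^T\Big[\int_{\mathbb T^d}\frac1{|B_\varepsilon(0)|}\int_{B_\varepsilon(0)}|f(x,t)-f(x-y,t)|^p\,dy\,dx\Big]^{r/p}dt\Big)^{1/r}=0.$$ * $B^s_{p,c(\mathbb N)}$ is the set of $f\in B^s_{p,\infty}$ with $\lim_{n\to\infty}2^{sn}\|\Delta_nf\|_{L^p}=0$, where $\Delta_n$ are the (smooth) Littlewood–Paley blocks on $\mathbb T^d$; its norm is that of $B^s_{p,\infty}$. Suppose that at least one of the following conditions holds: 1. $h\in L^3(0,T;\underline B^{2/3}_{3,VMO})$; 2. $\vec j\in L^{r_1}(0,T;\underline B^{\alpha}_{p,VMO})$ and $h\in L^{r_2}(0,T;B^{\beta}_{q,\infty})$ for some $\alpha,\beta\in\mathbb R$ and $r_1,r_2,p,q\in[1,\infty]$ with $\alpha+2\beta\ge1$, $\frac1{r_1}+\frac2{r_2}=1$, $\frac1p+\frac2q=1$; 3. $\vec j\in L^{r_1}(0,T;B^{\alpha}_{p,\infty})$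 and $h\in L^{r_2}(0,T;\underline B^{\beta}_{q,VMO})$ for some $\alpha,\beta\in\mathbb R$ and $r_1,r_2,p,q\in[1,\infty]$ with $\alpha+2\beta\ge1$, $\frac1{r_1}+\frac2{r_2}=1$, $\frac1p+\frac2q=1$; 4. $\vec j\in L^3(0,T;B^{1/3}_{3d/(d+2),\,c(\mathbb N)})$. Then the energy is conserved: for every $t\in[0,T]$, $$\frac12\int_{\mathbb T^d}|h(x,t)|^2\,dx=\frac12\int_{\mathbb T^d}|h(x,0)|^2\,dx .$$ -/

import Mathlib

open MeasureTheory Filter Topology Set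
open scoped ENNReal ContDiff

noncomputable section

/-- The flat torus `ℝ^d / ℤ^d`. -/
abbrev Torus (d : ℕ) := UnitAddTorus (Fin d)

/-- The space of values of magnetic fields, with the Euclidean norm. -/
abbrev E3 := EuclideanSpace ℝ (Fin 3)

/-- The quotient map `ℝ^d → ℝ^d / ℤ^d`. -/
def toTorus {d : ℕ} (x : Fin d → ℝ) : Torus d := fun i => (x i : UnitAddCircle)

/-! ### Differential operators for smooth fields on the torus

Fields have three components and depend on the `d` torus variables `x_0, …, x_{d-1}`. When `d = 2`
they do not depend on the third variable, so the derivative in that direction is zero. -/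

/-- The partial derivative in direction `a`; it is zero in the directions `a ≥ d`. -/
def pd {d : ℕ} (a : Fin 3) (f : Torus d → ℝ) (x : Torus d) : ℝ :=
  if ha : (a : ℕ) < d then
    deriv (fun s : ℝ => f (x + Pi.single (⟨a, ha⟩ : Fin d) (s : UnitAddCircle))) 0
  else 0

/-- The divergence of a vector field. -/
def divergence {d : ℕ} (φ : Torus d → E3) (x : Torus d) : ℝ :=
  ∑ a : Fin 3, pd a (fun y => φ y a) x

/-- The curl of a vector field. -/
def curl {d : ℕ} (φ : Torus d → E3) (x : Torus d) : E3 :=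
  !₂[pd 1 (fun y => φ y 2) x - pd 2 (fun y => φ y 1) x,
     pd 2 (fun y => φ y 0) x - pd 0 (fun y => φ y 2) x,
     pd 0 (fun y => φ y 1) x - pd 1 (fun y => φ y 0) x]

/-- Smoothness of a function on the torus: its periodic lift to `ℝ^d` is smooth. -/
def SmoothOnTorus {d : ℕ} {F : Type*} [NormedAddCommGroup F] [NormedSpace ℝ F]
    (φ : Torus d → F) : Prop :=
  ContDiff ℝ ∞ (fun x : Fin d → ℝ => φ (toTorus x))

/-- A divergence-free test field in `C_c^∞((0,T) × 𝕋^d; ℝ³)`. -/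
structure IsSolenoidalTest {d : ℕ} (T : ℝ) (φ : ℝ → Torus d → E3) : Prop where
  smooth : ContDiff ℝ ∞ (fun z : ℝ × (Fin d → ℝ) => φ z.1 (toTorus z.2))
  compact_support : ∃ a b : ℝ, 0 < a ∧ b < T ∧ ∀ t, t ∉ Icc a b → φ t = 0
  div_free : ∀ t x, divergence (φ t) x = 0

/-! ### Weak solutions -/

/-- `div u = 0` in the sense of distributions on the torus. -/
def WeaklyDivFree {d : ℕ} (u : Torus d → E3) : Prop :=
  ∀ φ : Torus d → ℝ, SmoothOnTorus φ → ∫ x, ∑ a : Fin 3, u x a * pd a φ x = 0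

/-- `curl u = j` in the sense of distributions on the torus. -/
def IsWeakCurl {d : ℕ} (u j : Torus d → E3) : Prop :=
  ∀ φ : Torus d → E3, SmoothOnTorus φ →
    ∫ x, ∑ a : Fin 3, j x a * φ x a = ∫ x, ∑ a : Fin 3, u x a * curl φ x a

/-- `h ∈ C([0,T]; L²(𝕋^d))` is a weak solution of the inviscid E-MHD equations
`h_t + ∇ × [(∇ × h) × h] = 0`, `div h = 0`, where the nonlinear term is written as
`∇ × div (h ⊗ h)`. -/
structure IsEMHDWeakSolution {d : ℕ} (T : ℝ)
    (h : ℝ → Lp E3 2 (volume : Measure (Torus d))) : Prop where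
  continuousOn : ContinuousOn h (Icc 0 T)
  div_free : ∀ t ∈ Icc 0 T, WeaklyDivFree (h t)
  equation : ∀ φ : ℝ → Torus d → E3, IsSolenoidalTest T φ →
    ∫ t in (0 : ℝ)..T, ∫ x, ((∑ b : Fin 3, deriv (fun s => φ s x b) t * h t x b) +
      ∑ a : Fin 3, ∑ b : Fin 3, h t x a * h t x b * pd a (fun y => curl (φ t) y b) x) = 0

/-- `j` is the current `curl h` on `(0,T)`, given as a measurable function of time with values
in `L¹(𝕋^d)`. -/
def IsCurrent {d : ℕ} (T : ℝ) (h : ℝ → Lp E3 2 (volume : Measure (Torus d)))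
    (j : ℝ → Lp E3 1 (volume : Measure (Torus d))) : Prop :=
  AEStronglyMeasurable j (volume.restrict (Ioo 0 T)) ∧
    ∀ᵐ t ∂(volume.restrict (Ioo 0 T)), IsWeakCurl (h t) (j t)

/-! ### Function spaces -/

/-- The Euclidean length of (the shortest representative of) a point of the torus. -/
def torusLength {d : ℕ} (y : Torus d) : ℝ := √(∑ i, ‖y i‖ ^ 2)

/-- The norm of the mixed Lebesgue-type space `L^r(0,T; X)`, where `N t` is the `X`-norm
of the function at time `t`. -/
def timeNorm (T : ℝ) (r : ℝ≥0∞) (N : ℝ → ℝ≥0∞) : ℝ≥0∞ :=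
  eLpNorm N r (volume.restrict (Ioo 0 T))

/-- The Besov norm
`‖f‖_{L^p} + ess sup_y |y|^{-s} ‖f(· - y) - f‖_{L^p}` of `B^s_{p,∞}(𝕋^d)`. -/
def besovNorm {d : ℕ} (s : ℝ) (p : ℝ≥0∞) (f : Torus d → E3) : ℝ≥0∞ :=
  eLpNorm f p volume +
    essSup (fun y : Torus d => ENNReal.ofReal (torusLength y ^ (-s)) *
      eLpNorm (fun x => f (x - y) - f x) p volume) volume

/-- `f ∈ L^r(0,T; B^s_{p,∞}(𝕋^d))`. -/
def MemBesov {d : ℕ} (T : ℝ) (r : ℝ≥0∞) (s : ℝ) (p : ℝ≥0∞) (f : ℝ → Torus d → E3) : Prop :=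
  timeNorm T r (fun t => besovNorm s p (f t)) < ⊤

/-- The mean oscillation `(∫_{𝕋^d} ⨍_{B_ε(0)} |f(x) - f(x - y)|^q dy dx)^{1/q}`
(the essential supremum of `|f(x) - f(x - y)|` over `x ∈ 𝕋^d`, `y ∈ B_ε(0)` if `q = ∞`). -/
def meanOsc {d : ℕ} (q : ℝ≥0∞) (ε : ℝ) (f : Torus d → E3) : ℝ≥0∞ :=
  eLpNorm (fun z : Torus d × Torus d => f z.1 - f (z.1 - z.2)) q
    ((volume : Measure (Torus d)).prod
      (ProbabilityTheory.cond volume {y : Torus d | torusLength y < ε}))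

/-- `f ∈ L^r(0,T; \underline{B}^s_{q,VMO}(𝕋^d))`. -/
def MemBesovVMO {d : ℕ} (T : ℝ) (r : ℝ≥0∞) (s : ℝ) (q : ℝ≥0∞) (f : ℝ → Torus d → E3) : Prop :=
  timeNorm T r (fun t => eLpNorm (f t) q volume) < ⊤ ∧
    Tendsto (fun ε : ℝ => ENNReal.ofReal (ε ^ (-s)) * timeNorm T r (fun t => meanOsc q ε (f t)))
      (𝓝[>] 0) (𝓝 0)

/-- A smooth radial cutoff, as a function of `ρ = |ξ|`: it is `1` for `ρ ≤ 1` and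
`0` for `ρ ≥ 2`. -/
def lpCutoff (ρ : ℝ) : ℝ := Real.smoothTransition ((4 - ρ ^ 2) / 3)

/-- The kernel of the `n`-th Littlewood-Paley block, with symbol
`lpCutoff (|k| / 2^n) - lpCutoff (|k| / 2^(n-1))`, which is supported in
`2^(n-1) ≤ |k| ≤ 2^(n+1)`; the sum therefore runs over all relevant frequencies `k ∈ ℤ^d`. -/
def lpKernel {d : ℕ} (n : ℕ) (x : Torus d) : ℝ :=
  ∑ k ∈ Fintype.piFinset (fun _ : Fin d => Finset.Icc (-(2 : ℤ) ^ (n + 1)) (2 ^ (n + 1))),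
    (lpCutoff (√(∑ i, (k i : ℝ) ^ 2) / 2 ^ n) - lpCutoff (2 * √(∑ i, (k i : ℝ) ^ 2) / 2 ^ n)) *
      (UnitAddTorus.mFourier k x).re

/-- The Littlewood-Paley block `Δ_n f`. -/
def lpBlock {d : ℕ} (n : ℕ) (f : Torus d → E3) (x : Torus d) : E3 :=
  ∫ y, lpKernel n (x - y) • f y

/-- `f ∈ L^r(0,T; B^s_{p,c(ℕ)}(𝕋^d))`, where `B^s_{p,c(ℕ)}` is the set of all
`g ∈ B^s_{p,∞}` with `2^{sn} ‖Δ_n g‖_{L^p} → 0`. -/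
def MemBesovC {d : ℕ} (T : ℝ) (r : ℝ≥0∞) (s : ℝ) (p : ℝ≥0∞) (f : ℝ → Torus d → E3) : Prop :=
  MemBesov T r s p f ∧
    ∀ᵐ t ∂(volume.restrict (Ioo 0 T)),
      Tendsto (fun n : ℕ => ENNReal.ofReal ((2 : ℝ) ^ (s * n)) * eLpNorm (lpBlock n (f t)) p volume)
        atTop (𝓝 0)

end

/-! ### Calculus on the torus -/

section TorusBasics

variable {d : ℕ}

/-! Write `f_η` for the convolution of `f` with an even mollifier `η` at scale `ε`, and `j` for the
current. The argument follows Constantin, E and Titi. Formally, testing the equation with the doubly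
mollified field `(h_η)_η` shows that `∫ |h_η|²` changes at rate `2 Π`, where `Π = ∫ h ⊗ h : ∇ curl
(h_η)_η`. It then suffices that `∫₀ᵀ |Π| dt → 0`, because `∫ |h_η(t)|² → ∫ |h(t)|²` at each fixed
time (`energy_eq_of_tendsto_flux`).

The field `h` is not differentiable in time, so the identity for `∫ |h_η|²` is obtained without a
time-dependent test field. The difference of the energies at `t` and `s` is the increment of the
pairing of `h` with the fixed field `((h(t) + h(s))_η)_η`. The weak form turns this increment into a
time integral, and continuity of the transfer functional on `L²` lets `t → s` (`mollEnergy_sub`,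
`weak_form_of_solenoidal`, `deriv_of_transfer`, `energy_identity`).

A smooth solenoidal field has zero flux (`flux_smooth_eq_zero`), because `w · (u · ∇)u = w ·
∇|u|²/2` for `w = curl u`. Hence `Π` is the integral of the commutator `(h ⊗ h)_η − h_η ⊗ h_η`
against `∇ curl h_η` (`flux_eq_commutator`). The commutator is a local covariance, bounded pointwise
by the mean of `|h(x) − h(x − z)|²` over the ball `B_ε`. The other factor costs `ε⁻²` times a mean
oscillation of `h`, or only `ε⁻¹` times one of `j`, since `curl h_η = j_η`. Hölder in space, then in
time, bounds the integrated flux by `ε⁻²` times the cube of the `L³` oscillation of `h`, or by `ε⁻¹`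
times one oscillation of `j` and two of `h`. The first three conditions make these products vanish
by counting powers of `ε`.

The fourth condition is reduced to the oscillation bound in the first
(`tendsto_oscillation_of_memBesovC`). Everything passes through `L²`, which is possible because `p =
3d/(d+2) ≤ 2 ≤ 3`. Bernstein's inequality takes blocks of `j` from `Lᵖ` to `L²`, Parseval inverts
the curl with a gain `2⁻ⁿ`, and Bernstein again takes blocks of `h` from `L²` to `L³`. The
oscillation at scale `ε`, divided by `ε^{2/3}`, is then dominated by a sum over `n` of rescaled
blocks of `j` with weights concentrated at `2ⁿ ε ≈ 1` and summable uniformly in `ε`. Vanishing of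
the blocks gives convergence at almost every time, and the Besov norm gives the majorant for
dominated convergence in time. -/

instance : IsProbabilityMeasure (volume : Measure UnitAddCircle) :=
  ⟨UnitAddCircle.measure_univ⟩

theorem toTorus_add (x y : Fin d → ℝ) : toTorus (x + y) = toTorus x + toTorus y := by
  ext i; simp [toTorus]

theorem toTorus_neg (x : Fin d → ℝ) : toTorus (-x) = -toTorus x := by
  ext i; simp [toTorus]

theorem toTorus_single (i : Fin d) (s : ℝ) :
    toTorus (Pi.single i s) = Pi.single i (s : UnitAddCircle) := by
  ext j
  by_cases hj : j = i
  · subst hj; simp [toTorus]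
  · simp [toTorus, hj]

theorem toTorus_surjective : Function.Surjective (toTorus : (Fin d → ℝ) → Torus d) := by
  intro x
  choose y hy using fun i => QuotientAddGroup.mk_surjective (x i)
  exact ⟨y, funext hy⟩

theorem isOpenQuotientMap_toTorus : IsOpenQuotientMap (toTorus : (Fin d → ℝ) → Torus d) :=
  IsOpenQuotientMap.piMap fun _ => QuotientAddGroup.isOpenQuotientMap_mk

/-- The partial derivative of a function on the torus in the coordinate direction `i`. -/
noncomputable def pdi (i : Fin d) (f : Torus d → ℝ) (x : Torus d) : ℝ :=
  deriv (fun s : ℝ => f (x + Pi.single i (s : UnitAddCircle))) 0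

/-- The coordinate functional `v ↦ v i` on `ℝ^d`. -/
noncomputable def coordProj (i : Fin d) : (Fin d → ℝ) →L[ℝ] ℝ := ContinuousLinearMap.proj i

theorem coordProj_apply (i : Fin d) (v : Fin d → ℝ) : coordProj i v = v i := rfl

instance : Measure.IsNegInvariant (volume : Measure (Torus d)) :=
  Measure.IsAddHaarMeasure.isNegInvariant_of_regular _

theorem pd_of_lt {a : Fin 3} (ha : (a : ℕ) < d) : pd (d := d) a = pdi ⟨a, ha⟩ := by
  ext f x; simp [pd, pdi, ha]

theorem pd_of_not_lt {a : Fin 3} (ha : ¬ (a : ℕ) < d) : pd (d := d) a = 0 := by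
  ext f x; simp [pd, ha]

namespace SmoothOnTorus

variable {F : Type*} [NormedAddCommGroup F] [NormedSpace ℝ F]

theorem continuous {f : Torus d → F} (hf : SmoothOnTorus f) : Continuous f :=
  isOpenQuotientMap_toTorus.isQuotientMap.continuous_iff.2 (ContDiff.continuous hf)

theorem exists_bound {f : Torus d → F} (hf : SmoothOnTorus f) : ∃ C, ∀ x, ‖f x‖ ≤ C := by
  obtain ⟨C, hC⟩ := isCompact_univ.exists_bound_of_continuousOn hf.continuous.continuousOn
  exact ⟨C, fun x => hC x (mem_univ x)⟩

theorem integrable {f : Torus d → ℝ} (hf : SmoothOnTorus f) : Integrable f :=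
  hf.continuous.integrable_of_hasCompactSupport (HasCompactSupport.of_compactSpace f)

theorem const (c : F) : SmoothOnTorus (fun _ : Torus d => c) := contDiff_const

theorem sub {f g : Torus d → F} (hf : SmoothOnTorus f) (hg : SmoothOnTorus g) :
    SmoothOnTorus (fun x => f x - g x) := ContDiff.sub hf hg

theorem mul {f g : Torus d → ℝ} (hf : SmoothOnTorus f) (hg : SmoothOnTorus g) :
    SmoothOnTorus (fun x => f x * g x) := ContDiff.mul hf hg

theorem sum {ι : Type*} {s : Finset ι} {f : ι → Torus d → F}
    (hf : ∀ i ∈ s, SmoothOnTorus (f i)) : SmoothOnTorus (fun x => ∑ i ∈ s, f i x) :=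
  ContDiff.sum hf

theorem const_add_comp {f : Torus d → F} (hf : SmoothOnTorus f) (x : Torus d) :
    SmoothOnTorus (fun y => f (x + y)) := by
  obtain ⟨x, rfl⟩ := toTorus_surjective x
  have hf' : ContDiff ℝ ∞ fun v : Fin d → ℝ => f (toTorus v) := hf
  have : ContDiff ℝ ∞ fun v : Fin d → ℝ => f (toTorus (x + v)) :=
    hf'.comp (contDiff_const.add contDiff_id)
  simpa only [SmoothOnTorus, toTorus_add] using this

theorem const_sub_comp {f : Torus d → F} (hf : SmoothOnTorus f) (x : Torus d) :
    SmoothOnTorus (fun y => f (x - y)) := by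
  obtain ⟨x, rfl⟩ := toTorus_surjective x
  have hf' : ContDiff ℝ ∞ fun v : Fin d → ℝ => f (toTorus v) := hf
  have : ContDiff ℝ ∞ fun v : Fin d → ℝ => f (toTorus (x + -v)) :=
    hf'.comp (contDiff_const.add contDiff_neg)
  simpa only [SmoothOnTorus, toTorus_add, toTorus_neg, sub_eq_add_neg] using this

theorem pdi_toTorus {f : Torus d → ℝ} (hf : SmoothOnTorus f) (i : Fin d) (v : Fin d → ℝ) :
    pdi i f (toTorus v) = fderiv ℝ (fun v => f (toTorus v)) v (Pi.single i 1) := by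
  have h1 : HasFDerivAt (fun v => f (toTorus v)) (fderiv ℝ (fun v => f (toTorus v)) v)
      (v + (0 : ℝ) • Pi.single i (1 : ℝ)) := by
    simpa using (ContDiff.differentiable hf (by simp) v).hasFDerivAt
  have h2 : HasDerivAt (fun s : ℝ => v + s • Pi.single i (1 : ℝ)) (Pi.single i 1) 0 := by
    simpa using ((hasDerivAt_id (0 : ℝ)).smul_const (Pi.single i (1 : ℝ))).const_add v
  have h3 := (h1.comp_hasDerivAt (0 : ℝ) h2).deriv
  rw [← h3, pdi]
  congr 1
  ext s
  simp only [Function.comp]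
  rw [toTorus_add, ← toTorus_single]
  congr 3
  ext j
  by_cases hj : j = i
  · subst hj; simp
  · simp [hj]

theorem pdi {f : Torus d → ℝ} (hf : SmoothOnTorus f) (i : Fin d) : SmoothOnTorus (pdi i f) := by
  have : (fun v => _root_.pdi i f (toTorus v)) =
      fun v => fderiv ℝ (fun v => f (toTorus v)) v (Pi.single i 1) :=
    funext fun v => hf.pdi_toTorus i v
  rw [SmoothOnTorus, this]
  exact (ContDiff.fderiv_right (m := ∞) hf (by simp)).clm_apply contDiff_const

theorem pd {f : Torus d → ℝ} (hf : SmoothOnTorus f) (a : Fin 3) : SmoothOnTorus (pd a f) := by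
  by_cases ha : (a : ℕ) < d
  · rw [pd_of_lt ha]; exact hf.pdi _
  · rw [pd_of_not_lt ha]; exact const 0

theorem hasFDerivAt {f : Torus d → ℝ} (hf : SmoothOnTorus f) (v : Fin d → ℝ) :
    HasFDerivAt (fun v => f (toTorus v))
      (∑ i, _root_.pdi i f (toTorus v) • coordProj i) v := by
  refine (ContDiff.differentiable hf (by simp) v).hasFDerivAt.congr_fderiv
    (ContinuousLinearMap.ext fun w => ?_)
  have hw : w = ∑ i, w i • Pi.single i (1 : ℝ) := by
    ext j; simp [Finset.sum_apply, Pi.single_apply]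
  conv_lhs => rw [hw]
  simp only [hf.pdi_toTorus, sum_apply, smul_apply, coordProj_apply, smul_eq_mul, map_sum,
    map_smul]
  exact Finset.sum_congr rfl fun i _ => mul_comm _ _

theorem hasDerivAt_pdi {f : Torus d → ℝ} (hf : SmoothOnTorus f) (i : Fin d) (x : Torus d) :
    HasDerivAt (fun s : ℝ => f (x + Pi.single i (s : UnitAddCircle))) (_root_.pdi i f x) 0 := by
  have h1 := (hf.const_add_comp x).hasFDerivAt 0
  have h2 : HasDerivAt (fun s : ℝ => Pi.single (M := fun _ : Fin d => ℝ) i s) (Pi.single i 1) 0 :=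
    hasDerivAt_pi.2 fun j => by
      by_cases hj : j = i
      · subst hj; simpa using hasDerivAt_id' (0 : ℝ)
      · simpa [hj] using hasDerivAt_const (0 : ℝ) (0 : ℝ)
  have h3 := HasFDerivAt.comp_hasDerivAt (0 : ℝ) (f := fun s : ℝ => Pi.single (M := fun _ : Fin d => ℝ) i s)
    (by simpa using h1) h2
  simp only [Function.comp_def, toTorus_single] at h3
  exact (h3.differentiableAt.hasDerivAt)

end SmoothOnTorus

/-! ### Algebraic rules for partial derivatives on the torus. -/

section Rules

variable {f g : Torus d → ℝ}

theorem pdi_comm (hf : SmoothOnTorus f) (i j : Fin d) (x : Torus d) :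
    pdi i (pdi j f) x = pdi j (pdi i f) x := by
  obtain ⟨v, rfl⟩ := toTorus_surjective x
  have key : ∀ i j : Fin d, pdi i (pdi j f) (toTorus v) =
      fderiv ℝ (fderiv ℝ (fun v => f (toTorus v))) v (Pi.single i 1) (Pi.single j 1) := by
    intro i j
    rw [(hf.pdi j).pdi_toTorus]
    simp only [hf.pdi_toTorus]
    have hd : DifferentiableAt ℝ (fderiv ℝ (fun v => f (toTorus v))) v :=
      (ContDiff.fderiv_right (m := ∞) hf (by simp)).differentiable (by simp) v
    rw [fderiv_clm_apply hd (by fun_prop)]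
    simp
  rw [key, key]
  have : IsSymmSndFDerivAt ℝ (fun v => f (toTorus v)) v :=
    ContDiffAt.isSymmSndFDerivAt (ContDiff.contDiffAt hf)
      (by simp only [minSmoothness_of_isRCLikeNormedField]; exact WithTop.coe_le_coe.2 le_top)
  exact this _ _

theorem pd_comm (hf : SmoothOnTorus f) (a b : Fin 3) (x : Torus d) :
    pd a (pd b f) x = pd b (pd a f) x := by
  have h0 : ∀ i : Fin d, pdi i (0 : Torus d → ℝ) = 0 := fun i => by ext; simp [pdi]
  by_cases ha : (a : ℕ) < d <;> by_cases hb : (b : ℕ) < d <;>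
    simp only [pd_of_lt, pd_of_not_lt, ha, hb, not_false_eq_true, Pi.zero_apply, h0]
  exact pdi_comm hf _ _ x

theorem pd_const (a : Fin 3) (c : ℝ) (x : Torus d) : pd a (fun _ => c) x = 0 := by
  simp [pd]

/-- Partial derivatives of smooth functions are genuine derivatives along a curve. -/
theorem exists_hasDerivAt_pd (a : Fin 3) (x : Torus d) : ∃ γ : ℝ → Torus d, γ 0 = x ∧
    ∀ f : Torus d → ℝ, SmoothOnTorus f → HasDerivAt (fun s => f (γ s)) (pd a f x) 0 := by
  by_cases ha : (a : ℕ) < d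
  · refine ⟨fun s => x + Pi.single ⟨a, ha⟩ (s : UnitAddCircle), by simp, fun f hf => ?_⟩
    rw [pd_of_lt ha]; exact hf.hasDerivAt_pdi _ x
  · refine ⟨fun _ => x, rfl, fun f _ => ?_⟩
    rw [pd_of_not_lt ha]; exact hasDerivAt_const _ _

theorem pd_sub (hf : SmoothOnTorus f) (hg : SmoothOnTorus g) (a : Fin 3) (x : Torus d) :
    pd a (fun y => f y - g y) x = pd a f x - pd a g x := by
  obtain ⟨γ, -, hγ⟩ := exists_hasDerivAt_pd a x
  exact (hγ _ (hf.sub hg)).unique ((hγ f hf).sub (hγ g hg))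

theorem pd_mul (hf : SmoothOnTorus f) (hg : SmoothOnTorus g) (a : Fin 3) (x : Torus d) :
    pd a (fun y => f y * g y) x = pd a f x * g x + f x * pd a g x := by
  obtain ⟨γ, h0, hγ⟩ := exists_hasDerivAt_pd a x
  have := (hγ _ (hf.mul hg)).unique ((hγ f hf).mul (hγ g hg))
  simpa [h0] using this

theorem pd_sum {ι : Type*} {s : Finset ι} {f : ι → Torus d → ℝ}
    (hf : ∀ i ∈ s, SmoothOnTorus (f i)) (a : Fin 3) (x : Torus d) :
    pd a (fun y => ∑ i ∈ s, f i y) x = ∑ i ∈ s, pd a (f i) x := by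
  obtain ⟨γ, -, hγ⟩ := exists_hasDerivAt_pd a x
  exact (hγ _ (SmoothOnTorus.sum hf)).unique (HasDerivAt.fun_sum fun i hi => hγ (f i) (hf i hi))

theorem pd_const_sub_comp (hf : SmoothOnTorus f) (a : Fin 3) (x y : Torus d) :
    pd a (fun y => f (x - y)) y = -pd a f (x - y) := by
  by_cases ha : (a : ℕ) < d
  · rw [pd_of_lt ha]
    have h1 := hf.hasDerivAt_pdi ⟨a, ha⟩ (x - y)
    have h2 := HasDerivAt.scomp (0 : ℝ) (h := fun s : ℝ => -s) (by simpa using h1) (hasDerivAt_neg (0:ℝ))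
    have h3 := (hf.const_sub_comp x).hasDerivAt_pdi ⟨a, ha⟩ y
    refine h3.unique ?_
    convert h2 using 1
    · ext s
      simp only [Function.comp, AddCircle.coe_neg, Pi.single_neg]
      congr 1; abel
    · simp
  · rw [pd_of_not_lt ha]; simp

end Rules

/-! ### Convolution -/

/-- The convolution of a kernel with an integrable function on the torus. -/
noncomputable def conv (K f : Torus d → ℝ) (x : Torus d) : ℝ := ∫ y, K (x - y) * f y

theorem integrable_kernel_mul {K f : Torus d → ℝ} (hK : Continuous K) (hf : Integrable f)
    (x : Torus d) : Integrable (fun y => K (x - y) * f y) := by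
  obtain ⟨C, hC⟩ := isCompact_univ.exists_bound_of_continuousOn hK.continuousOn
  exact hf.bdd_mul (hK.comp (continuous_const.sub continuous_id)).aestronglyMeasurable
    (Eventually.of_forall fun y => hC _ (mem_univ _))

/-- The derivative of `v ↦ K (v - y)`. -/
noncomputable def kernelDeriv (K : Torus d → ℝ) (v : Fin d → ℝ) (y : Torus d) :
    (Fin d → ℝ) →L[ℝ] ℝ := ∑ i, pdi i K (toTorus v - y) • coordProj i

theorem hasFDerivAt_kernel {K : Torus d → ℝ} (hK : SmoothOnTorus K) (v : Fin d → ℝ)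
    (y : Torus d) : HasFDerivAt (fun v => K (toTorus v - y)) (kernelDeriv K v y) v := by
  have h1 := (hK.const_add_comp (-y)).hasFDerivAt v
  have h2 : ∀ i, pdi i (fun z => K (-y + z)) (toTorus v) = pdi i K (toTorus v - y) := fun i => by
    simp only [pdi]; congr 1; ext s; congr 1; abel
  simp only [h2] at h1
  simp only [neg_add_eq_sub] at h1
  exact h1

theorem integral_sum_smul_const {ι α E : Type*} [Fintype ι] [MeasurableSpace α] {μ : Measure α}
    [NormedAddCommGroup E] [NormedSpace ℝ E] [CompleteSpace E] {g : ι → α → ℝ} (c : ι → E)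
    (hg : ∀ i, Integrable (g i) μ) :
    Integrable (fun y => ∑ i, g i y • c i) μ ∧
      ∫ y, ∑ i, g i y • c i ∂μ = ∑ i, (∫ y, g i y ∂μ) • c i := by
  refine ⟨integrable_finsetSum _ fun i _ => (hg i).smul_const _, ?_⟩
  rw [integral_finsetSum _ fun i _ => (hg i).smul_const _]
  simp only [integral_smul_const]

theorem hasFDerivAt_conv {K f : Torus d → ℝ} (hK : SmoothOnTorus K) (hf : Integrable f)
    (v : Fin d → ℝ) :
    HasFDerivAt (fun v => conv K f (toTorus v))
      (∑ i, conv (pdi i K) f (toTorus v) • coordProj i) v := by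
  choose C hC using fun i => (hK.pdi i).exists_bound
  have hbound : ∀ w y, ‖f y • kernelDeriv K w y‖ ≤ (∑ i, C i * ‖coordProj i‖) * ‖f y‖ := by
    intro w y
    rw [norm_smul, mul_comm]
    gcongr
    refine (norm_sum_le _ _).trans (Finset.sum_le_sum fun i _ => ?_)
    rw [norm_smul]
    gcongr
    exact hC i _
  have heq : ∀ w y, f y • kernelDeriv K w y =
      ∑ i, (pdi i K (toTorus w - y) * f y) • coordProj i := by
    intro w y
    rw [kernelDeriv, Finset.smul_sum]
    exact Finset.sum_congr rfl fun i _ => by rw [smul_smul, mul_comm]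
  have hint := integral_sum_smul_const (coordProj (d := d)) fun i =>
    integrable_kernel_mul (hK.pdi i).continuous hf (toTorus v)
  simp only [← heq] at hint
  have hderiv : ∀ w y, HasFDerivAt (fun w => K (toTorus w - y) * f y)
      (f y • kernelDeriv K w y) w := by
    intro w y
    have := HasFDerivAt.mul_const (c := fun w : Fin d → ℝ => K (toTorus w - y))
      (hasFDerivAt_kernel hK w y) (f y)
    exact this
  have key : HasFDerivAt (fun v => conv K f (toTorus v)) (∫ y, f y • kernelDeriv K v y) v :=
    hasFDerivAt_integral_of_dominated_of_fderiv_le (F := fun v y => K (toTorus v - y) * f y)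
      (F' := fun v y => f y • kernelDeriv K v y) (s := univ)
      (bound := fun y => (∑ i, C i * ‖coordProj i‖) * ‖f y‖) univ_mem
      (Eventually.of_forall fun w =>
        (integrable_kernel_mul hK.continuous hf _).aestronglyMeasurable)
      (integrable_kernel_mul hK.continuous hf _) hint.1.aestronglyMeasurable
      (Eventually.of_forall fun y w _ => hbound w y) (hf.norm.const_mul _)
      (Eventually.of_forall fun y w _ => hderiv w y)
  exact key.congr_fderiv hint.2

/-- Derivatives fall on the kernel and produce convolutions with `pdi i K`, which is again smooth.
The induction on the order of differentiability therefore has to run over all kernels at once. -/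
theorem SmoothOnTorus.conv {K f : Torus d → ℝ} (hK : SmoothOnTorus K) (hf : Integrable f) :
    SmoothOnTorus (conv K f) := by
  have : ∀ n : ℕ, ∀ K, SmoothOnTorus K → ContDiff ℝ n (fun v => _root_.conv K f (toTorus v)) := by
    intro n
    induction n with
    | zero =>
      intro K hK
      rw [Nat.cast_zero, contDiff_zero]
      exact continuous_iff_continuousAt.2 fun v => (hasFDerivAt_conv hK hf v).continuousAt
    | succ n ih =>
      intro K hK
      refine contDiff_succ_iff_hasFDerivAt.2 ⟨_, ?_, fun v => hasFDerivAt_conv hK hf v⟩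
      exact ContDiff.sum fun i _ => (ih _ (hK.pdi i)).smul contDiff_const
  exact contDiff_infty.2 fun n => this n K hK

theorem pd_conv {K f : Torus d → ℝ} (hK : SmoothOnTorus K) (hf : Integrable f) (a : Fin 3) (x : Torus d) :
    pd a (conv K f) x = conv (pd a K) f x := by
  by_cases ha : (a : ℕ) < d
  · rw [pd_of_lt ha]
    obtain ⟨v, rfl⟩ := toTorus_surjective x
    rw [(hK.conv hf).pdi_toTorus, (hasFDerivAt_conv hK hf v).fderiv]
    simp [coordProj_apply, Pi.single_apply]
  · rw [pd_of_not_lt ha]; simp [conv]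

theorem conv_comm (K f : Torus d → ℝ) : conv K f = conv f K := by
  ext x
  rw [conv, conv, ← integral_sub_left_eq_self _ _ x]
  simp [mul_comm]

/-- Translation invariance in disguise: convolution with the constant `1` turns `f` into the
constant `∫ f`, whose derivative is zero, while differentiating the kernel gives `∫ pd a f`. -/
theorem integral_pd {f : Torus d → ℝ} (hf : SmoothOnTorus f) (a : Fin 3) :
    ∫ x, pd a f x = 0 := by
  have h1 : conv f (fun _ => 1) = fun _ => ∫ y, f y := by
    ext x
    simp only [conv, mul_one]
    exact integral_sub_left_eq_self f volume x
  have h2 := pd_conv hf (integrable_const (1 : ℝ)) a 0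
  rw [h1, pd_const] at h2
  simp only [conv, mul_one] at h2
  rw [h2, integral_sub_left_eq_self (pd a f) volume 0]

theorem integral_pd_mul {f g : Torus d → ℝ} (hf : SmoothOnTorus f) (hg : SmoothOnTorus g)
    (a : Fin 3) : ∫ x, pd a f x * g x = -∫ x, f x * pd a g x := by
  have h := integral_pd (hf.mul hg) a
  simp only [pd_mul hf hg] at h
  rw [integral_add ((hf.pd a).mul hg).integrable (hf.mul (hg.pd a)).integrable] at h
  linarith

theorem integral_mul_conv {K f g : Torus d → ℝ} (hK : Continuous K) (hf : Integrable f)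
    (hg : Integrable g) (heven : ∀ x, K (-x) = K x) :
    ∫ x, f x * conv K g x = ∫ x, conv K f x * g x := by
  have hint : Integrable (fun p : Torus d × Torus d => f p.1 * (K (p.1 - p.2) * g p.2)) := by
    obtain ⟨C, hC⟩ := isCompact_univ.exists_bound_of_continuousOn hK.continuousOn
    have := (hf.mul_prod hg).bdd_mul
      (f := fun p : Torus d × Torus d => K (p.1 - p.2)) (by fun_prop)
      (Eventually.of_forall fun y => hC _ (mem_univ _))
    refine this.congr (Eventually.of_forall fun p => ?_)
    simp only; ring
  simp only [conv, ← integral_const_mul, ← integral_mul_const]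
  rw [integral_integral_swap hint]
  refine integral_congr_ae (Eventually.of_forall fun y => ?_)
  refine integral_congr_ae (Eventually.of_forall fun x => ?_)
  simp only
  rw [← heven (x - y), neg_sub]; ring

end TorusBasics

/-! ### Periodization and mollifiers -/

section Mollifier

variable {d : ℕ}

theorem volume_torus_eq_pi_haar :
    (volume : Measure (Torus d)) = Measure.pi fun _ => AddCircle.haarAddCircle := by
  rw [volume_pi]
  congr 1
  ext1 i
  rw [AddCircle.volume_eq_smul_haarAddCircle]
  simp

theorem integral_torus {E : Type*} [NormedAddCommGroup E] [NormedSpace ℝ E]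
    (f : Torus d → E) (a : Fin d → ℝ) :
    ∫ x, f x = ∫ x in {x : Fin d → ℝ | ∀ i, x i ∈ Ioc (a i) (a i + 1)}, f (toTorus x) := by
  rw [volume_torus_eq_pi_haar]
  exact UnitAddTorus.integral_preimage f a

/-- The representative of a point of the torus in `(-1/2, 1/2]^d`. -/
noncomputable def torusRep (x : Torus d) : Fin d → ℝ :=
  fun i => (AddCircle.equivIoc 1 (-1 / 2 : ℝ) (x i) : ℝ)

theorem toTorus_torusRep (x : Torus d) : toTorus (torusRep x) = x := by
  ext i
  exact (AddCircle.equivIoc 1 (-1 / 2 : ℝ)).symm_apply_apply (x i)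

theorem abs_torusRep_le (x : Torus d) (i : Fin d) : |torusRep x i| ≤ 1 / 2 := by
  have h := (AddCircle.equivIoc 1 (-1 / 2 : ℝ) (x i)).2
  rw [abs_le]
  constructor
  · have := h.1; simp only [torusRep]; linarith
  · have := h.2; simp only [torusRep]; linarith

theorem exists_int_of_toTorus_eq {v w : Fin d → ℝ} (h : toTorus v = toTorus w) (i : Fin d) :
    ∃ n : ℤ, v i - w i = n := by
  have h1 : ((v i - w i : ℝ) : UnitAddCircle) = 0 := by
    have := congrFun h i
    simp only [toTorus] at this
    rw [AddCircle.coe_sub, this, sub_self]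
  obtain ⟨n, hn⟩ := (AddCircle.coe_eq_zero_iff (1 : ℝ)).1 h1
  exact ⟨n, by simpa using hn.symm⟩

theorem toTorus_int (k : Fin d → ℤ) : toTorus (fun i => (k i : ℝ)) = 0 := by
  ext i
  exact (AddCircle.coe_eq_zero_iff (1 : ℝ)).2 ⟨k i, by simp⟩

/-- The periodization of a function supported near the origin. -/
noncomputable def periodize (G : (Fin d → ℝ) → ℝ) (x : Torus d) : ℝ := G (torusRep x)

/-- If `r` is not its own representative, some coordinate of the two differs by at least `1`. The
bounds `1/2` and `5/8` then put both points outside the ball of radius `1/4`, where `G` vanishes.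
Allowing `5/8` rather than `1/2` leaves room for open neighbourhoods of the closed fundamental cube.
-/
theorem periodize_toTorus {G : (Fin d → ℝ) → ℝ} (hG : ∀ v, 1 / 4 < ‖v‖ → G v = 0)
    {r : Fin d → ℝ} (hr : ∀ i, |r i| ≤ 5 / 8) : periodize G (toTorus r) = G r := by
  by_cases h : torusRep (toTorus r) = r
  · rw [periodize, h]
  · obtain ⟨i, hi⟩ := Function.ne_iff.1 h
    obtain ⟨n, hn⟩ := exists_int_of_toTorus_eq (toTorus_torusRep (toTorus r)) i
    have hn0 : n ≠ 0 := by
      rintro rfl; exact hi (sub_eq_zero.1 (by simpa using hn))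
    have h1 : (1 : ℝ) ≤ |torusRep (toTorus r) i - r i| := by
      rw [hn]; exact_mod_cast Int.one_le_abs hn0
    have h2 := abs_torusRep_le (toTorus r) i
    have h3 := hr i
    have h4 := abs_sub (torusRep (toTorus r) i) (r i)
    have h5 := norm_le_pi_norm (torusRep (toTorus r)) i
    have h6 := norm_le_pi_norm r i
    rw [Real.norm_eq_abs] at h5 h6
    rw [periodize, hG _ (by linarith), hG _ (by linarith)]

theorem smoothOnTorus_periodize {G : (Fin d → ℝ) → ℝ} (hG : ∀ v, 1 / 4 < ‖v‖ → G v = 0)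
    (hs : ContDiff ℝ ∞ G) : SmoothOnTorus (periodize G) := by
  rw [SmoothOnTorus, contDiff_iff_contDiffAt]
  intro v
  -- Subtracting the nearest integer vector puts `v` in the cube `[-1/2, 1/2]^d`, so nearby points
  -- stay within `5/8`, where the periodization agrees with `G`.
  set k : Fin d → ℝ := fun i => (round (v i) : ℝ)
  have hk : ∀ w, toTorus w = toTorus (w - k) := fun w => by
    have : toTorus w = toTorus (w - k) + toTorus k := by rw [← toTorus_add, sub_add_cancel]
    rw [this, toTorus_int, add_zero]
  have h1 : ContDiffAt ℝ ∞ (fun w => G (w - k)) v :=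
    (hs.comp (contDiff_id.sub contDiff_const)).contDiffAt
  refine h1.congr_of_eventuallyEq ?_
  have h2 : ∀ᶠ w in 𝓝 v, ∀ i, |w i - k i| < 5 / 8 := by
    rw [eventually_all]
    intro i
    have hc : Continuous fun w : Fin d → ℝ => |w i - k i| := by fun_prop
    exact hc.continuousAt.eventually_lt continuousAt_const
      (lt_of_le_of_lt (abs_sub_round (v i)) (by norm_num))
  filter_upwards [h2] with w hw
  rw [hk w]
  exact periodize_toTorus hG fun i => (hw i).le

/-- The directional derivative in the coordinate direction `i`. -/
noncomputable def dirDeriv (i : Fin d) (G : (Fin d → ℝ) → ℝ) (v : Fin d → ℝ) : ℝ :=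
  fderiv ℝ G v (Pi.single i 1)

theorem contDiff_dirDeriv {G : (Fin d → ℝ) → ℝ} (hs : ContDiff ℝ ∞ G) (i : Fin d) :
    ContDiff ℝ ∞ (dirDeriv i G) :=
  (hs.fderiv_right (m := ∞) (by simp)).clm_apply contDiff_const

theorem dirDeriv_eq_zero {G : (Fin d → ℝ) → ℝ} {r : ℝ} (hG : ∀ v, r < ‖v‖ → G v = 0) (i : Fin d) :
    ∀ v, r < ‖v‖ → dirDeriv i G v = 0 := by
  intro v hv
  have : G =ᶠ[𝓝 v] fun _ => 0 := by
    filter_upwards [continuous_norm.continuousAt.eventually (lt_mem_nhds hv)] with w hw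
    exact hG w hw
  rw [dirDeriv, this.fderiv_eq]
  simp

theorem pdi_periodize {G : (Fin d → ℝ) → ℝ} (hG : ∀ v, 1 / 4 < ‖v‖ → G v = 0)
    (hs : ContDiff ℝ ∞ G) (i : Fin d) : pdi i (periodize G) = periodize (dirDeriv i G) := by
  ext x
  have hx := toTorus_torusRep x
  set r := torusRep x with hr
  have h1 : HasDerivAt (fun s : ℝ => r + s • Pi.single i (1 : ℝ)) (Pi.single i 1) 0 := by
    simpa using ((hasDerivAt_id (0 : ℝ)).smul_const (Pi.single i (1 : ℝ))).const_add r
  have h2 : HasFDerivAt G (fderiv ℝ G r) (r + (0 : ℝ) • Pi.single i (1 : ℝ)) := by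
    simpa using (hs.differentiable (by simp) r).hasFDerivAt
  have h3 := h2.comp_hasDerivAt (0 : ℝ) h1
  have h4 : (fun s : ℝ => periodize G (x + Pi.single i (s : UnitAddCircle))) =ᶠ[𝓝 0]
      G ∘ fun s : ℝ => r + s • Pi.single i (1 : ℝ) := by
    -- `1/8` is the margin between the size `1/2` of a representative and the admissible `5/8`.
    have h5 : ∀ᶠ s : ℝ in 𝓝 0, |s| < 1 / 8 := by
      have hc : Continuous fun s : ℝ => |s| := by fun_prop
      exact hc.continuousAt.eventually_lt continuousAt_const (by norm_num)
    filter_upwards [h5] with s hs'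
    have h6 : x + Pi.single i (s : UnitAddCircle) = toTorus (r + s • Pi.single i (1 : ℝ)) := by
      rw [toTorus_add, hx, ← toTorus_single]
      congr 2
      ext j
      by_cases hj : j = i
      · subst hj; simp
      · simp [hj]
    rw [h6, periodize_toTorus hG]
    · rfl
    · intro j
      have h7 := abs_torusRep_le x j
      rw [← hr] at h7
      by_cases hj : j = i
      · subst hj
        simp only [Pi.add_apply, Pi.smul_apply, Pi.single_eq_same, smul_eq_mul, mul_one]
        have := abs_add_le (r j) s
        linarith
      · simp [hj]; linarith
  rw [pdi, h4.deriv_eq, h3.deriv]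
  rfl

theorem integral_periodize {G : (Fin d → ℝ) → ℝ} (hG : ∀ v, 1 / 4 < ‖v‖ → G v = 0) :
    ∫ x, periodize G x = ∫ v, G v := by
  rw [integral_torus _ fun _ => -1 / 2]
  have hcube : ∀ v ∈ {x : Fin d → ℝ | ∀ i, x i ∈ Ioc ((-1 / 2 : ℝ)) (-1 / 2 + 1)},
      periodize G (toTorus v) = G v := by
    intro v hv
    refine periodize_toTorus hG fun i => abs_le.2 ⟨?_, ?_⟩
    · linarith [(hv i).1]
    · linarith [(hv i).2]
  rw [setIntegral_congr_fun (MeasurableSet.univ_pi' fun i => measurableSet_Ioc) hcube]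
  refine setIntegral_eq_integral_of_forall_compl_eq_zero fun v hv => hG v ?_
  simp only [mem_ofPred_eq, not_forall, mem_Ioc, not_and_or, not_lt, not_le] at hv
  obtain ⟨i, hi⟩ := hv
  have h1 := norm_le_pi_norm v i
  rw [Real.norm_eq_abs] at h1
  rcases hi with hi | hi
  · have := neg_abs_le (v i); linarith
  · have := le_abs_self (v i); linarith

/-- Rescaling of a kernel to the length scale `ε`. -/
noncomputable def rescale (ε : ℝ) (G : (Fin d → ℝ) → ℝ) (v : Fin d → ℝ) : ℝ :=
  (ε ^ d)⁻¹ * G (ε⁻¹ • v)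

theorem rescale_eq_zero {G : (Fin d → ℝ) → ℝ} {r ε : ℝ} (hε : 0 < ε)
    (hG : ∀ v, r < ‖v‖ → G v = 0) : ∀ v, ε * r < ‖v‖ → rescale ε G v = 0 := by
  intro v hv
  rw [rescale, hG, mul_zero]
  rw [norm_smul, norm_inv, Real.norm_of_nonneg hε.le]
  rwa [lt_inv_mul_iff₀ hε]

theorem contDiff_rescale {G : (Fin d → ℝ) → ℝ} (hs : ContDiff ℝ ∞ G) (ε : ℝ) :
    ContDiff ℝ ∞ (rescale ε G) :=
  contDiff_const.mul (hs.comp (contDiff_const_smul ε⁻¹))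

theorem dirDeriv_rescale {G : (Fin d → ℝ) → ℝ} (hs : ContDiff ℝ ∞ G) (ε : ℝ) (i : Fin d)
    (v : Fin d → ℝ) : dirDeriv i (rescale ε G) v = ε⁻¹ * rescale ε (dirDeriv i G) v := by
  have h1 : HasFDerivAt (fun v : Fin d → ℝ => ε⁻¹ • v)
      (ε⁻¹ • ContinuousLinearMap.id ℝ (Fin d → ℝ)) v := (hasFDerivAt_id v).const_smul ε⁻¹
  have h2 := ((hs.differentiable (by simp) (ε⁻¹ • v)).hasFDerivAt.comp v h1).const_mul (ε ^ d)⁻¹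
  have h3 : fderiv ℝ (rescale ε G) v = _ := h2.fderiv
  rw [dirDeriv, h3]
  simp [rescale, dirDeriv]
  ring

theorem torusLength_le {x : Torus d} {r : ℝ} (hr : ∀ i, ‖x i‖ ≤ r) (hr0 : 0 ≤ r) :
    torusLength x ≤ (d + 1) * r := by
  rw [torusLength]
  refine Real.sqrt_le_iff.2 ⟨by positivity, ?_⟩
  calc ∑ i, ‖x i‖ ^ 2 ≤ ∑ _i : Fin d, r ^ 2 :=
        Finset.sum_le_sum fun i _ => by gcongr; exact hr i
    _ = d * r ^ 2 := by simp
    _ ≤ ((d + 1) * r) ^ 2 := by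
        rw [mul_pow]; gcongr; nlinarith [(Nat.cast_nonneg d : (0 : ℝ) ≤ d)]

theorem continuous_torusLength : Continuous (torusLength : Torus d → ℝ) := by
  unfold torusLength; fun_prop

theorem torusLength_zero : torusLength (0 : Torus d) = 0 := by simp [torusLength]

theorem norm_apply_le_torusLength (x : Torus d) (i : Fin d) : ‖x i‖ ≤ torusLength x := by
  rw [torusLength]
  refine Real.le_sqrt_of_sq_le ?_
  exact Finset.single_le_sum (f := fun i => ‖x i‖ ^ 2) (fun i _ => sq_nonneg _) (Finset.mem_univ i)

theorem torusLength_toTorus_le (v : Fin d → ℝ) : torusLength (toTorus v) ≤ (d + 1) * ‖v‖ := by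
  refine torusLength_le (fun i => ?_) (norm_nonneg v)
  have h1 : ‖(v i : UnitAddCircle)‖ ≤ ‖v i‖ := by
    exact QuotientAddGroup.norm_mk_le_norm
  exact h1.trans (norm_le_pi_norm v i)

/-- The ball of radius `ε` around the origin of the torus. -/
def torusBall (d : ℕ) (ε : ℝ) : Set (Torus d) := {y | torusLength y < ε}

theorem isOpen_torusBall (ε : ℝ) : IsOpen (torusBall d ε) :=
  isOpen_lt continuous_torusLength continuous_const

theorem measureReal_torusBall_pos {ε : ℝ} (hε : 0 < ε) :
    0 < (volume : Measure (Torus d)).real (torusBall d ε) := by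
  rw [measureReal_def, ENNReal.toReal_pos_iff]
  refine ⟨(isOpen_torusBall ε).measure_pos _ ⟨0, ?_⟩, measure_lt_top _ _⟩
  rwa [torusBall, mem_ofPred_eq, torusLength_zero]

theorem measureReal_torusBall_le {ε : ℝ} (hε : 0 < ε) :
    (volume : Measure (Torus d)).real (torusBall d ε) ≤ (2 * ε) ^ d := by
  have h1 : torusBall d ε ⊆ univ.pi fun _ => Metric.closedBall (0 : UnitAddCircle) ε := by
    intro x hx i _
    rw [mem_closedBall_zero_iff]
    exact (norm_apply_le_torusLength x i).trans (le_of_lt hx)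
  refine ENNReal.toReal_le_of_le_ofReal (by positivity) ((measure_mono h1).trans ?_)
  rw [volume_pi_pi]
  simp only [AddCircle.volume_closedBall, Finset.prod_const, Finset.card_univ, Fintype.card_fin]
  rw [← ENNReal.ofReal_pow (by positivity)]
  · gcongr
    exact min_le_right _ _

/-- A kernel `K` of size `A / |B_ε|` supported in the ball `B_ε`. -/
structure KernelBound (ε A : ℝ) (K : Torus d → ℝ) : Prop where
  abs_le : ∀ x, |K x| ≤ A * ((volume : Measure (Torus d)).real (torusBall d ε))⁻¹
  support : ∀ x, x ∉ torusBall d ε → K x = 0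

/-- The torus length is at most `d + 1` times the sup norm, so the rescaled support lies within
`ε/4` of the origin. The height `ε^{-d}` is comparable to the inverse volume because `B_ε` fits into
a cube of side `2ε`, whence the factor `2^d`. -/
theorem kernelBound_periodize {G : (Fin d → ℝ) → ℝ} {C ε : ℝ} (hC0 : 0 ≤ C) (hC : ∀ v, |G v| ≤ C)
    (hG : ∀ v, 1 / (4 * (d + 1) : ℝ) < ‖v‖ → G v = 0) (hε : 0 < ε) :
    KernelBound ε (2 ^ d * C) (periodize (rescale ε G)) := by
  constructor
  · intro x
    rw [periodize, rescale, abs_mul, abs_of_nonneg (by positivity : 0 ≤ (ε ^ d)⁻¹)]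
    have h1 := measureReal_torusBall_le (d := d) hε
    have h2 := measureReal_torusBall_pos (d := d) hε
    calc (ε ^ d)⁻¹ * |G (ε⁻¹ • torusRep x)| ≤ (ε ^ d)⁻¹ * C := by gcongr; exact hC _
      _ = 2 ^ d * C * ((2 * ε) ^ d)⁻¹ := by rw [mul_pow]; field_simp
      _ ≤ _ := by gcongr
  · intro x hx
    by_contra hne
    refine hx ?_
    have h1 : ‖torusRep x‖ ≤ ε * (1 / (4 * (d + 1))) := by
      by_contra hlt
      exact hne (rescale_eq_zero hε hG _ (not_le.1 hlt))
    have h2 := torusLength_toTorus_le (torusRep x)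
    rw [toTorus_torusRep] at h2
    refine h2.trans_lt ?_
    calc (d + 1 : ℝ) * ‖torusRep x‖ ≤ (d + 1) * (ε * (1 / (4 * (d + 1)))) := by gcongr
      _ = ε / 4 := by field_simp
      _ < ε := by linarith

theorem exists_abs_le_of_eq_zero {G : (Fin d → ℝ) → ℝ} (hs : ContDiff ℝ ∞ G) {r : ℝ}
    (hG : ∀ v, r < ‖v‖ → G v = 0) : ∃ C, 0 ≤ C ∧ ∀ v, |G v| ≤ C := by
  have h1 : HasCompactSupport G := by
    refine HasCompactSupport.intro (isCompact_closedBall (0 : Fin d → ℝ) r) fun v hv => hG v ?_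
    simpa using hv
  obtain ⟨C, hC⟩ := h1.exists_bound_of_continuous hs.continuous
  exact ⟨C, (norm_nonneg _).trans (hC 0), hC⟩

/-- A mollifier at scale `ε`, with constant `C`. -/
structure IsMollifier (C ε : ℝ) (η : Torus d → ℝ) : Prop where
  smooth : SmoothOnTorus η
  even : ∀ x, η (-x) = η x
  nonneg : ∀ x, 0 ≤ η x
  integral_eq_one : ∫ x, η x = 1
  bound : KernelBound ε C η
  bound_pd : ∀ a, KernelBound ε (C * ε⁻¹) (pd a η)
  bound_pd_pd : ∀ a b, KernelBound ε (C * (ε⁻¹ * ε⁻¹)) (pd a (pd b η))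

theorem KernelBound.const_mul {ε A c : ℝ} {K : Torus d → ℝ} (h : KernelBound ε A K) (hc : 0 ≤ c) :
    KernelBound ε (A * c) (fun x => c * K x) := by
  refine ⟨fun x => ?_, fun x hx => by simp [h.support x hx]⟩
  rw [abs_mul, abs_of_nonneg hc, mul_comm A, mul_assoc]
  gcongr
  exact h.abs_le x

theorem KernelBound.mono {ε A B : ℝ} {K : Torus d → ℝ} (h : KernelBound ε A K) (hAB : A ≤ B) :
    KernelBound ε B K :=
  ⟨fun x => (h.abs_le x).trans (by gcongr), h.support⟩

theorem KernelBound.zero {ε A : ℝ} (hA : 0 ≤ A) : KernelBound ε A (0 : Torus d → ℝ) :=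
  ⟨fun x => by simp only [Pi.zero_apply, abs_zero]; positivity, fun _ _ => rfl⟩

theorem pdi_periodize_rescale {G : (Fin d → ℝ) → ℝ} {r ε : ℝ} (hr : r ≤ 1 / 4) (hε : 0 < ε)
    (hε1 : ε ≤ 1) (hs : ContDiff ℝ ∞ G) (hG : ∀ v, r < ‖v‖ → G v = 0) (i : Fin d) :
    pdi i (periodize (rescale ε G)) = fun x => ε⁻¹ * periodize (rescale ε (dirDeriv i G)) x := by
  have h1 : ∀ v, 1 / 4 < ‖v‖ → rescale ε G v = 0 := fun v hv =>
    rescale_eq_zero hε hG v (by nlinarith [norm_nonneg v])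
  rw [pdi_periodize h1 (contDiff_rescale hs ε)]
  ext x
  rw [periodize, dirDeriv_rescale hs, periodize]

theorem pdi_const_mul (i : Fin d) (c : ℝ) (f : Torus d → ℝ) :
    pdi i (fun x => c * f x) = fun x => c * pdi i f x := by
  ext x; simp [pdi]

theorem exists_mollifier (d : ℕ) : ∃ C : ℝ, 0 ≤ C ∧ ∀ ε : ℝ, 0 < ε → ε ≤ 1 →
    ∃ η : Torus d → ℝ, IsMollifier C ε η := by
  -- The outer radius is exactly the support size demanded by `kernelBound_periodize`.
  let b : ContDiffBump (0 : Fin d → ℝ) :=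
    ⟨1 / (8 * (d + 1)), 1 / (4 * (d + 1)), by positivity, by gcongr; norm_num⟩
  set r : ℝ := 1 / (4 * (d + 1)) with hr
  have hr4 : r ≤ 1 / 4 := by
    rw [hr]; gcongr; linarith [(Nat.cast_nonneg d : (0 : ℝ) ≤ d)]
  set g : (Fin d → ℝ) → ℝ := b.normed volume with hg
  have hgs : ContDiff ℝ ∞ g := b.contDiff_normed
  have hg0 : ∀ v, r < ‖v‖ → g v = 0 := by
    intro v hv
    have : v ∉ Function.support g := by
      rw [hg, b.support_normed_eq, mem_ball_zero_iff, not_lt]; exact hv.le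
    simpa using this
  obtain ⟨C0, hC00, hC0⟩ := exists_abs_le_of_eq_zero hgs hg0
  choose C1 hC10 hC1 using fun i => exists_abs_le_of_eq_zero (contDiff_dirDeriv hgs i)
    (dirDeriv_eq_zero hg0 i)
  choose C2 hC20 hC2 using fun i j => exists_abs_le_of_eq_zero
    (contDiff_dirDeriv (contDiff_dirDeriv hgs j) i) (dirDeriv_eq_zero (dirDeriv_eq_zero hg0 j) i)
  -- One constant serves the kernel and its first and second derivatives. It is fixed before `ε`,
  -- since rescaling affects derivatives only through powers of `ε⁻¹`.
  set C : ℝ := 2 ^ d * (C0 + ∑ i, C1 i + ∑ i, ∑ j, C2 i j) with hC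
  have hS1 : ∀ i, C1 i ≤ ∑ i, C1 i := fun i =>
    Finset.single_le_sum (fun i _ => hC10 i) (Finset.mem_univ i)
  have hS2 : ∀ i j, C2 i j ≤ ∑ i, ∑ j, C2 i j := fun i j =>
    (Finset.single_le_sum (f := fun j => C2 i j) (fun j _ => hC20 i j) (Finset.mem_univ j)).trans
    (Finset.single_le_sum (f := fun i => ∑ j, C2 i j)
      (fun i _ => Finset.sum_nonneg fun j _ => hC20 i j) (Finset.mem_univ i))
  have hP1 : 0 ≤ ∑ i, C1 i := Finset.sum_nonneg fun i _ => hC10 i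
  have hP2 : 0 ≤ ∑ i, ∑ j, C2 i j := Finset.sum_nonneg fun i _ => Finset.sum_nonneg fun j _ => hC20 i j
  have hCpos : 0 ≤ C := by positivity
  refine ⟨C, hCpos, fun ε hε hε1 => ⟨periodize (rescale ε g), ?_⟩⟩
  have h4 : ∀ v, 1 / 4 < ‖v‖ → rescale ε g v = 0 := fun v hv =>
    rescale_eq_zero hε hg0 v (by nlinarith [norm_nonneg v])
  have hε0 : 0 ≤ ε⁻¹ := by positivity
  refine ⟨smoothOnTorus_periodize h4 (contDiff_rescale hgs ε), ?_, ?_, ?_, ?_, ?_, ?_⟩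
  · intro x
    have h5 : -x = toTorus (-torusRep x) := by rw [toTorus_neg, toTorus_torusRep]
    rw [h5, periodize_toTorus h4, periodize, rescale, rescale, smul_neg, hg, b.normed_neg]
    intro i
    have := abs_torusRep_le x i
    rw [Pi.neg_apply, abs_neg]; linarith
  · intro x
    rw [periodize, rescale]
    have := b.nonneg_normed (μ := volume) (ε⁻¹ • torusRep x)
    positivity
  · rw [integral_periodize h4]
    simp only [rescale]
    rw [integral_const_mul, Measure.integral_comp_inv_smul_of_nonneg _ _ hε.le]
    simp only [Module.finrank_fintype_fun_eq_card, Fintype.card_fin, smul_eq_mul]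
    rw [hg, b.integral_normed, mul_one, inv_mul_cancel₀ (by positivity)]
  · refine (kernelBound_periodize hC00 hC0 hg0 hε).mono ?_
    rw [hC]; gcongr; linarith
  · intro a
    by_cases ha : (a : ℕ) < d
    · rw [pd_of_lt ha, pdi_periodize_rescale hr4 hε hε1 hgs hg0]
      refine ((kernelBound_periodize (hC10 _) (hC1 _) (dirDeriv_eq_zero hg0 _) hε).const_mul
        hε0).mono ?_
      rw [hC]; gcongr; linarith [hS1 ⟨a, ha⟩]
    · rw [pd_of_not_lt ha]; exact KernelBound.zero (by positivity)
  · intro a c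
    by_cases ha : (a : ℕ) < d
    · by_cases hc : (c : ℕ) < d
      · rw [pd_of_lt ha, pd_of_lt hc, pdi_periodize_rescale hr4 hε hε1 hgs hg0, pdi_const_mul,
          pdi_periodize_rescale hr4 hε hε1 (contDiff_dirDeriv hgs _) (dirDeriv_eq_zero hg0 _)]
        have := ((kernelBound_periodize (hC20 ⟨a, ha⟩ ⟨c, hc⟩) (hC2 _ _)
          (dirDeriv_eq_zero (dirDeriv_eq_zero hg0 _) _) hε).const_mul
          (mul_nonneg hε0 hε0)).mono (B := C * (ε⁻¹ * ε⁻¹))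
          (by rw [hC]; gcongr; linarith [hS2 ⟨a, ha⟩ ⟨c, hc⟩])
        simpa only [mul_assoc] using this
      · have h0 : pd a (0 : Torus d → ℝ) = 0 := by ext x; exact pd_const a 0 x
        rw [pd_of_not_lt hc, Pi.zero_apply, h0]; exact KernelBound.zero (by positivity)
    · rw [pd_of_not_lt ha]; exact KernelBound.zero (by positivity)

end Mollifier

/-! ### Weak curl and divergence of mollified fields -/

section Fields

variable {d : ℕ}

/-- The curl of a field given by its components. -/
noncomputable def scurl (w : Fin 3 → Torus d → ℝ) : Fin 3 → Torus d → ℝ :=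
  ![fun x => pd 1 (w 2) x - pd 2 (w 1) x, fun x => pd 2 (w 0) x - pd 0 (w 2) x,
    fun x => pd 0 (w 1) x - pd 1 (w 0) x]

theorem scurl_zero (w : Fin 3 → Torus d → ℝ) :
    scurl w 0 = fun x => pd 1 (w 2) x - pd 2 (w 1) x := rfl

theorem scurl_one (w : Fin 3 → Torus d → ℝ) :
    scurl w 1 = fun x => pd 2 (w 0) x - pd 0 (w 2) x := rfl

theorem scurl_two (w : Fin 3 → Torus d → ℝ) :
    scurl w 2 = fun x => pd 0 (w 1) x - pd 1 (w 0) x := rfl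

theorem curl_apply (φ : Torus d → E3) (x : Torus d) (b : Fin 3) :
    curl φ x b = scurl (fun a y => φ y a) b x := by
  fin_cases b <;> rfl

/-- The field with given components. -/
noncomputable def ofComps (w : Fin 3 → Torus d → ℝ) (x : Torus d) : E3 :=
  WithLp.toLp 2 fun a => w a x

theorem ofComps_apply (w : Fin 3 → Torus d → ℝ) (x : Torus d) (a : Fin 3) :
    ofComps w x a = w a x := rfl

theorem smoothOnTorus_ofComps {w : Fin 3 → Torus d → ℝ} (hw : ∀ a, SmoothOnTorus (w a)) :
    SmoothOnTorus (ofComps w) :=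
  contDiff_euclidean.2 fun a => hw a

theorem smoothOnTorus_scurl {w : Fin 3 → Torus d → ℝ} (hw : ∀ a, SmoothOnTorus (w a)) (b : Fin 3) :
    SmoothOnTorus (scurl w b) := by
  fin_cases b
  · exact ((hw 2).pd 1).sub ((hw 1).pd 2)
  · exact ((hw 0).pd 2).sub ((hw 2).pd 0)
  · exact ((hw 1).pd 0).sub ((hw 0).pd 1)

theorem sum_pd_scurl {w : Fin 3 → Torus d → ℝ} (hw : ∀ a, SmoothOnTorus (w a)) (x : Torus d) :
    ∑ b, pd b (scurl w b) x = 0 := by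
  have h : ∀ a b, SmoothOnTorus (pd a (w b)) := fun a b => (hw b).pd a
  simp only [Fin.sum_univ_three, scurl_zero, scurl_one, scurl_two]
  rw [pd_sub (h _ _) (h _ _), pd_sub (h _ _) (h _ _), pd_sub (h _ _) (h _ _),
    pd_comm (hw 2) 1 0, pd_comm (hw 1) 2 0, pd_comm (hw 0) 2 1]
  ring

theorem conv_sub {K f g : Torus d → ℝ} (hK : Continuous K) (hf : Integrable f)
    (hg : Integrable g) (x : Torus d) :
    conv K (fun y => f y - g y) x = conv K f x - conv K g x := by
  simp only [conv, mul_sub]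
  exact integral_sub (integrable_kernel_mul hK hf x) (integrable_kernel_mul hK hg x)

theorem conv_add {K f g : Torus d → ℝ} (hK : Continuous K) (hf : Integrable f)
    (hg : Integrable g) (x : Torus d) :
    conv K (fun y => f y + g y) x = conv K f x + conv K g x := by
  simp only [conv, mul_add]
  exact integral_add (integrable_kernel_mul hK hf x) (integrable_kernel_mul hK hg x)

theorem pd_conv_right {K f : Torus d → ℝ} (hK : Continuous K) (hf : SmoothOnTorus f) (a : Fin 3)
    (x : Torus d) : pd a (conv K f) x = conv K (pd a f) x := by
  have hKi : Integrable K :=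
    hK.integrable_of_hasCompactSupport (HasCompactSupport.of_compactSpace K)
  rw [conv_comm K f, pd_conv hf hKi, conv_comm]

theorem scurl_conv_right {K : Torus d → ℝ} (hK : SmoothOnTorus K) {w : Fin 3 → Torus d → ℝ}
    (hw : ∀ a, SmoothOnTorus (w a)) (b : Fin 3) :
    scurl (fun a => conv K (w a)) b = conv K (scurl w b) := by
  have hc := hK.continuous
  ext x
  have h : ∀ a c, Integrable (pd a (w c)) := fun a c => ((hw c).pd a).integrable
  fin_cases b
  · change pd 1 _ x - pd 2 _ x = conv K (fun x => pd 1 (w 2) x - pd 2 (w 1) x) x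
    rw [pd_conv_right hc (hw _), pd_conv_right hc (hw _), conv_sub hc (h _ _) (h _ _)]
  · change pd 2 _ x - pd 0 _ x = conv K (fun x => pd 2 (w 0) x - pd 0 (w 2) x) x
    rw [pd_conv_right hc (hw _), pd_conv_right hc (hw _), conv_sub hc (h _ _) (h _ _)]
  · change pd 0 _ x - pd 1 _ x = conv K (fun x => pd 0 (w 1) x - pd 1 (w 0) x) x
    rw [pd_conv_right hc (hw _), pd_conv_right hc (hw _), conv_sub hc (h _ _) (h _ _)]

/-- The weak divergence condition is tested with `y ↦ K (x - y)`. -/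
theorem sum_pd_conv_eq_zero {K : Torus d → ℝ} (hK : SmoothOnTorus K) {v : Torus d → E3}
    (hv : ∀ a, Integrable fun y => v y a) (hdiv : WeaklyDivFree v) (x : Torus d) :
    ∑ a, pd a (conv K fun y => v y a) x = 0 := by
  have h1 := hdiv _ (hK.const_sub_comp x)
  simp only [pd_const_sub_comp hK] at h1
  simp only [pd_conv hK (hv _), conv]
  rw [← integral_finsetSum _ fun a _ =>
    integrable_kernel_mul (hK.pd a).continuous (hv a) x, ← neg_eq_zero, ← h1, ← integral_neg]
  congr 1
  ext y
  rw [← Finset.sum_neg_distrib]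
  exact Finset.sum_congr rfl fun a _ => by ring

theorem scurl_conv {K : Torus d → ℝ} (hK : SmoothOnTorus K) {v j : Torus d → E3}
    (hv : ∀ a, Integrable fun y => v y a) (hcurl : IsWeakCurl v j) (b : Fin 3) (x : Torus d) :
    scurl (fun a => conv K fun y => v y a) b x = conv K (fun y => j y b) x := by
  -- The test field is the reflected, translated kernel pointing in direction `b`. It isolates the
  -- component `b` of the current at the point `x`.
  have hs : ∀ a, SmoothOnTorus fun y => if a = b then K (x - y) else 0 := by
    intro a
    by_cases h : a = b
    · simpa [h] using hK.const_sub_comp x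
    · simpa [h] using SmoothOnTorus.const 0
  have h1 := hcurl _ (smoothOnTorus_ofComps hs)
  have hI : ∀ a c, Integrable fun y => pd c K (x - y) * v y a := fun a c =>
    integrable_kernel_mul (hK.pd c).continuous (hv a) x
  have h2 : ∀ c y, pd c (fun y => K (x - y)) y = -pd c K (x - y) := fun c y =>
    pd_const_sub_comp hK c x y
  simp only [curl_apply, ofComps_apply] at h1
  have h0 : ∀ (c : Fin 3) (y : Torus d), pd c (fun _ => (0 : ℝ)) y = 0 := fun c y => pd_const c 0 y
  have h3 : conv K (fun y => j y b) x =
      ∫ y, ∑ a, j y a * (if a = b then K (x - y) else 0) := by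
    rw [conv]
    congr 1
    ext y
    simp [mul_comm]
  rw [h3, h1]
  have key : ∀ c e, pd c (conv K fun y => v y e) x = ∫ y, pd c K (x - y) * v y e := fun c e => by
    rw [pd_conv hK (hv e), conv]
  fin_cases b
  · change pd 1 (conv K fun y => v y 2) x - pd 2 (conv K fun y => v y 1) x = _
    rw [key, key, ← integral_sub (hI _ _) (hI _ _)]
    congr 1
    ext y
    simp [Fin.sum_univ_three, scurl, h2, h0]
    ring
  · change pd 2 (conv K fun y => v y 0) x - pd 0 (conv K fun y => v y 2) x = _
    rw [key, key, ← integral_sub (hI _ _) (hI _ _)]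
    congr 1
    ext y
    simp [Fin.sum_univ_three, scurl, h2, h0]
    ring
  · change pd 0 (conv K fun y => v y 1) x - pd 1 (conv K fun y => v y 0) x = _
    rw [key, key, ← integral_sub (hI _ _) (hI _ _)]
    congr 1
    ext y
    simp [Fin.sum_univ_three, scurl, h2, h0]
    ring

/-! ### The energy flux -/

/-- Smooth solenoidal fields have vanishing energy flux. -/
theorem flux_smooth_eq_zero {u : Fin 3 → Torus d → ℝ} (hu : ∀ a, SmoothOnTorus (u a))
    (hdiv : ∀ x, ∑ a, pd a (u a) x = 0) :
    ∫ x, ∑ a, ∑ b, u a x * u b x * pd a (scurl u b) x = 0 := by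
  have hw := smoothOnTorus_scurl hu
  have hQ : SmoothOnTorus fun x => ∑ a, u a x * u a x := SmoothOnTorus.sum fun a _ => (hu a).mul (hu a)
  -- Integration by parts in direction `a`; the term containing `∑ a, pd a (u a)` drops out.
  have e1 : ∫ x, ∑ a, ∑ b, u a x * u b x * pd a (scurl u b) x =
      ∫ x, -∑ b, scurl u b x * ∑ a, u a x * pd a (u b) x := by
    have hI1 : ∀ a b, Integrable fun x => u a x * u b x * pd a (scurl u b) x := fun a b =>
      (((hu a).mul (hu b)).mul ((hw b).pd a)).integrable
    have hI2 : ∀ a b, Integrable fun x => pd a (fun y => u a y * u b y) x * scurl u b x := fun a b =>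
      ((((hu a).mul (hu b)).pd a).mul (hw b)).integrable
    have h1 : ∀ a b, ∫ x, u a x * u b x * pd a (scurl u b) x =
        -∫ x, pd a (fun y => u a y * u b y) x * scurl u b x := fun a b => by
      rw [integral_pd_mul ((hu a).mul (hu b)) (hw b), neg_neg]
    rw [integral_finsetSum _ fun a _ => integrable_finsetSum _ fun b _ => hI1 a b]
    simp only [integral_finsetSum _ fun b _ => hI1 _ b, h1, Finset.sum_neg_distrib]
    rw [integral_neg]
    simp only [← integral_finsetSum _ fun b _ => hI2 _ b]
    rw [← integral_finsetSum _ fun a _ => integrable_finsetSum _ fun b _ => hI2 a b]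
    congr 2
    ext x
    have := hdiv x
    simp only [pd_mul (hu _) (hu _)]
    simp only [Fin.sum_univ_three] at this ⊢
    linear_combination (u 0 x * scurl u 0 x + u 1 x * scurl u 1 x + u 2 x * scurl u 2 x) * this
  -- With `w = curl u` one has `(u · ∇)u = ∇|u|²/2 − u × w`, and `u × w` is orthogonal to `w`.
  have e2 : ∀ x, ∑ b, scurl u b x * ∑ a, u a x * pd a (u b) x =
      (1 / 2) * ∑ b, pd b (fun x => ∑ a, u a x * u a x) x * scurl u b x := by
    intro x
    have : ∀ b, pd b (fun x => ∑ a, u a x * u a x) x = ∑ a, 2 * (u a x * pd b (u a) x) := fun b => by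
      rw [pd_sum fun a _ => (hu a).mul (hu a)]
      refine Finset.sum_congr rfl fun a _ => ?_
      rw [pd_mul (hu a) (hu a)]; ring
    simp only [this]
    simp only [Fin.sum_univ_three, scurl_zero, scurl_one, scurl_two]
    ring
  -- A gradient is orthogonal in `L²` to a curl, which is divergence-free.
  have e3 : ∫ x, ∑ b, pd b (fun x => ∑ a, u a x * u a x) x * scurl u b x = 0 := by
    rw [integral_finsetSum _ fun b _ => ((hQ.pd b).mul (hw b)).integrable]
    simp only [integral_pd_mul hQ (hw _), Finset.sum_neg_distrib]
    rw [← integral_finsetSum _ fun b _ => (hQ.mul ((hw b).pd b)).integrable]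
    simp only [← Finset.mul_sum, sum_pd_scurl hu]
    simp
  rw [e1, integral_neg]
  simp only [e2]
  rw [integral_const_mul, e3]
  simp

/-- The flux of the field `v` against the doubly mollified field. -/
theorem flux_eq_commutator {η : Torus d → ℝ} (hη : SmoothOnTorus η) (heven : ∀ x, η (-x) = η x)
    {v : Torus d → E3} (hv : ∀ a, Integrable fun y => v y a)
    (hvv : ∀ a b, Integrable fun y => v y a * v y b) (hdiv : WeaklyDivFree v) :
    ∫ x, ∑ a, ∑ b, v x a * v x b *
        pd a (scurl (fun c => conv η (conv η fun y => v y c)) b) x =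
      ∫ x, ∑ a, ∑ b, (conv η (fun y => v y a * v y b) x -
        conv η (fun y => v y a) x * conv η (fun y => v y b) x) *
          pd a (scurl (fun c => conv η fun y => v y c) b) x := by
  set u : Fin 3 → Torus d → ℝ := fun c => conv η fun y => v y c with hu_def
  have hu : ∀ a, SmoothOnTorus (u a) := fun a => hη.conv (hv a)
  have hw := smoothOnTorus_scurl hu
  -- The flux of the mollified field is zero, so subtracting it costs nothing and creates the
  -- commutator.
  have h0 := flux_smooth_eq_zero hu (sum_pd_conv_eq_zero hη hv hdiv)
  have h1 : ∀ a b x, pd a (scurl (fun c => conv η (conv η fun y => v y c)) b) x =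
      conv η (pd a (scurl u b)) x := by
    intro a b x
    rw [show (fun c => conv η (conv η fun y => v y c)) = fun c => conv η (u c) from rfl]
    rw [scurl_conv_right hη hu, pd_conv_right hη.continuous (hw b)]
  -- Evenness makes mollification self-adjoint; one of the two mollifiers moves onto the quadratic
  -- term.
  have h2 : ∀ a b, ∫ x, v x a * v x b * conv η (pd a (scurl u b)) x =
      ∫ x, conv η (fun y => v y a * v y b) x * pd a (scurl u b) x := fun a b =>
    integral_mul_conv hη.continuous (hvv a b) ((hw b).pd a).integrable heven
  have hI1 : ∀ a b, Integrable fun x => v x a * v x b * conv η (pd a (scurl u b)) x := by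
    intro a b
    have hs := hη.conv ((hw b).pd a).integrable
    obtain ⟨C, hC⟩ := hs.exists_bound
    exact (hvv a b).mul_bdd hs.continuous.aestronglyMeasurable (Eventually.of_forall hC)
  have hI2 : ∀ a b, Integrable fun x => conv η (fun y => v y a * v y b) x * pd a (scurl u b) x :=
    fun a b => ((hη.conv (hvv a b)).mul ((hw b).pd a)).integrable
  have hI3 : ∀ a b, Integrable fun x => u a x * u b x * pd a (scurl u b) x := fun a b =>
    (((hu a).mul (hu b)).mul ((hw b).pd a)).integrable
  simp only [h1, sub_mul, Finset.sum_sub_distrib]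
  rw [integral_sub (integrable_finsetSum _ fun a _ => integrable_finsetSum _ fun b _ => hI2 a b)
    (integrable_finsetSum _ fun a _ => integrable_finsetSum _ fun b _ => hI3 a b), h0, sub_zero,
    integral_finsetSum _ fun a _ => integrable_finsetSum _ fun b _ => hI1 a b,
    integral_finsetSum _ fun a _ => integrable_finsetSum _ fun b _ => hI2 a b]
  refine Finset.sum_congr rfl fun a _ => ?_
  rw [integral_finsetSum _ fun b _ => hI1 a b, integral_finsetSum _ fun b _ => hI2 a b]
  exact Finset.sum_congr rfl fun b _ => h2 a b

end Fields

/-! ### Estimates of the energy flux -/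

section FluxBounds

variable {d : ℕ}

/-- The uniform probability measure on the ball `B_ε`. -/
noncomputable def ballMeasure (d : ℕ) (ε : ℝ) : Measure (Torus d) :=
  ProbabilityTheory.cond volume (torusBall d ε)

theorem isProbabilityMeasure_ballMeasure {ε : ℝ} (hε : 0 < ε) :
    IsProbabilityMeasure (ballMeasure d ε) := by
  refine ProbabilityTheory.cond_isProbabilityMeasure ?_
  intro h
  have := measureReal_torusBall_pos (d := d) hε
  rw [measureReal_def, h] at this
  simp at this

theorem meanOsc_eq (q : ℝ≥0∞) (ε : ℝ) (f : Torus d → E3) :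
    meanOsc q ε f = eLpNorm (fun z : Torus d × Torus d => f z.1 - f (z.1 - z.2)) q
      ((volume : Measure (Torus d)).prod (ballMeasure d ε)) := rfl

theorem KernelBound.lintegral_le {ε A : ℝ} {K : Torus d → ℝ} (hK : KernelBound ε A K) (hε : 0 < ε)
    (hA : 0 ≤ A) (F : Torus d → ℝ≥0∞) :
    ∫⁻ z, ‖K z‖ₑ * F z ≤ ENNReal.ofReal A * ∫⁻ z, F z ∂(ballMeasure d ε) := by
  have hV := measureReal_torusBall_pos (d := d) hε
  have hm := (isOpen_torusBall (d := d) ε).measurableSet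
  have h1 : ∀ z, ‖K z‖ₑ * F z ≤ (torusBall d ε).indicator (fun z =>
      (ENNReal.ofReal A * (volume (torusBall d ε))⁻¹) * F z) z := by
    intro z
    by_cases hz : z ∈ torusBall d ε
    · rw [indicator_of_mem hz]
      gcongr
      rw [← ofReal_norm, Real.norm_eq_abs]
      refine (ENNReal.ofReal_le_ofReal (hK.abs_le z)).trans_eq ?_
      rw [ENNReal.ofReal_mul hA, ENNReal.ofReal_inv_of_pos hV, ofReal_measureReal]
    · simp [hK.support z hz]
  refine (lintegral_mono h1).trans_eq ?_
  have hne : volume (torusBall d ε) ≠ 0 := by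
    intro h; rw [measureReal_def, h] at hV; simp at hV
  rw [lintegral_indicator hm, lintegral_const_mul' _ _
    (ENNReal.mul_ne_top ENNReal.ofReal_ne_top (ENNReal.inv_ne_top.2 hne)), ballMeasure,
    ProbabilityTheory.cond, lintegral_smul_measure, smul_eq_mul, mul_assoc]

theorem conv_eq_integral_shift (K f : Torus d → ℝ) (x : Torus d) :
    conv K f x = ∫ z, K z * f (x - z) := by
  rw [conv_comm, conv]
  simp only [mul_comm]

theorem integrable_shift {K f : Torus d → ℝ} (hK : Continuous K) (hf : Integrable f) (x : Torus d) :
    Integrable (fun z => K z * f (x - z)) := by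
  have := (integrable_kernel_mul hK hf x).comp_sub_left x
  simpa using this

theorem SmoothOnTorus.integrable_kernel {K : Torus d → ℝ} (hK : Continuous K) : Integrable K :=
  hK.integrable_of_hasCompactSupport (HasCompactSupport.of_compactSpace K)

/-- A kernel of mean zero does not see constants, so `f x` may be subtracted under the integral. It
is applied to derivatives of mollifiers. -/
theorem enorm_conv_le {ε A : ℝ} {K f : Torus d → ℝ} (hK : KernelBound ε A K) (hε : 0 < ε)
    (hA : 0 ≤ A) (hc : Continuous K) (h0 : ∫ z, K z = 0) (hf : Integrable f) (x : Torus d) :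
    ‖conv K f x‖ₑ ≤ ENNReal.ofReal A * ∫⁻ z, ‖f x - f (x - z)‖ₑ ∂(ballMeasure d ε) := by
  have h1 : conv K f x = ∫ z, K z * (f (x - z) - f x) := by
    simp only [mul_sub]
    rw [integral_sub (integrable_shift hc hf x) ((SmoothOnTorus.integrable_kernel hc).mul_const _),
      integral_mul_const, h0, zero_mul, sub_zero, conv_eq_integral_shift]
  rw [h1]
  refine (enorm_integral_le_lintegral_enorm _).trans ?_
  simp only [enorm_mul]
  refine (hK.lintegral_le hε hA _).trans_eq ?_
  simp only [← enorm_neg (f _ - f (_ - _)), neg_sub]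

/-- Under the probability density `η`, the commutator is the covariance of `f (x - ·)` and `g (x -
·)`. It is at most the sum of the two variances, and a variance is at most the second moment about
any other centre, here `f x` and `g x`. -/
theorem abs_commutator_le {η f g : Torus d → ℝ} (hη : Continuous η) (hη0 : ∀ x, 0 ≤ η x)
    (hη1 : ∫ x, η x = 1) (hf : Integrable f) (hg : Integrable g)
    (hff : Integrable fun x => f x * f x) (hgg : Integrable fun x => g x * g x)
    (hfg : Integrable fun x => f x * g x) (x : Torus d) :
    |conv η (fun y => f y * g y) x - conv η f x * conv η g x| ≤
      (∫ z, η z * ((f (x - z) - f x) * (f (x - z) - f x))) +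
        ∫ z, η z * ((g (x - z) - g x) * (g (x - z) - g x)) := by
  have hηi := SmoothOnTorus.integrable_kernel hη
  -- All moments about arbitrary centres `a`, `b` come from one expansion, which is then used for
  -- the covariance, the variances and the moments about `f x` and `g x`.
  have expand : ∀ {f g : Torus d → ℝ}, Integrable f → Integrable g →
      Integrable (fun x => f x * g x) → ∀ a b : ℝ,
      Integrable (fun z => η z * ((f (x - z) - a) * (g (x - z) - b))) ∧
      ∫ z, η z * ((f (x - z) - a) * (g (x - z) - b)) =
        conv η (fun y => f y * g y) x - b * conv η f x - a * conv η g x + a * b := by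
    intro f g hf hg hfg a b
    have i1 := integrable_shift hη hfg x
    have i2 := (integrable_shift hη hf x).const_mul b
    have i3 := (integrable_shift hη hg x).const_mul a
    have i4 := hηi.const_mul (a * b)
    have e : (fun z => η z * ((f (x - z) - a) * (g (x - z) - b))) = fun z =>
        η z * (f (x - z) * g (x - z)) - b * (η z * f (x - z)) - a * (η z * g (x - z)) +
          a * b * η z := by
      ext z; ring
    have j1 : Integrable fun z => η z * (f (x - z) * g (x - z)) - b * (η z * f (x - z)) :=
      i1.sub i2
    have j2 : Integrable fun z => η z * (f (x - z) * g (x - z)) - b * (η z * f (x - z)) -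
      a * (η z * g (x - z)) := j1.sub i3
    rw [e]
    refine ⟨j2.add i4, ?_⟩
    rw [integral_add j2 i4, integral_sub j1 i3, integral_sub i1 i2,
      integral_const_mul, integral_const_mul, integral_const_mul, hη1, mul_one,
      conv_eq_integral_shift, conv_eq_integral_shift, conv_eq_integral_shift]
  obtain ⟨if1, ef1⟩ := expand hf hf hff (f x) (f x)
  obtain ⟨ig1, eg1⟩ := expand hg hg hgg (g x) (g x)
  obtain ⟨if2, ef2⟩ := expand hf hf hff (conv η f x) (conv η f x)
  obtain ⟨ig2, eg2⟩ := expand hg hg hgg (conv η g x) (conv η g x)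
  obtain ⟨ifg, efg⟩ := expand hf hg hfg (conv η f x) (conv η g x)
  have sq : ∀ (F : Torus d → ℝ) (c : ℝ), 0 ≤ ∫ z, η z * ((F (x - z) - c) * (F (x - z) - c)) :=
    fun F c => integral_nonneg fun z => mul_nonneg (hη0 z) (mul_self_nonneg _)
  have key : |∫ z, η z * ((f (x - z) - conv η f x) * (g (x - z) - conv η g x))| ≤
      (∫ z, η z * ((f (x - z) - conv η f x) * (f (x - z) - conv η f x))) +
        ∫ z, η z * ((g (x - z) - conv η g x) * (g (x - z) - conv η g x)) := by
    rw [← integral_add if2 ig2]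
    refine (abs_integral_le_integral_abs).trans (integral_mono ifg.abs (if2.add ig2) fun z => ?_)
    simp only [abs_mul, abs_of_nonneg (hη0 z), ← mul_add]
    refine mul_le_mul_of_nonneg_left ?_ (hη0 z)
    rw [← abs_mul_abs_self (f (x - z) - conv η f x), ← abs_mul_abs_self (g (x - z) - conv η g x)]
    nlinarith [sq_nonneg (|f (x - z) - conv η f x| - |g (x - z) - conv η g x|),
      abs_nonneg (f (x - z) - conv η f x), abs_nonneg (g (x - z) - conv η g x),
      mul_nonneg (abs_nonneg (f (x - z) - conv η f x)) (abs_nonneg (g (x - z) - conv η g x))]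
  have e3 : conv η (fun y => f y * g y) x - conv η f x * conv η g x =
      ∫ z, η z * ((f (x - z) - conv η f x) * (g (x - z) - conv η g x)) := by rw [efg]; ring
  rw [e3]
  refine key.trans (add_le_add ?_ ?_)
  · rw [ef1, ef2]; nlinarith [sq_nonneg (f x - conv η f x)]
  · rw [eg1, eg2]; nlinarith [sq_nonneg (g x - conv η g x)]

theorem enorm_apply_le (v : E3) (a : Fin 3) : ‖v a‖ₑ ≤ ‖v‖ₑ := by
  rw [← ofReal_norm, ← ofReal_norm]
  exact ENNReal.ofReal_le_ofReal (PiLp.norm_apply_le v a)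

theorem integrable_comp {v : Torus d → E3} {p : ℝ≥0∞} (hv : MemLp v p) (hp : 1 ≤ p) (a : Fin 3) :
    Integrable fun y => v y a := by
  have h1 : Integrable v := hv.integrable hp
  exact (EuclideanSpace.proj a : E3 →L[ℝ] ℝ).integrable_comp h1

theorem memLp_apply {v : Torus d → E3} {p : ℝ≥0∞} (hv : MemLp v p) (a : Fin 3) :
    MemLp (fun y => v y a) p :=
  (EuclideanSpace.proj a : E3 →L[ℝ] ℝ).comp_memLp' hv

theorem integrable_comp_mul {v w : Torus d → E3} (hv : MemLp v 2) (hw : MemLp w 2) (a b : Fin 3) :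
    Integrable fun y => v y a * w y b :=
  (memLp_apply hv a).integrable_mul (memLp_apply hw b)

theorem enorm_commutator_le {C ε : ℝ} {η : Torus d → ℝ} (hη : IsMollifier C ε η) (hC : 0 ≤ C)
    (hε : 0 < ε) {v : Torus d → E3} (hv : MemLp v 2) (a b : Fin 3) (x : Torus d) :
    ‖conv η (fun y => v y a * v y b) x -
        conv η (fun y => v y a) x * conv η (fun y => v y b) x‖ₑ ≤
      ENNReal.ofReal (2 * C) * ∫⁻ z, ‖v x - v (x - z)‖ₑ ^ 2 ∂(ballMeasure d ε) := by
  have h1 := abs_commutator_le hη.smooth.continuous hη.nonneg hη.integral_eq_one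
    (integrable_comp hv one_le_two a) (integrable_comp hv one_le_two b)
    (integrable_comp_mul hv hv a a) (integrable_comp_mul hv hv b b) (integrable_comp_mul hv hv a b) x
  have h2 : ∀ c : Fin 3, ‖∫ z, η z * ((v (x - z) c - v x c) * (v (x - z) c - v x c))‖ₑ ≤
      ENNReal.ofReal C * ∫⁻ z, ‖v x - v (x - z)‖ₑ ^ 2 ∂(ballMeasure d ε) := by
    intro c
    refine (enorm_integral_le_lintegral_enorm _).trans
      (le_trans ?_ (hη.bound.lintegral_le hε hC _))
    refine lintegral_mono fun z => ?_
    rw [enorm_mul, enorm_mul, ← pow_two]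
    gcongr
    rw [← neg_sub, enorm_neg]
    exact enorm_apply_le (v x - v (x - z)) c
  rw [ENNReal.ofReal_mul (by norm_num), mul_assoc, show ENNReal.ofReal 2 = 2 by simp, two_mul]
  refine le_trans ?_ (add_le_add (h2 a) (h2 b))
  rw [← Real.enorm_abs]
  refine le_trans ?_ (enorm_add_le _ _ |>.trans' le_rfl)
  rw [Real.enorm_of_nonneg (abs_nonneg _), Real.enorm_of_nonneg ((abs_nonneg _).trans h1)]
  exact ENNReal.ofReal_le_ofReal h1

/-- The curl passes through the mollification onto the current, so only one derivative lands on the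
kernel and the cost is `ε⁻¹`. -/
theorem enorm_pd_scurl_le_of_curl {C ε : ℝ} {η : Torus d → ℝ} (hη : IsMollifier C ε η)
    (hC : 0 ≤ C) (hε : 0 < ε) {v j : Torus d → E3} (hv : MemLp v 2) (hj : MemLp j 1)
    (hcurl : IsWeakCurl v j) (a b : Fin 3) (x : Torus d) :
    ‖pd a (scurl (fun c => conv η fun y => v y c) b) x‖ₑ ≤
      ENNReal.ofReal (C * ε⁻¹) * ∫⁻ z, ‖j x - j (x - z)‖ₑ ∂(ballMeasure d ε) := by
  have h1 : scurl (fun c => conv η fun y => v y c) b = conv η fun y => j y b :=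
    funext fun x => scurl_conv hη.smooth (integrable_comp hv one_le_two) hcurl b x
  rw [h1, pd_conv hη.smooth (integrable_comp hj le_rfl b)]
  refine (enorm_conv_le (hη.bound_pd a) hε (by positivity) (hη.smooth.pd a).continuous
    (integral_pd hη.smooth a) (integrable_comp hj le_rfl b) x).trans ?_
  gcongr with z
  exact enorm_apply_le (j x - j (x - z)) b

/-- Without information on the current both derivatives land on the kernel, at cost `ε⁻²`; the
factor `2` counts the two terms in a component of the curl. -/
theorem enorm_pd_scurl_le {C ε : ℝ} {η : Torus d → ℝ} (hη : IsMollifier C ε η)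
    (hC : 0 ≤ C) (hε : 0 < ε) {v : Torus d → E3} (hv : MemLp v 2) (a b : Fin 3) (x : Torus d) :
    ‖pd a (scurl (fun c => conv η fun y => v y c) b) x‖ₑ ≤
      ENNReal.ofReal (2 * (C * (ε⁻¹ * ε⁻¹))) * ∫⁻ z, ‖v x - v (x - z)‖ₑ ∂(ballMeasure d ε) := by
  have hvi := integrable_comp hv one_le_two
  have hs : ∀ c e, SmoothOnTorus (pd c (conv η fun y => v y e)) := fun c e =>
    (hη.smooth.conv (hvi e)).pd c
  have h1 : ∀ c e, ‖pd a (pd c (conv η fun y => v y e)) x‖ₑ ≤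
      ENNReal.ofReal (C * (ε⁻¹ * ε⁻¹)) * ∫⁻ z, ‖v x - v (x - z)‖ₑ ∂(ballMeasure d ε) := by
    intro c e
    rw [show pd c (conv η fun y => v y e) = conv (pd c η) fun y => v y e from
      funext fun x => pd_conv hη.smooth (hvi e) c x, pd_conv (hη.smooth.pd c) (hvi e)]
    refine (enorm_conv_le (hη.bound_pd_pd a c) hε (by positivity)
      ((hη.smooth.pd c).pd a).continuous (integral_pd (hη.smooth.pd c) a) (hvi e) x).trans ?_
    gcongr with z
    exact enorm_apply_le (v x - v (x - z)) e
  have h2 : ∀ c e c' e', ‖pd a (fun y => pd c (conv η fun y => v y e) y -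
      pd c' (conv η fun y => v y e') y) x‖ₑ ≤
      ENNReal.ofReal (2 * (C * (ε⁻¹ * ε⁻¹))) * ∫⁻ z, ‖v x - v (x - z)‖ₑ ∂(ballMeasure d ε) := by
    intro c e c' e'
    rw [pd_sub (hs _ _) (hs _ _), ENNReal.ofReal_mul (by norm_num), mul_assoc,
      show ENNReal.ofReal 2 = 2 by simp, two_mul]
    exact enorm_sub_le.trans (add_le_add (h1 _ _) (h1 _ _))
  fin_cases b
  exacts [h2 1 2 2 1, h2 2 0 0 2, h2 0 1 1 0]

/-- Hölder's inequality for `F G²` and exponents with `1/p + 2/q = 1`. -/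
theorem lintegral_mul_sq_le {α : Type*} [MeasurableSpace α] {μ : Measure α} {F G : α → ℝ≥0∞}
    (hF : AEMeasurable F μ) (hG : AEMeasurable G μ) {p q : ℝ≥0∞} (hpq : p⁻¹ + 2 * q⁻¹ = 1) :
    ∫⁻ x, F x * G x ^ 2 ∂μ ≤ eLpNorm F p μ * eLpNorm G q μ ^ 2 := by
  -- The exponent conjugate to `p` is `q/2`. At the endpoints `q = ∞` forces `p = 1`, and `p = ∞`
  -- forces `q = 2`; there the supremum is pulled out by hand, and the usual Hölder inequality
  -- covers the rest.
  by_cases hq : q = ⊤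
  · subst hq
    have hp : p = 1 := by simpa using hpq
    subst hp
    have h1 : ∀ᵐ x ∂μ, F x * G x ^ 2 ≤ F x * eLpNorm G ⊤ μ ^ 2 := by
      filter_upwards [enorm_ae_le_eLpNormEssSup G μ] with x hx
      rw [eLpNorm_exponent_top]
      gcongr
      simpa using hx
    refine (lintegral_mono_ae h1).trans_eq ?_
    rw [lintegral_mul_const'' _ hF, eLpNorm_one_eq_lintegral_enorm]
    simp
  have hq0 : q ≠ 0 := by rintro rfl; simp at hpq
  have hq2 : 2 ≤ q := by
    have h1 : 2 * q⁻¹ ≤ 1 := by rw [← hpq]; exact le_add_self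
    have h2 : 2 / q ≤ 1 := by rwa [div_eq_mul_inv]
    rwa [ENNReal.div_le_iff hq0 hq, one_mul] at h2
  have hqr : (2 : ℝ) ≤ q.toReal := by
    have := ENNReal.toReal_mono hq hq2; simpa using this
  have hGq : ∀ s : ℝ, s = q.toReal / 2 →
      (∫⁻ x, (G x ^ 2) ^ s ∂μ) ^ (1 / s) = eLpNorm G q μ ^ 2 := by
    intro s hs
    have hs0 : s ≠ 0 := by rw [hs]; linarith
    rw [eLpNorm_eq_lintegral_rpow_enorm_toReal hq0 hq, ← ENNReal.rpow_natCast _ 2,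
      ← ENNReal.rpow_mul]
    congr 1
    · refine lintegral_congr fun x => ?_
      rw [← ENNReal.rpow_natCast, ← ENNReal.rpow_mul, enorm_eq_self]
      congr 1
      rw [hs]; push_cast; ring
    · rw [hs]; push_cast; field_simp
  by_cases hp : p = ⊤
  · subst hp
    have hq' : q = 2 := by
      simp only [ENNReal.inv_top, zero_add] at hpq
      have : 2 / q = 1 := by rwa [div_eq_mul_inv]
      rwa [ENNReal.div_eq_one_iff hq0 hq, eq_comm] at this
    have h1 : ∀ᵐ x ∂μ, F x * G x ^ 2 ≤ eLpNorm F ⊤ μ * G x ^ 2 := by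
      filter_upwards [enorm_ae_le_eLpNormEssSup F μ] with x hx
      rw [eLpNorm_exponent_top]
      gcongr
      simpa using hx
    refine (lintegral_mono_ae h1).trans_eq ?_
    rw [lintegral_const_mul'' _ (hG.pow_const 2), ← hGq 1 (by rw [hq']; simp)]
    simp
  have hp0 : p ≠ 0 := by rintro rfl; simp at hpq
  have hreal : p.toReal⁻¹ + (q.toReal / 2)⁻¹ = 1 := by
    have := congrArg ENNReal.toReal hpq
    rw [ENNReal.toReal_add (ENNReal.inv_ne_top.2 hp0)
      (ENNReal.mul_ne_top (by simp) (ENNReal.inv_ne_top.2 hq0))] at this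
    simp only [ENNReal.toReal_inv, ENNReal.toReal_mul, ENNReal.toReal_ofNat, ENNReal.toReal_one]
      at this
    rw [inv_div, div_eq_mul_inv]; exact this
  have hpr : 0 < p.toReal := ENNReal.toReal_pos hp0 hp
  have hc : p.toReal.HolderConjugate (q.toReal / 2) := ⟨by simpa using hreal, hpr, by linarith⟩
  refine (ENNReal.lintegral_mul_le_Lp_mul_Lq μ hc hF (hG.pow_const 2)).trans_eq ?_
  rw [hGq _ rfl, eLpNorm_eq_lintegral_rpow_enorm_toReal hp0 hp]
  simp

theorem quasiMeasurePreserving_sub_ballMeasure (ε : ℝ) :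
    Measure.QuasiMeasurePreserving (fun z : Torus d × Torus d => z.1 - z.2)
      ((volume : Measure (Torus d)).prod (ballMeasure d ε)) volume := by
  have h1 : ballMeasure d ε ≪ volume := ProbabilityTheory.cond_absolutelyContinuous
  have h2 : Measure.QuasiMeasurePreserving (fun z : Torus d × Torus d => z.1 - z.2)
      ((volume : Measure (Torus d)).prod volume) volume := quasiMeasurePreserving_sub _ _
  exact h2.mono_left (Measure.AbsolutelyContinuous.rfl.prod h1)

instance (ε : ℝ) : SFinite (ballMeasure d ε) := by
  unfold ballMeasure ProbabilityTheory.cond; infer_instance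

theorem aestronglyMeasurable_diff {v : Torus d → E3} (hv : AEStronglyMeasurable v) (ε : ℝ) :
    AEStronglyMeasurable (fun z : Torus d × Torus d => v z.1 - v (z.1 - z.2))
      ((volume : Measure (Torus d)).prod (ballMeasure d ε)) :=
  hv.comp_fst.sub (hv.comp_quasiMeasurePreserving (quasiMeasurePreserving_sub_ballMeasure ε))

/-- The product of two means over the ball is a mean over two independent shifts. Hölder is applied
on the space of triples (point, shift, shift); each factor depends on only one of the shifts, so
integrating out the other leaves exactly a mean oscillation. -/
theorem lintegral_osc_le {ε : ℝ} (hε : 0 < ε) {v g : Torus d → E3} (hv : AEStronglyMeasurable v)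
    (hg : AEStronglyMeasurable g) {p q : ℝ≥0∞} (hpq : p⁻¹ + 2 * q⁻¹ = 1) :
    ∫⁻ x, (∫⁻ z, ‖g x - g (x - z)‖ₑ ∂(ballMeasure d ε)) *
      ∫⁻ z, ‖v x - v (x - z)‖ₑ ^ 2 ∂(ballMeasure d ε) ≤ meanOsc p ε g * meanOsc q ε v ^ 2 := by
  have := isProbabilityMeasure_ballMeasure (d := d) hε
  set ν := ballMeasure d ε with hν
  have hG := aestronglyMeasurable_diff hg ε
  have hV := aestronglyMeasurable_diff hv ε
  have mp1 : MeasurePreserving (fun w : Torus d × (Torus d × Torus d) => (w.1, w.2.1))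
      ((volume : Measure (Torus d)).prod (ν.prod ν)) (volume.prod ν) :=
    (MeasurePreserving.id _).prod measurePreserving_fst
  have mp2 : MeasurePreserving (fun w : Torus d × (Torus d × Torus d) => (w.1, w.2.2))
      ((volume : Measure (Torus d)).prod (ν.prod ν)) (volume.prod ν) :=
    (MeasurePreserving.id _).prod measurePreserving_snd
  have hF1 : AEMeasurable (fun w : Torus d × (Torus d × Torus d) => ‖g w.1 - g (w.1 - w.2.1)‖ₑ)
      ((volume : Measure (Torus d)).prod (ν.prod ν)) :=
    (hG.comp_measurePreserving mp1).enorm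
  have hF2 : AEMeasurable (fun w : Torus d × (Torus d × Torus d) => ‖v w.1 - v (w.1 - w.2.2)‖ₑ)
      ((volume : Measure (Torus d)).prod (ν.prod ν)) :=
    (hV.comp_measurePreserving mp2).enorm
  have h1 := lintegral_mul_sq_le hF1 hF2 hpq
  rw [eLpNorm_enorm, eLpNorm_enorm] at h1
  have e1 := eLpNorm_comp_measurePreserving (p := p) hG mp1
  have e2 := eLpNorm_comp_measurePreserving (p := q) hV mp2
  simp only [Function.comp_def] at e1 e2
  have hF12 : AEMeasurable (fun w : Torus d × (Torus d × Torus d) =>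
      ‖g w.1 - g (w.1 - w.2.1)‖ₑ * ‖v w.1 - v (w.1 - w.2.2)‖ₑ ^ 2)
      ((volume : Measure (Torus d)).prod (ν.prod ν)) := hF1.mul (hF2.pow_const 2)
  rw [e1, e2, lintegral_prod _ hF12] at h1
  refine (lintegral_mono_ae ?_).trans h1
  filter_upwards [hG.prodMk_left, hV.prodMk_left] with x hx1 hx2
  exact (lintegral_prod_mul hx1.enorm (hx2.enorm.pow_const 2)).ge

/-- The flux of `v` through the scale of the mollifier `η`, see `flux_eq_commutator`. -/
noncomputable def scaleFlux (η : Torus d → ℝ) (v : Torus d → E3) : ℝ :=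
  ∫ x, ∑ a, ∑ b, v x a * v x b * pd a (scurl (fun c => conv η (conv η fun y => v y c)) b) x

/-- The auxiliary field `g` stands for either the field itself, with `A` of order `ε⁻²`, or its
current, with `A` of order `ε⁻¹`. The constant `18` is nine index pairs times the `2` of the
commutator bound. -/
theorem enorm_scaleFlux_le {C ε A : ℝ} {η : Torus d → ℝ} (hη : IsMollifier C ε η) (hC : 0 ≤ C)
    (hε : 0 < ε) {v g : Torus d → E3} (hv : MemLp v 2) (hdiv : WeaklyDivFree v)
    (hg : AEStronglyMeasurable g)
    (hD : ∀ a b x, ‖pd a (scurl (fun c => conv η fun y => v y c) b) x‖ₑ ≤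
      ENNReal.ofReal A * ∫⁻ z, ‖g x - g (x - z)‖ₑ ∂(ballMeasure d ε))
    {p q : ℝ≥0∞} (hpq : p⁻¹ + 2 * q⁻¹ = 1) :
    ‖scaleFlux η v‖ₑ ≤ ENNReal.ofReal (18 * C) * ENNReal.ofReal A *
      (meanOsc p ε g * meanOsc q ε v ^ 2) := by
  rw [scaleFlux, flux_eq_commutator hη.smooth hη.even (integrable_comp hv one_le_two)
    (integrable_comp_mul hv hv) hdiv]
  refine (enorm_integral_le_lintegral_enorm _).trans ?_
  have h1 : ∀ x, ‖∑ a, ∑ b, (conv η (fun y => v y a * v y b) x -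
      conv η (fun y => v y a) x * conv η (fun y => v y b) x) *
        pd a (scurl (fun c => conv η fun y => v y c) b) x‖ₑ ≤
      ENNReal.ofReal (18 * C) * ENNReal.ofReal A *
        ((∫⁻ z, ‖g x - g (x - z)‖ₑ ∂(ballMeasure d ε)) *
          ∫⁻ z, ‖v x - v (x - z)‖ₑ ^ 2 ∂(ballMeasure d ε)) := by
    intro x
    have h2 : ∀ a b, ‖(conv η (fun y => v y a * v y b) x -
      conv η (fun y => v y a) x * conv η (fun y => v y b) x) *
        pd a (scurl (fun c => conv η fun y => v y c) b) x‖ₑ ≤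
        (ENNReal.ofReal (2 * C) * ∫⁻ z, ‖v x - v (x - z)‖ₑ ^ 2 ∂(ballMeasure d ε)) *
          (ENNReal.ofReal A * ∫⁻ z, ‖g x - g (x - z)‖ₑ ∂(ballMeasure d ε)) := by
      intro a b
      rw [enorm_mul]
      exact mul_le_mul' (enorm_commutator_le hη hC hε hv a b x) (hD a b x)
    refine (enorm_sum_le _ _).trans ((Finset.sum_le_sum fun a _ => (enorm_sum_le _ _).trans
      (Finset.sum_le_sum fun b _ => h2 a b)).trans_eq ?_)
    simp only [Finset.sum_const, Finset.card_univ, Fintype.card_fin, nsmul_eq_mul]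
    rw [show (18 * C : ℝ) = 9 * (2 * C) by ring, ENNReal.ofReal_mul (by norm_num : (0 : ℝ) ≤ 9),
      show ENNReal.ofReal 9 = 3 * 3 by norm_num]
    push_cast
    ring
  refine (lintegral_mono h1).trans ?_
  rw [lintegral_const_mul' _ _ (ENNReal.mul_ne_top ENNReal.ofReal_ne_top ENNReal.ofReal_ne_top)]
  gcongr
  exact lintegral_osc_le hε hv.aestronglyMeasurable hg hpq

end FluxBounds

/-! ### The fundamental lemma in time -/

theorem exists_Icc_of_hasCompactSupport {T : ℝ} (hT : 0 < T) {θ : ℝ → ℝ} (hc : HasCompactSupport θ)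
    (hs : tsupport θ ⊆ Ioo 0 T) : ∃ a b : ℝ, 0 < a ∧ b < T ∧ ∀ t, t ∉ Icc a b → θ t = 0 := by
  rcases (tsupport θ).eq_empty_or_nonempty with h | h
  · refine ⟨T / 2, T / 2, by linarith, by linarith, fun t _ => image_eq_zero_of_notMem_tsupport ?_⟩
    simp [h]
  · obtain ⟨a, ha, hamin⟩ := hc.exists_isLeast h
    obtain ⟨b, hb, hbmax⟩ := hc.exists_isGreatest h
    refine ⟨a, b, (hs ha).1, (hs hb).2, fun t ht => image_eq_zero_of_notMem_tsupport fun hts => ?_⟩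
    exact ht ⟨hamin hts, hbmax hts⟩

theorem contDiff_primitive {g : ℝ → ℝ} (hg : ContDiff ℝ ∞ g) (a : ℝ) :
    ContDiff ℝ ∞ fun t => ∫ s in a..t, g s := by
  have h : ∀ t, HasDerivAt (fun t => ∫ s in a..t, g s) (g t) t := fun t =>
    (hg.continuous.integral_hasStrictDerivAt a t).hasDerivAt
  rw [contDiff_infty_iff_deriv]
  refine ⟨fun t => (h t).differentiableAt, ?_⟩
  rwa [show deriv (fun t => ∫ s in a..t, g s) = g from funext fun t => (h t).deriv]

/-- A continuous function with vanishing distributional derivative on `(0,T)` is constant. -/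
theorem eq_const_of_integral_deriv_mul_eq_zero {T : ℝ} (hT : 0 < T) {F : ℝ → ℝ} (hF : Continuous F)
    (h : ∀ θ : ℝ → ℝ, ContDiff ℝ ∞ θ →
      (∃ a b : ℝ, 0 < a ∧ b < T ∧ ∀ t, t ∉ Icc a b → θ t = 0) →
      ∫ t in (0 : ℝ)..T, deriv θ t * F t = 0) :
    ∀ t ∈ Icc 0 T, F t = F 0 := by
  obtain ⟨ρ, hρ_sub, hρc, hρ, -, hρ1⟩ : ∃ ρ : ℝ → ℝ, tsupport ρ ⊆ Ioo 0 T ∧ HasCompactSupport ρ ∧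
      ContDiff ℝ ∞ ρ ∧ True ∧ ∫ t, ρ t = 1 := by
    let b : ContDiffBump (T / 2) := ⟨T / 8, T / 4, by positivity, by linarith⟩
    refine ⟨b.normed volume, ?_, b.hasCompactSupport_normed, b.contDiff_normed, trivial,
      b.integral_normed⟩
    rw [b.tsupport_normed_eq, Real.closedBall_eq_Icc]
    intro t ht
    have h1 : T / 2 - T / 4 ≤ t := ht.1
    have h2 : t ≤ T / 2 + T / 4 := ht.2
    exact ⟨by linarith, by linarith⟩
  have hint : ∀ g : ℝ → ℝ, Function.support g ⊆ Ioc 0 T → ∫ t in (0 : ℝ)..T, g t = ∫ t, g t := by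
    intro g hg
    exact intervalIntegral.integral_eq_integral_of_support_subset hg
  set c := ∫ t, ρ t * F t with hc
  have hzero : ∀ᵐ t, t ∈ Ioo 0 T → F t - c = 0 := by
    refine isOpen_Ioo.ae_eq_zero_of_integral_contDiff_smul_eq_zero
      ((hF.sub continuous_const).locallyIntegrable.locallyIntegrableOn _) fun ψ hψ hψc hψs => ?_
    set m := ∫ t, ψ t with hm
    -- Removing the mass of `ψ` by means of the unit bump `ρ` leaves a function of integral zero,
    -- whose primitive is again compactly supported in the open interval and hence an admissible
    -- `θ`.
    have hg : ContDiff ℝ ∞ fun t => ψ t - m * ρ t := hψ.sub (contDiff_const.mul hρ)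
    have hgc : HasCompactSupport fun t => ψ t - m * ρ t := hψc.sub hρc.mul_left
    have hgs : tsupport (fun t => ψ t - m * ρ t) ⊆ Ioo 0 T := by
      refine (tsupport_sub ψ fun t => m * ρ t).trans (union_subset hψs ?_)
      exact (closure_mono (Function.support_mul_subset_right (fun _ => m) ρ)).trans hρ_sub
    obtain ⟨a, b, ha, hb, hab⟩ := exists_Icc_of_hasCompactSupport hT hgc hgs
    set θ : ℝ → ℝ := fun t => ∫ s in (0 : ℝ)..t, (ψ s - m * ρ s) with hθ
    have hderiv : ∀ t, deriv θ t = ψ t - m * ρ t := fun t =>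
      (hg.continuous.integral_hasStrictDerivAt 0 t).hasDerivAt.deriv
    have hψi : Integrable ψ := hψ.continuous.integrable_of_hasCompactSupport hψc
    have hρi : Integrable ρ := hρ.continuous.integrable_of_hasCompactSupport hρc
    have htot : ∫ s, (ψ s - m * ρ s) = 0 := by
      rw [integral_sub hψi (hρi.const_mul m), integral_const_mul, hρ1, mul_one, hm, sub_self]
    have hθ0 : ∀ t, t ∉ Icc a b → θ t = 0 := by
      intro t ht
      rw [mem_Icc, not_and_or, not_le, not_le] at ht
      rcases ht with ht | ht
      · refine intervalIntegral.integral_zero_ae (Eventually.of_forall fun s hs => hab s ?_)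
        rw [mem_Icc, not_and_or, not_le]
        refine Or.inl ?_
        rcases le_total 0 t with h0 | h0
        · rw [uIoc_of_le h0] at hs; linarith [hs.2]
        · rw [uIoc_of_ge h0] at hs; linarith [hs.2]
      · by_cases h0 : 0 ≤ t
        · rw [hθ]
          simp only
          rw [← htot]
          refine intervalIntegral.integral_eq_integral_of_support_subset fun s hs => ?_
          have : s ∈ Icc a b := by by_contra hcon; exact hs (hab s hcon)
          exact ⟨by linarith [this.1], by linarith [this.2]⟩
        · refine intervalIntegral.integral_zero_ae (Eventually.of_forall fun s hs => hab s ?_)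
          rw [uIoc_of_ge (not_le.1 h0).le] at hs
          rw [mem_Icc, not_and_or, not_le]
          exact Or.inl (by linarith [hs.2])
    have h1 := h θ (contDiff_primitive hg 0) ⟨a, b, ha, hb, hθ0⟩
    simp only [hderiv] at h1
    rw [hint] at h1
    · have i1 : Integrable fun t => ψ t * F t :=
        (hψ.continuous.mul hF).integrable_of_hasCompactSupport hψc.mul_right
      have i2 : Integrable fun t => ρ t * F t :=
        (hρ.continuous.mul hF).integrable_of_hasCompactSupport hρc.mul_right
      have e1 : ∀ t, (ψ t - m * ρ t) * F t = ψ t * F t - m * (ρ t * F t) := fun t => by ring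
      simp only [e1] at h1
      rw [integral_sub i1 (i2.const_mul m), integral_const_mul, ← hc] at h1
      simp only [smul_eq_mul, mul_sub]
      rw [integral_sub i1 (hψi.mul_const c), integral_mul_const, ← hm]
      exact h1
    · intro t ht
      have h2 : t ∈ Icc a b := by
        by_contra hcon
        exact ht (by simp [hab t hcon])
      exact ⟨by linarith [h2.1], by linarith [h2.2]⟩
  have h3 : F =ᵐ[volume.restrict (Icc 0 T)] fun _ => c := by
    rw [← restrict_Ioo_eq_restrict_Icc, EventuallyEq, ae_restrict_iff' measurableSet_Ioo]
    filter_upwards [hzero] with t ht hmem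
    linarith [ht hmem]
  have h4 : EqOn F (fun _ => c) (Icc 0 T) :=
    Measure.eqOn_Icc_of_ae_eq volume hT.ne h3 hF.continuousOn continuousOn_const
  intro t ht
  rw [h4 ht, h4 ⟨le_rfl, hT.le⟩]

/-- A continuous function with continuous distributional derivative `b` is a primitive of `b`. -/
theorem sub_eq_integral_of_weak_deriv {T : ℝ} (hT : 0 < T) {l b : ℝ → ℝ}
    (hl : ContinuousOn l (Icc 0 T)) (hb : ContinuousOn b (Icc 0 T))
    (h : ∀ θ : ℝ → ℝ, ContDiff ℝ ∞ θ →
      (∃ a b : ℝ, 0 < a ∧ b < T ∧ ∀ t, t ∉ Icc a b → θ t = 0) →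
      ∫ t in (0 : ℝ)..T, (deriv θ t * l t + θ t * b t) = 0) :
    ∀ t ∈ Icc 0 T, l t - l 0 = ∫ s in (0 : ℝ)..t, b s := by
  have hle := hT.le
  -- Constant extension beyond `[0, T]` makes both functions continuous on the whole line, so that
  -- the primitive is differentiable everywhere.
  set l' : ℝ → ℝ := IccExtend hle ((Icc 0 T).domRestrict l) with hl'
  set b' : ℝ → ℝ := IccExtend hle ((Icc 0 T).domRestrict b) with hb'
  have cl : Continuous l' := (continuousOn_iff_continuous_domRestrict.1 hl).Icc_extend'
  have cb : Continuous b' := (continuousOn_iff_continuous_domRestrict.1 hb).Icc_extend'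
  have el : ∀ t ∈ Icc 0 T, l' t = l t := fun t ht => by
    rw [hl', IccExtend_of_mem _ _ ht]; rfl
  have eb : ∀ t ∈ Icc 0 T, b' t = b t := fun t ht => by
    rw [hb', IccExtend_of_mem _ _ ht]; rfl
  have hB : ∀ t, HasDerivAt (fun t => ∫ s in (0 : ℝ)..t, b' s) (b' t) t := fun t =>
    (cb.integral_hasStrictDerivAt 0 t).hasDerivAt
  have cB : Continuous fun t => ∫ s in (0 : ℝ)..t, b' s :=
    continuous_iff_continuousAt.2 fun t => (hB t).continuousAt
  have key := eq_const_of_integral_deriv_mul_eq_zero hT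
    (F := fun t => l' t - ∫ s in (0 : ℝ)..t, b' s) (cl.sub cB) fun θ hθ hsupp => ?_
  · intro t ht
    have h1 := key t ht
    simp only [intervalIntegral.integral_same, sub_zero] at h1
    rw [el t ht, el 0 ⟨le_rfl, hle⟩] at h1
    have h2 : ∫ s in (0 : ℝ)..t, b' s = ∫ s in (0 : ℝ)..t, b s := by
      refine intervalIntegral.integral_congr fun s hs => eb s ?_
      rw [uIcc_of_le ht.1] at hs
      exact ⟨hs.1, hs.2.trans ht.2⟩
    rw [← h2]; linarith
  · obtain ⟨a, c, ha, hc, hac⟩ := hsupp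
    have h0 : θ 0 = 0 := hac 0 fun hcon => by linarith [hcon.1]
    have h1 : θ T = 0 := hac T fun hcon => by linarith [hcon.2]
    have cθ' : Continuous (deriv θ) := hθ.continuous_deriv (by simp)
    have hd : ∀ t, HasDerivAt θ (deriv θ t) t := fun t =>
      (hθ.differentiable (by simp) t).hasDerivAt
    have hp := intervalIntegral.integral_deriv_mul_eq_sub (a := 0) (b := T)
      (fun t _ => hd t) (fun t _ => hB t) (cθ'.intervalIntegrable _ _) (cb.intervalIntegrable _ _)
    rw [h0, h1, zero_mul, zero_mul, sub_zero] at hp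
    have hw : ∫ t in (0 : ℝ)..T, (deriv θ t * l' t + θ t * b' t) = 0 := by
      refine Eq.trans ?_ (h θ hθ ⟨a, c, ha, hc, hac⟩)
      refine intervalIntegral.integral_congr fun s hs => ?_
      rw [uIcc_of_le hle] at hs
      simp only [el s hs, eb s hs]
    have i1 : IntervalIntegrable (fun t => deriv θ t * l' t + θ t * b' t) volume 0 T :=
      ((cθ'.mul cl).add (hθ.continuous.mul cb)).intervalIntegrable _ _
    have i2 : IntervalIntegrable (fun t => deriv θ t * (∫ s in (0 : ℝ)..t, b' s) + θ t * b' t)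
        volume 0 T := ((cθ'.mul cB).add (hθ.continuous.mul cb)).intervalIntegrable _ _
    have := intervalIntegral.integral_sub i1 i2
    rw [hw, hp, sub_zero] at this
    refine Eq.trans ?_ this
    refine intervalIntegral.integral_congr fun s _ => ?_
    ring

/-! ### Continuity of the functionals in the weak formulation -/

section Functionals

variable {d : ℕ}

/-- The components of a square integrable field. -/
noncomputable def compL (a : Fin 3) :
    Lp E3 2 (volume : Measure (Torus d)) →L[ℝ] Lp ℝ 2 (volume : Measure (Torus d)) :=
  (EuclideanSpace.proj a : E3 →L[ℝ] ℝ).compLpL 2 volume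

theorem coeFn_compL (a : Fin 3) (v : Lp E3 2 (volume : Measure (Torus d))) :
    compL a v =ᵐ[volume] fun x => v x a :=
  (EuclideanSpace.proj a : E3 →L[ℝ] ℝ).coeFn_compLpL v

/-- The product of two components of square integrable fields. -/
noncomputable def mulL (a b : Fin 3) (v w : Lp E3 2 (volume : Measure (Torus d))) :
    Lp ℝ 1 (volume : Measure (Torus d)) :=
  (ContinuousLinearMap.mul ℝ ℝ).holderL volume 2 2 1 (compL a v) (compL b w)

theorem coeFn_mulL (a b : Fin 3) (v w : Lp E3 2 (volume : Measure (Torus d))) :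
    mulL a b v w =ᵐ[volume] fun x => v x a * w x b := by
  refine ((ContinuousLinearMap.mul ℝ ℝ).coeFn_holder (compL a v) (compL b w)).trans ?_
  filter_upwards [coeFn_compL a v, coeFn_compL b w] with x h1 h2
  simp [h1, h2]

theorem continuous_mulL (a b : Fin 3) :
    Continuous fun p : Lp E3 2 (volume : Measure (Torus d)) × Lp E3 2 (volume : Measure (Torus d)) =>
      mulL a b p.1 p.2 := by
  unfold mulL
  fun_prop

/-- Integration of an integrable function against a continuous function. -/
noncomputable def pairL : Lp ℝ 1 (volume : Measure (Torus d)) →L[ℝ] C(Torus d, ℝ) →L[ℝ] ℝ :=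
  (((ContinuousLinearMap.mul ℝ ℝ).lpPairing volume 1 ⊤).flip ∘L
    (ContinuousMap.toLp (E := ℝ) ⊤ volume ℝ)).flip

theorem pairL_apply (P : Lp ℝ 1 (volume : Measure (Torus d))) (g : C(Torus d, ℝ)) :
    pairL P g = ∫ x, P x * g x := by
  have h : pairL P g = (ContinuousLinearMap.mul ℝ ℝ).lpPairing volume 1 ⊤ P
    (ContinuousMap.toLp (E := ℝ) ⊤ volume ℝ g) := rfl
  rw [h, ContinuousLinearMap.lpPairing_eq_integral]
  refine integral_congr_ae ?_
  filter_upwards [ContinuousMap.coeFn_toLp (p := ⊤) (𝕜 := ℝ) volume g] with x hx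
  rw [ContinuousLinearMap.mul_apply', hx]

/-- Convolution with a smooth kernel as an operator into the continuous functions. -/
noncomputable def convL {K : Torus d → ℝ} (hK : SmoothOnTorus K) :
    Lp ℝ 2 (volume : Measure (Torus d)) →L[ℝ] C(Torus d, ℝ) :=
  LinearMap.mkContinuousOfExistsBound
    { toFun := fun w => ⟨conv K w, (hK.conv ((Lp.memLp w).integrable one_le_two)).continuous⟩
      map_add' := fun w w' => by
        ext x
        simp only [ContinuousMap.coe_mk, ContinuousMap.add_apply]
        rw [← conv_add hK.continuous ((Lp.memLp w).integrable one_le_two)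
          ((Lp.memLp w').integrable one_le_two), conv, conv]
        refine integral_congr_ae ?_
        filter_upwards [Lp.coeFn_add w w'] with y hy
        rw [hy]; rfl
      map_smul' := fun c w => by
        ext x
        simp only [ContinuousMap.coe_mk, RingHom.id_apply, ContinuousMap.smul_apply, smul_eq_mul]
        rw [conv, conv, ← integral_const_mul]
        refine integral_congr_ae ?_
        filter_upwards [Lp.coeFn_smul c w] with y hy
        rw [hy, Pi.smul_apply, smul_eq_mul]; ring }
    (by
      obtain ⟨C, hC⟩ := hK.exists_bound
      have hC0 : 0 ≤ C := (norm_nonneg _).trans (hC 0)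
      refine ⟨C, fun w => ?_⟩
      have hw := (Lp.memLp w)
      rw [ContinuousMap.norm_le _ (by positivity)]
      intro x
      change ‖conv K w x‖ ≤ _
      refine (norm_integral_le_integral_norm _).trans ?_
      have h1 : ∫ y, ‖K (x - y) * w y‖ ≤ C * ∫ y, ‖w y‖ := by
        rw [← integral_const_mul]
        refine integral_mono_of_nonneg (Eventually.of_forall fun y => norm_nonneg _)
          ((hw.integrable one_le_two).norm.const_mul C) (Eventually.of_forall fun y => ?_)
        simp only [norm_mul]
        gcongr
        exact hC _
      refine h1.trans ?_
      gcongr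
      rw [Lp.norm_def, integral_norm_eq_lintegral_enorm hw.1, ← eLpNorm_one_eq_lintegral_enorm]
      exact ENNReal.toReal_mono hw.eLpNorm_ne_top
        (eLpNorm_le_eLpNorm_of_exponent_le one_le_two hw.1))

theorem convL_apply {K : Torus d → ℝ} (hK : SmoothOnTorus K)
    (w : Lp ℝ 2 (volume : Measure (Torus d))) (x : Torus d) : convL hK w x = conv K w x := rfl

theorem conv_congr_ae {K f g : Torus d → ℝ} (h : f =ᵐ[volume] g) : conv K f = conv K g := by
  ext x
  refine integral_congr_ae ?_
  filter_upwards [h] with y hy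
  rw [hy]

theorem conv_assoc {K L f : Torus d → ℝ} (hK : Continuous K) (hL : Continuous L)
    (hf : Integrable f) : conv K (conv L f) = conv (conv K L) f := by
  obtain ⟨A, hA⟩ := isCompact_univ.exists_bound_of_continuousOn hK.continuousOn
  obtain ⟨B, hB⟩ := isCompact_univ.exists_bound_of_continuousOn hL.continuousOn
  ext x
  have hint : Integrable (fun p : Torus d × Torus d => K (x - p.1) * (L (p.1 - p.2) * f p.2)) := by
    have h1 := hf.comp_snd (volume : Measure (Torus d))
    have h2 := (h1.bdd_mul (f := fun p : Torus d × Torus d => L (p.1 - p.2)) (c := B)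
      (by fun_prop) (Eventually.of_forall fun p => hB _ (mem_univ _)))
    exact h2.bdd_mul (f := fun p : Torus d × Torus d => K (x - p.1)) (c := A)
      (by fun_prop) (Eventually.of_forall fun p => hA _ (mem_univ _))
  simp only [conv, ← integral_const_mul, ← integral_mul_const]
  rw [integral_integral_swap hint]
  refine integral_congr_ae (Eventually.of_forall fun z => ?_)
  simp only
  rw [← integral_add_right_eq_self _ z]
  refine integral_congr_ae (Eventually.of_forall fun y => ?_)
  simp only [add_sub_cancel_right, sub_add_eq_sub_sub, mul_assoc]
  rw [sub_right_comm]

/-- The trilinear energy transfer functional. -/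
noncomputable def transfer (η : Torus d → ℝ) (v w : Torus d → E3) : ℝ :=
  ∫ x, ∑ a, ∑ b, v x a * v x b * pd a (scurl (fun c => conv η (conv η fun y => w y c)) b) x

theorem continuous_integral_mul (a b : Fin 3) {g : Torus d → ℝ} (hg : Continuous g) :
    Continuous fun v : Lp E3 2 (volume : Measure (Torus d)) => ∫ x, v x a * v x b * g x := by
  have h1 : ∀ v : Lp E3 2 (volume : Measure (Torus d)),
      ∫ x, v x a * v x b * g x = pairL (mulL a b v v) ⟨g, hg⟩ := by
    intro v
    rw [pairL_apply]
    refine integral_congr_ae ?_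
    filter_upwards [coeFn_mulL a b v v] with x hx
    rw [hx]; rfl
  simp only [h1]
  have := (continuous_mulL (d := d) a b).comp (continuous_id.prodMk continuous_id)
  exact ((pairL (d := d)).flip ⟨g, hg⟩).continuous.comp this

theorem continuous_integral_apply (b : Fin 3) {g : Torus d → ℝ} (hg : Continuous g) :
    Continuous fun v : Lp E3 2 (volume : Measure (Torus d)) => ∫ x, g x * v x b := by
  set G : Lp ℝ 2 (volume : Measure (Torus d)) := ContinuousMap.toLp (E := ℝ) 2 volume ℝ ⟨g, hg⟩
  have h1 : ∀ v : Lp E3 2 (volume : Measure (Torus d)), ∫ x, g x * v x b =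
      (ContinuousLinearMap.mul ℝ ℝ).lpPairing volume 2 2 G (compL b v) := by
    intro v
    rw [ContinuousLinearMap.lpPairing_eq_integral]
    refine integral_congr_ae ?_
    filter_upwards [coeFn_compL b v, ContinuousMap.coeFn_toLp (p := 2) (𝕜 := ℝ) volume
      (⟨g, hg⟩ : C(Torus d, ℝ))] with x h1 h2
    simp only [G, ContinuousLinearMap.mul_apply', h1, h2]
    rfl
  simp only [h1]
  exact (((ContinuousLinearMap.mul ℝ ℝ).lpPairing volume 2 2 G).continuous.comp
    (compL b).continuous)

theorem integrable_mul_mul {v : Torus d → E3} (hv : MemLp v 2) (a b : Fin 3) {g : Torus d → ℝ}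
    (hg : Continuous g) : Integrable fun x => v x a * v x b * g x := by
  obtain ⟨C, hC⟩ := isCompact_univ.exists_bound_of_continuousOn hg.continuousOn
  exact (integrable_comp_mul hv hv a b).mul_bdd hg.aestronglyMeasurable
    (Eventually.of_forall fun x => hC x (mem_univ x))

/-- Although two derivatives appear, they can be put on the smooth kernel `conv η η`. The second
argument then enters through a bounded operator from `L²` to continuous functions, and the first
through products in `L¹`, which pair continuously. -/
theorem continuous_transfer {η : Torus d → ℝ} (hη : SmoothOnTorus η) :
    Continuous fun p : Lp E3 2 (volume : Measure (Torus d)) × Lp E3 2 (volume : Measure (Torus d)) =>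
      transfer η p.1 p.2 := by
  have hηi := hη.integrable
  have hM : SmoothOnTorus (conv η η) := hη.conv hηi
  have hwi : ∀ (w : Lp E3 2 (volume : Measure (Torus d))) c, Integrable fun y => w y c :=
    fun w c => integrable_comp (Lp.memLp w) one_le_two c
  have hs : ∀ (w : Lp E3 2 (volume : Measure (Torus d))) c,
      SmoothOnTorus (conv η (conv η fun y => w y c)) := fun w c => hη.conv (hη.conv (hwi w c)).integrable
  have h1 : ∀ (w : Lp E3 2 (volume : Measure (Torus d))) a c e,
      pd a (pd c (conv η (conv η fun y => w y e))) = convL ((hM.pd c).pd a) (compL e w) := by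
    intro w a c e
    ext x
    rw [convL_apply, conv_congr_ae (coeFn_compL e w), conv_assoc hη.continuous hη.continuous (hwi w e),
      show pd c (conv (conv η η) fun y => w y e) = conv (pd c (conv η η)) fun y => w y e from
      funext fun x => pd_conv hM (hwi w e) c x, pd_conv (hM.pd c) (hwi w e)]
  have h2 : ∀ a b c e, Continuous fun p : Lp E3 2 (volume : Measure (Torus d)) ×
      Lp E3 2 (volume : Measure (Torus d)) =>
      ∫ x, p.1 x a * p.1 x b * pd a (pd c (conv η (conv η fun y => p.2 y e))) x := by
    intro a b c e
    have h3 : ∀ p : Lp E3 2 (volume : Measure (Torus d)) × Lp E3 2 (volume : Measure (Torus d)),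
        ∫ x, p.1 x a * p.1 x b * pd a (pd c (conv η (conv η fun y => p.2 y e))) x =
        pairL (mulL a b p.1 p.1) (convL ((hM.pd c).pd a) (compL e p.2)) := by
      intro p
      rw [pairL_apply]
      refine integral_congr_ae ?_
      filter_upwards [coeFn_mulL a b p.1 p.1] with x hx
      rw [hx, h1]
    simp only [h3]
    have h4 : Continuous fun p : Lp E3 2 (volume : Measure (Torus d)) ×
        Lp E3 2 (volume : Measure (Torus d)) => mulL a b p.1 p.1 :=
      (continuous_mulL (d := d) a b).comp (continuous_fst.prodMk continuous_fst)
    have h5 : Continuous fun p : Lp E3 2 (volume : Measure (Torus d)) ×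
        Lp E3 2 (volume : Measure (Torus d)) => convL ((hM.pd c).pd a) (compL e p.2) := by fun_prop
    exact ((pairL (d := d)).continuous.comp h4).clm_apply h5
  have h6 : ∀ a b c e c' e', Continuous fun p : Lp E3 2 (volume : Measure (Torus d)) ×
      Lp E3 2 (volume : Measure (Torus d)) =>
      ∫ x, p.1 x a * p.1 x b * pd a (fun x => pd c (conv η (conv η fun y => p.2 y e)) x -
        pd c' (conv η (conv η fun y => p.2 y e')) x) x := by
    intro a b c e c' e'
    refine ((h2 a b c e).sub (h2 a b c' e')).congr fun p => ?_
    rw [Pi.sub_apply, ← integral_sub (integrable_mul_mul (Lp.memLp p.1) a b (((hs p.2 e).pd c).pd a).continuous)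
      (integrable_mul_mul (Lp.memLp p.1) a b (((hs p.2 e').pd c').pd a).continuous)]
    congr 1
    ext x
    rw [pd_sub ((hs p.2 e).pd c) ((hs p.2 e').pd c')]; ring
  have h7 : ∀ a b, Continuous fun p : Lp E3 2 (volume : Measure (Torus d)) ×
      Lp E3 2 (volume : Measure (Torus d)) =>
      ∫ x, p.1 x a * p.1 x b * pd a (scurl (fun c => conv η (conv η fun y => p.2 y c)) b) x := by
    intro a b
    fin_cases b
    exacts [h6 a 0 1 2 2 1, h6 a 1 2 0 0 2, h6 a 2 0 1 1 0]
  refine (continuous_finsetSum Finset.univ fun a _ =>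
    continuous_finsetSum Finset.univ fun b _ => h7 a b).congr fun p => ?_
  have hi : ∀ a b, Integrable fun x => p.1 x a * p.1 x b *
      pd a (scurl (fun c => conv η (conv η fun y => p.2 y c)) b) x := fun a b =>
    integrable_mul_mul (Lp.memLp p.1) a b ((smoothOnTorus_scurl (hs p.2) b).pd a).continuous
  rw [transfer, integral_finsetSum _ fun a _ => integrable_finsetSum _ fun b _ => hi a b]
  refine Finset.sum_congr rfl fun a _ => ?_
  rw [integral_finsetSum _ fun b _ => hi a b]

end Functionals

/-! ### The energy identity at a fixed scale -/

section EnergyIdentity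

variable {d : ℕ}

theorem pd_const_mul (a : Fin 3) (c : ℝ) (f : Torus d → ℝ) (x : Torus d) :
    pd a (fun y => c * f y) x = c * pd a f x := by
  by_cases ha : (a : ℕ) < d
  · rw [pd_of_lt ha, pdi_const_mul]
  · rw [pd_of_not_lt ha]; simp

theorem scurl_const_mul (c : ℝ) (w : Fin 3 → Torus d → ℝ) (b : Fin 3) :
    scurl (fun a y => c * w a y) b = fun x => c * scurl w b x := by
  ext x
  fin_cases b <;> simp [scurl, pd_const_mul, mul_sub]

/-- Only test fields of the form `θ(t) w(x)` are needed. For these the equation says that the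
pairing of `h` with `w` has a distributional derivative that is continuous in time, so it is a
genuine primitive up to the endpoints. -/
theorem weak_form_of_solenoidal {T : ℝ} (hT : 0 < T) {h : ℝ → Lp E3 2 (volume : Measure (Torus d))}
    (hsol : IsEMHDWeakSolution T h) {w : Fin 3 → Torus d → ℝ} (hw : ∀ a, SmoothOnTorus (w a))
    (hdiv : ∀ x, ∑ a, pd a (w a) x = 0) :
    ∀ t ∈ Icc 0 T, (∫ x, ∑ b, w b x * h t x b) - ∫ x, ∑ b, w b x * h 0 x b =
      ∫ s in (0 : ℝ)..t, ∫ x, ∑ a, ∑ b, h s x a * h s x b * pd a (scurl w b) x := by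
  have hcurl := smoothOnTorus_scurl hw
  have i1 : ∀ (v : Lp E3 2 (volume : Measure (Torus d))) b, Integrable fun x => w b x * v x b := by
    intro v b
    obtain ⟨C, hC⟩ := (hw b).exists_bound
    exact (integrable_comp (Lp.memLp v) one_le_two b).bdd_mul
      (hw b).continuous.aestronglyMeasurable (Eventually.of_forall hC)
  have i2 : ∀ (v : Lp E3 2 (volume : Measure (Torus d))) a b,
      Integrable fun x => v x a * v x b * pd a (scurl w b) x := fun v a b =>
    integrable_mul_mul (Lp.memLp v) a b ((hcurl b).pd a).continuous
  have c1 : Continuous fun v : Lp E3 2 (volume : Measure (Torus d)) =>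
      ∫ x, ∑ b, w b x * v x b := by
    simp only [integral_finsetSum _ fun b _ => i1 _ b]
    exact continuous_finsetSum _ fun b _ => continuous_integral_apply b (hw b).continuous
  have c2 : Continuous fun v : Lp E3 2 (volume : Measure (Torus d)) =>
      ∫ x, ∑ a, ∑ b, v x a * v x b * pd a (scurl w b) x := by
    have : ∀ v : Lp E3 2 (volume : Measure (Torus d)),
        ∫ x, ∑ a, ∑ b, v x a * v x b * pd a (scurl w b) x =
        ∑ a, ∑ b, ∫ x, v x a * v x b * pd a (scurl w b) x := fun v => by
      rw [integral_finsetSum _ fun a _ => integrable_finsetSum _ fun b _ => i2 v a b]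
      exact Finset.sum_congr rfl fun a _ => integral_finsetSum _ fun b _ => i2 v a b
    simp only [this]
    exact continuous_finsetSum _ fun a _ => continuous_finsetSum _ fun b _ =>
      continuous_integral_mul a b ((hcurl b).pd a).continuous
  refine sub_eq_integral_of_weak_deriv hT (c1.comp_continuousOn hsol.continuousOn)
    (c2.comp_continuousOn hsol.continuousOn) fun θ hθ hsupp => ?_
  have htest : IsSolenoidalTest T fun t => ofComps fun a x => θ t * w a x := by
    refine ⟨contDiff_euclidean.2 fun a => ?_, ?_, fun t x => ?_⟩
    · have hwa : ContDiff ℝ ∞ fun v : Fin d → ℝ => w a (toTorus v) := hw a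
      exact (hθ.comp contDiff_fst).mul (hwa.comp contDiff_snd)
    · obtain ⟨a, b, ha, hb, hab⟩ := hsupp
      refine ⟨a, b, ha, hb, fun t ht => ?_⟩
      funext x
      refine PiLp.ext fun c => ?_
      simp [ofComps_apply, hab t ht]
    · simp only [divergence, ofComps_apply, pd_const_mul, ← Finset.mul_sum, hdiv, mul_zero]
  refine Eq.trans ?_ (hsol.equation _ htest)
  refine intervalIntegral.integral_congr fun t _ => ?_
  simp only [ofComps_apply, curl_apply, scurl_const_mul, pd_const_mul]
  rw [← integral_const_mul, ← integral_const_mul, ← integral_add]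
  · congr 1
    ext x
    rw [Finset.mul_sum, Finset.mul_sum]
    congr 1
    · refine Finset.sum_congr rfl fun b _ => ?_
      rw [deriv_mul_const (hθ.differentiable (by simp) t)]; ring
    · refine Finset.sum_congr rfl fun a _ => ?_
      rw [Finset.mul_sum]
      exact Finset.sum_congr rfl fun b _ => by ring
  · exact (integrable_finsetSum _ fun b _ => i1 (h t) b).const_mul _
  · exact (integrable_finsetSum _ fun a _ => integrable_finsetSum _ fun b _ => i2 (h t) a b).const_mul _

/-- The increment formula has the endpoint values frozen in the second slot of `β`. Dividing by `t -
s` and letting `t → s`, continuity of `β` and `h` identifies the derivative of `D` with the diagonal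
value; integrating back gives the claim. This replaces a mollification in time. -/
theorem deriv_of_transfer {X : Type*} [NormedAddCommGroup X] {T : ℝ} (hT : 0 < T) {h : ℝ → X}
    (hh : ContinuousOn h (Icc 0 T)) {β : X → X → ℝ} (hβ : Continuous fun p : X × X => β p.1 p.2)
    {D : ℝ → ℝ}
    (hD : ∀ s ∈ Icc 0 T, ∀ t ∈ Icc 0 T, D t - D s = ∫ τ in s..t, β (h τ) (h t + h s)) :
    ∀ t ∈ Icc 0 T, D t - D 0 = ∫ τ in (0 : ℝ)..t, β (h τ) (h τ + h τ) := by
  have hle := hT.le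
  set h' : ℝ → X := IccExtend hle ((Icc 0 T).domRestrict h) with hh'
  have ch : Continuous h' := (continuousOn_iff_continuous_domRestrict.1 hh).Icc_extend'
  have eh : ∀ t ∈ Icc 0 T, h' t = h t := fun t ht => by
    rw [hh', IccExtend_of_mem _ _ ht]; rfl
  have cb : Continuous fun t => β (h' t) (h' t + h' t) := hβ.comp (ch.prodMk (ch.add ch))
  have hderiv : ∀ s ∈ Icc 0 T, HasDerivWithinAt D (β (h' s) (h' s + h' s)) (Icc 0 T) s := by
    intro s hs
    rw [hasDerivWithinAt_iff_isLittleO, Asymptotics.isLittleO_iff]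
    intro ε hε
    have hc : Continuous fun p : ℝ × ℝ => β (h' p.1) (h' p.2 + h' s) :=
      hβ.comp ((ch.comp continuous_fst).prodMk ((ch.comp continuous_snd).add continuous_const))
    obtain ⟨δ, hδ, hball⟩ := Metric.continuous_iff.1 hc (s, s) ε hε
    filter_upwards [self_mem_nhdsWithin, mem_nhdsWithin_of_mem_nhds (Metric.ball_mem_nhds s hδ)]
      with t ht hts
    have hsub : uIcc s t ⊆ Icc 0 T := ordConnected_Icc.uIcc_subset hs ht
    have e1 : D t - D s = ∫ τ in s..t, β (h' τ) (h' t + h' s) := by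
      rw [hD s hs t ht, eh t ht, eh s hs]
      refine intervalIntegral.integral_congr fun τ hτ => ?_
      simp only [eh τ (hsub hτ)]
    have e2 : D t - D s - (t - s) • β (h' s) (h' s + h' s) =
        ∫ τ in s..t, (β (h' τ) (h' t + h' s) - β (h' s) (h' s + h' s)) := by
      rw [intervalIntegral.integral_sub, ← e1, intervalIntegral.integral_const]
      · exact (hβ.comp (ch.prodMk continuous_const)).intervalIntegrable _ _
      · exact intervalIntegrable_const
    rw [e2]
    refine (intervalIntegral.norm_integral_le_of_norm_le_const fun τ hτ => ?_)
    have hd : dist (τ, t) (s, s) < δ := by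
      rw [Prod.dist_eq, max_lt_iff]
      refine ⟨lt_of_le_of_lt ?_ hts, hts⟩
      rw [Real.dist_eq, Real.dist_eq]
      exact abs_sub_left_of_mem_uIcc (uIoc_subset_uIcc hτ)
    exact (hball (τ, t) hd).le
  intro t ht
  have h1 : ∀ s ∈ Ioo 0 t, HasDerivAt D (β (h' s) (h' s + h' s)) s := fun s hs =>
    (hderiv s ⟨hs.1.le, hs.2.le.trans ht.2⟩).hasDerivAt
      (Icc_mem_nhds hs.1 (hs.2.trans_le ht.2))
  have h2 : ContinuousOn D (Icc 0 t) := fun s hs =>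
    ((hderiv s ⟨hs.1, hs.2.trans ht.2⟩).continuousWithinAt).mono (Icc_subset_Icc_right ht.2)
  rw [← intervalIntegral.integral_eq_sub_of_hasDerivAt_of_le ht.1 h2 h1 (cb.intervalIntegrable _ _)]
  refine intervalIntegral.integral_congr fun s hs => ?_
  rw [uIcc_of_le ht.1] at hs
  simp only [eh s ⟨hs.1, hs.2.trans ht.2⟩]

theorem sub_eq_integral_of_continuousOn {T : ℝ} {F : ℝ → ℝ} (hF : ContinuousOn F (Icc 0 T))
    {s t : ℝ} (hs : s ∈ Icc 0 T) (ht : t ∈ Icc 0 T)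
    {a b c : ℝ} (ha : a - c = ∫ τ in (0 : ℝ)..t, F τ) (hb : b - c = ∫ τ in (0 : ℝ)..s, F τ) :
    a - b = ∫ τ in s..t, F τ := by
  have ii : ∀ u ∈ Icc 0 T, IntervalIntegrable F volume 0 u := fun u hu =>
    (hF.mono (by rw [uIcc_of_le hu.1]; exact Icc_subset_Icc_right hu.2)).intervalIntegrable
  rw [← intervalIntegral.integral_interval_sub_left (ii t ht) (ii s hs), ← ha, ← hb]
  ring

/-- The energy of the mollified field. -/
noncomputable def mollEnergy (η : Torus d → ℝ) (v : Torus d → E3) : ℝ :=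
  ∑ a, ∫ x, conv η (fun y => v y a) x ^ 2

theorem transfer_add_self (η : Torus d → ℝ)
    (v : Lp E3 2 (volume : Measure (Torus d))) :
    transfer η v ⇑(v + v) = 2 * scaleFlux η v := by
  have h1 : ∀ c, conv η (conv η fun y => (v + v : Lp E3 2 (volume : Measure (Torus d))) y c) =
      fun x => 2 * conv η (conv η fun y => v y c) x := by
    intro c
    have : (fun y => (v + v : Lp E3 2 (volume : Measure (Torus d))) y c) =ᵐ[volume]
        fun y => 2 * v y c := by
      filter_upwards [Lp.coeFn_add v v] with y hy
      rw [hy, Pi.add_apply, PiLp.add_apply]; ring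
    rw [conv_congr_ae this]
    have h2 : ∀ f : Torus d → ℝ, conv η (fun y => 2 * f y) = fun x => 2 * conv η f x := fun f => by
      ext x
      rw [conv, conv, ← integral_const_mul]
      congr 1; ext y; ring
    rw [h2, h2]
  rw [transfer, scaleFlux, ← integral_const_mul]
  congr 1
  ext x
  simp only [h1, scurl_const_mul, pd_const_mul, Finset.mul_sum]
  exact Finset.sum_congr rfl fun a _ => Finset.sum_congr rfl fun b _ => by ring

/-- Polarization, `|V|² − |W|² = (V + W) · (V − W)` for the mollified fields, followed by moving one
mollifier to the other factor. The point is that a difference of energies becomes linear in the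
increment of the field. -/
theorem mollEnergy_sub {η : Torus d → ℝ} (hη : SmoothOnTorus η) (heven : ∀ x, η (-x) = η x)
    (v w : Lp E3 2 (volume : Measure (Torus d))) :
    mollEnergy η v - mollEnergy η w =
      (∫ x, ∑ b, conv η (conv η fun y => (v + w : Lp E3 2 (volume : Measure (Torus d))) y b) x *
        v x b) -
      ∫ x, ∑ b, conv η (conv η fun y => (v + w : Lp E3 2 (volume : Measure (Torus d))) y b) x *
        w x b := by
  have hi : ∀ (v : Lp E3 2 (volume : Measure (Torus d))) c, Integrable fun y => v y c :=
    fun v c => integrable_comp (Lp.memLp v) one_le_two c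
  set U : Lp E3 2 (volume : Measure (Torus d)) → Fin 3 → Torus d → ℝ :=
    fun v c => conv η fun y => v y c with hU
  have hs : ∀ v c, SmoothOnTorus (U v c) := fun v c => hη.conv (hi v c)
  have hadd : ∀ c x, U (v + w) c x = U v c x + U w c x := by
    intro c x
    have : (fun y => (v + w : Lp E3 2 (volume : Measure (Torus d))) y c) =ᵐ[volume]
        fun y => v y c + w y c := by
      filter_upwards [Lp.coeFn_add v w] with y hy
      rw [hy, Pi.add_apply, PiLp.add_apply]
    simp only [hU]
    rw [conv_congr_ae this, conv_add hη.continuous (hi v c) (hi w c)]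
  have key : ∀ z : Lp E3 2 (volume : Measure (Torus d)),
      ∫ x, ∑ b, conv η (U (v + w) b) x * z x b = ∑ b, ∫ x, U (v + w) b x * U z b x := by
    intro z
    rw [integral_finsetSum]
    · refine Finset.sum_congr rfl fun b _ => ?_
      exact (integral_mul_conv hη.continuous (hs _ b).integrable (hi z b) heven).symm
    · intro b _
      have hsm := hη.conv (hs (v + w) b).integrable
      obtain ⟨C, hC⟩ := hsm.exists_bound
      exact (hi z b).bdd_mul hsm.continuous.aestronglyMeasurable (Eventually.of_forall hC)
  rw [key, key, ← Finset.sum_sub_distrib, mollEnergy, mollEnergy, ← Finset.sum_sub_distrib]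
  refine Finset.sum_congr rfl fun b _ => ?_
  have e1 : ∀ z : Lp E3 2 (volume : Measure (Torus d)), Integrable fun x => U z b x ^ 2 := fun z => by
    simpa only [pow_two] using ((hs z b).mul (hs z b)).integrable
  rw [← integral_sub (e1 v) (e1 w), ← integral_sub ((hs _ b).mul (hs v b)).integrable
    ((hs _ b).mul (hs w b)).integrable]
  congr 1
  ext x
  rw [hadd]
  ring

theorem energy_identity {T : ℝ} (hT : 0 < T) {h : ℝ → Lp E3 2 (volume : Measure (Torus d))}
    (hsol : IsEMHDWeakSolution T h) {η : Torus d → ℝ} (hη : SmoothOnTorus η)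
    (heven : ∀ x, η (-x) = η x) :
    ∀ t ∈ Icc 0 T, mollEnergy η (h t) - mollEnergy η (h 0) =
      ∫ s in (0 : ℝ)..t, 2 * scaleFlux η (h s) := by
  have hi : ∀ (v : Lp E3 2 (volume : Measure (Torus d))) c, Integrable fun y => v y c :=
    fun v c => integrable_comp (Lp.memLp v) one_le_two c
  have hdivadd : ∀ s ∈ Icc 0 T, ∀ t ∈ Icc 0 T, WeaklyDivFree ⇑(h t + h s) := by
    intro s hs t ht φ hφ
    have h1 := hsol.div_free t ht φ hφ
    have h2 := hsol.div_free s hs φ hφ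
    have i1 : ∀ v : Lp E3 2 (volume : Measure (Torus d)),
        Integrable fun x => ∑ a, v x a * pd a φ x := fun v =>
      integrable_finsetSum _ fun a _ => by
        obtain ⟨C, hC⟩ := (hφ.pd a).exists_bound
        exact (hi v a).mul_bdd (hφ.pd a).continuous.aestronglyMeasurable (Eventually.of_forall hC)
    have h3 := integral_add (i1 (h t)) (i1 (h s))
    rw [h1, h2, add_zero] at h3
    rw [← h3]
    refine integral_congr_ae ?_
    filter_upwards [Lp.coeFn_add (h t) (h s)] with x hx
    rw [hx, ← Finset.sum_add_distrib]
    exact Finset.sum_congr rfl fun a _ => by rw [Pi.add_apply, PiLp.add_apply]; ring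
  have key := deriv_of_transfer hT hsol.continuousOn
    (β := fun v w => transfer η v w) (continuous_transfer hη)
    (D := fun t => mollEnergy η (h t)) fun s hs t ht => ?_
  · intro t ht
    rw [key t ht]
    simp only [transfer_add_self η]
  · have hs1 : ∀ a, SmoothOnTorus (conv η fun y => (h t + h s : Lp E3 2 (volume : Measure (Torus d))) y a) :=
      fun a => hη.conv (hi _ a)
    have hw : ∀ a, SmoothOnTorus (conv η (conv η fun y =>
        (h t + h s : Lp E3 2 (volume : Measure (Torus d))) y a)) :=
      fun a => hη.conv (hs1 a).integrable
    have hdiv : ∀ x, ∑ a, pd a (conv η (conv η fun y =>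
        (h t + h s : Lp E3 2 (volume : Measure (Torus d))) y a)) x = 0 := by
      intro x
      -- Double mollification is a single convolution with `conv η η`, so the frozen field is an
      -- admissible solenoidal test field.
      have h0 := sum_pd_conv_eq_zero (hη.conv hη.integrable) (hi (h t + h s)) (hdivadd s hs t ht) x
      rw [← h0]
      exact Finset.sum_congr rfl fun a _ => by
        rw [conv_assoc hη.continuous hη.continuous (hi _ a)]
    have hform := weak_form_of_solenoidal hT hsol hw hdiv
    have e1 := hform t ht
    have e2 := hform s hs
    rw [mollEnergy_sub hη heven]
    have hcont : ContinuousOn (fun τ => transfer η (h τ) ⇑(h t + h s)) (Icc 0 T) := by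
      have h1 : ContinuousOn (fun τ => (h τ, h t + h s)) (Icc 0 T) :=
        hsol.continuousOn.prodMk continuousOn_const
      have h2 := continuous_transfer hη
      generalize h t + h s = w at h1 ⊢
      exact Continuous.comp_continuousOn' (f := fun τ => (h τ, w))
        (g := fun p : Lp E3 2 (volume : Measure (Torus d)) × Lp E3 2 (volume : Measure (Torus d)) =>
          transfer η p.1 p.2) h2 h1
    exact sub_eq_integral_of_continuousOn hcont hs ht e1 e2

end EnergyIdentity

/-! ### Vanishing flux implies energy conservation -/

theorem eLpNorm_prod_le {α β E : Type*} [MeasurableSpace α] [MeasurableSpace β]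
    [NormedAddCommGroup E] {μ : Measure α} [IsProbabilityMeasure μ] {ν : Measure β} [SFinite ν]
    {F : α × β → E} (hF : AEStronglyMeasurable F (μ.prod ν)) {q M : ℝ≥0∞}
    (hM : ∀ᵐ a ∂μ, eLpNorm (fun b => F (a, b)) q ν ≤ M) : eLpNorm F q (μ.prod ν) ≤ M := by
  -- A strongly measurable representative makes the superlevel sets measurable, as needed to
  -- exchange null sets between slices and product when `q = ∞`.
  obtain ⟨G, hG, hFG⟩ := hF
  rw [eLpNorm_congr_ae hFG]
  have hM' : ∀ᵐ a ∂μ, eLpNorm (fun b => G (a, b)) q ν ≤ M := by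
    filter_upwards [hM, Measure.ae_ae_of_ae_prod hFG] with a h1 h2
    rwa [← eLpNorm_congr_ae h2]
  have hGm : Measurable fun z => ‖G z‖ₑ := hG.enorm
  by_cases hq0 : q = 0
  · simp [hq0]
  by_cases hq : q = ⊤
  · subst hq
    rw [eLpNorm_exponent_top]
    refine essSup_le_of_ae_le _ ?_
    have hs : MeasurableSet {z : α × β | ‖G z‖ₑ ≤ M} := measurableSet_le hGm measurable_const
    refine (Measure.ae_prod_mem_iff_ae_ae_mem hs).2 ?_
    filter_upwards [hM'] with a ha
    rw [eLpNorm_exponent_top] at ha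
    filter_upwards [enorm_ae_le_eLpNormEssSup (fun b => G (a, b)) ν] with b hb
    exact hb.trans ha
  · have hpos : 0 < q.toReal := ENNReal.toReal_pos hq0 hq
    rw [eLpNorm_eq_lintegral_rpow_enorm_toReal hq0 hq, one_div, ENNReal.rpow_inv_le_iff hpos,
      lintegral_prod _ (hGm.pow_const _).aemeasurable]
    calc _ ≤ ∫⁻ _, M ^ q.toReal ∂μ := by
          refine lintegral_mono_ae ?_
          filter_upwards [hM'] with a ha
          rwa [eLpNorm_eq_lintegral_rpow_enorm_toReal hq0 hq, one_div,
            ENNReal.rpow_inv_le_iff hpos] at ha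
      _ = M ^ q.toReal := by simp

section FluxCriterion

variable {d : ℕ}

/-- The mean over shifts is taken with respect to a probability measure, so a bound for almost every
shift of the ball survives averaging, for every exponent. -/
theorem meanOsc_le {q M : ℝ≥0∞} {ε : ℝ} (hε : 0 < ε) {v : Torus d → E3}
    (hv : AEStronglyMeasurable v)
    (hM : ∀ᵐ y : Torus d, torusLength y < ε → eLpNorm (fun x => v (x - y) - v x) q ≤ M) :
    meanOsc q ε v ≤ M := by
  have := isProbabilityMeasure_ballMeasure (d := d) hε
  rw [meanOsc_eq]
  have h1 := eLpNorm_comp_measurePreserving (p := q) (aestronglyMeasurable_diff hv ε)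
    (Measure.measurePreserving_swap (μ := ballMeasure d ε) (ν := volume))
  rw [← h1]
  refine eLpNorm_prod_le ((aestronglyMeasurable_diff hv ε).comp_measurePreserving
    Measure.measurePreserving_swap) ?_
  have h2 : ∀ᵐ y ∂(ballMeasure d ε), y ∈ torusBall d ε :=
    ProbabilityTheory.ae_cond_mem (isOpen_torusBall ε).measurableSet
  filter_upwards [h2, ProbabilityTheory.cond_absolutelyContinuous.ae_le hM] with y hy hy'
  rw [← eLpNorm_neg]
  refine (eLpNorm_congr_ae (Eventually.of_forall fun x => ?_)).trans_le (hy' hy)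
  simp

theorem tendsto_eLpNorm_shift (v : Lp E3 2 (volume : Measure (Torus d))) :
    Tendsto (fun y : Torus d => eLpNorm (fun x => v (x - y) - v x) 2 volume) (𝓝 0) (𝓝 0) := by
  have : Fact ((2 : ℝ≥0∞) ≠ ⊤) := ⟨ENNReal.ofNat_ne_top⟩
  have : ContinuousVAdd (Torus d)ᵈᵃᵃ (Lp E3 2 (volume : Measure (Torus d))) :=
    Lp.instContinuousVAddDomAddAct
  have hc : Continuous fun y : Torus d => ‖(DomAddAct.mk (-y) +ᵥ v) - v‖ₑ := by
    refine Continuous.enorm (Continuous.sub ?_ continuous_const)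
    exact Continuous.vadd (DomAddAct.continuous_mk.comp continuous_neg) continuous_const
  have h0 := hc.tendsto 0
  have h1 : DomAddAct.mk (-(0 : Torus d)) +ᵥ v = v := by
    rw [neg_zero]
    exact zero_vadd _ v
  rw [h1, sub_self, enorm_zero] at h0
  refine h0.congr fun y => ?_
  rw [Lp.enorm_def]
  refine eLpNorm_congr_ae ?_
  filter_upwards [Lp.coeFn_sub (DomAddAct.mk (-y) +ᵥ v) v, DomAddAct.vadd_Lp_ae_eq (DomAddAct.mk (-y)) v]
    with x h1 h2
  rw [h1, Pi.sub_apply, h2]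
  simp only [Equiv.symm_apply_apply, vadd_eq_add]
  rw [neg_add_eq_sub]

theorem exists_torusLength_lt {s : Set (Torus d)} (hs : s ∈ 𝓝 (0 : Torus d)) :
    ∃ δ : ℝ, 0 < δ ∧ ∀ y, torusLength y < δ → y ∈ s := by
  obtain ⟨δ, hδ, h⟩ := Metric.mem_nhds_iff.1 hs
  refine ⟨δ, hδ, fun y hy => h ?_⟩
  rw [mem_ball_zero_iff]
  exact (pi_norm_lt_iff hδ).2 fun i => (norm_apply_le_torusLength y i).trans_lt hy

theorem tendsto_meanOsc_two (v : Lp E3 2 (volume : Measure (Torus d))) :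
    Tendsto (fun ε : ℝ => meanOsc 2 ε v) (𝓝[>] 0) (𝓝 0) := by
  rw [ENNReal.tendsto_nhds_zero]
  intro c hc
  obtain ⟨δ, hδ, h⟩ := exists_torusLength_lt
    ((ENNReal.tendsto_nhds_zero.1 (tendsto_eLpNorm_shift v)) c hc)
  filter_upwards [Ioo_mem_nhdsGT hδ] with ε hε
  exact meanOsc_le hε.1 (Lp.aestronglyMeasurable v)
    (Eventually.of_forall fun y hy => h y (hy.trans hε.2))

/-- Mollification preserves integrals, so the energy defect is the integrated trace of the same
commutator as in the flux, and the same pointwise bound applies. -/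
theorem enorm_mollEnergy_sub_le {C ε : ℝ} {η : Torus d → ℝ} (hη : IsMollifier C ε η) (hC : 0 ≤ C)
    (hε : 0 < ε) {v : Torus d → E3} (hv : MemLp v 2) :
    ‖(∫ x, ‖v x‖ ^ 2) - mollEnergy η v‖ₑ ≤ 3 * (ENNReal.ofReal (2 * C) * meanOsc 2 ε v ^ 2) := by
  have hvv := fun a => integrable_comp_mul hv hv a a
  have hvi := fun a => integrable_comp hv one_le_two a
  have hcs : ∀ a, SmoothOnTorus (conv η fun y => v y a) := fun a => hη.smooth.conv (hvi a)
  have hone : ∀ x, conv η (fun _ => (1 : ℝ)) x = 1 := fun x => by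
    rw [conv_eq_integral_shift]; simp [hη.integral_eq_one]
  have e1 : ∀ a, ∫ x, conv η (fun y => v y a * v y a) x = ∫ x, v x a * v x a := fun a => by
    have := integral_mul_conv (f := fun _ => (1 : ℝ)) hη.smooth.continuous
      (integrable_const 1) (hvv a) hη.even
    simpa [hone] using this
  have e2 : (∫ x, ‖v x‖ ^ 2) = ∑ a, ∫ x, v x a * v x a := by
    rw [← integral_finsetSum _ fun a _ => hvv a]
    congr 1
    ext x
    rw [EuclideanSpace.real_norm_sq_eq]
    exact Finset.sum_congr rfl fun a _ => by ring
  have e3 : (∫ x, ‖v x‖ ^ 2) - mollEnergy η v =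
      ∑ a, ∫ x, (conv η (fun y => v y a * v y a) x -
        conv η (fun y => v y a) x * conv η (fun y => v y a) x) := by
    rw [e2, mollEnergy, ← Finset.sum_sub_distrib]
    refine Finset.sum_congr rfl fun a _ => ?_
    rw [integral_sub (hη.smooth.conv (hvv a)).integrable ((hcs a).mul (hcs a)).integrable, e1]
    simp only [pow_two]
  have e4 : ∫⁻ x, ∫⁻ z, ‖v x - v (x - z)‖ₑ ^ 2 ∂(ballMeasure d ε) = meanOsc 2 ε v ^ 2 := by
    have hm := aestronglyMeasurable_diff hv.1 ε
    rw [meanOsc_eq, eLpNorm_eq_lintegral_rpow_enorm_toReal two_ne_zero ENNReal.ofNat_ne_top,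
      lintegral_prod _ (hm.enorm.pow_const _)]
    rw [← ENNReal.rpow_natCast, ← ENNReal.rpow_mul]
    simp
  rw [e3]
  refine (enorm_sum_le _ _).trans ?_
  calc _ ≤ ∑ _a : Fin 3, ENNReal.ofReal (2 * C) * meanOsc 2 ε v ^ 2 := by
        refine Finset.sum_le_sum fun a _ => ?_
        rw [← e4, ← lintegral_const_mul' _ _ ENNReal.ofReal_ne_top]
        exact (enorm_integral_le_lintegral_enorm _).trans
          (lintegral_mono fun x => enorm_commutator_le hη hC hε hv a a x)
    _ = _ := by simp

theorem energy_eq_of_tendsto_flux {T : ℝ} (hT : 0 < T)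
    {h : ℝ → Lp E3 2 (volume : Measure (Torus d))} (hsol : IsEMHDWeakSolution T h) {C : ℝ}
    (hC : 0 ≤ C) {η : ℝ → Torus d → ℝ} (hη : ∀ ε, 0 < ε → ε ≤ 1 → IsMollifier C ε (η ε))
    (hflux : Tendsto (fun ε => ∫⁻ t in Ioo 0 T, ‖scaleFlux (η ε) (h t)‖ₑ) (𝓝[>] 0) (𝓝 0)) :
    ∀ t ∈ Icc 0 T, ∫ x, ‖h t x‖ ^ 2 = ∫ x, ‖h 0 x‖ ^ 2 := by
  intro t ht
  have hev : ∀ᶠ ε : ℝ in 𝓝[>] 0, IsMollifier C ε (η ε) ∧ 0 < ε := by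
    filter_upwards [Ioo_mem_nhdsGT (zero_lt_one' ℝ)] with ε hε
    exact ⟨hη ε hε.1 hε.2.le, hε.1⟩
  have hlim : ∀ s, Tendsto (fun ε => mollEnergy (η ε) (h s)) (𝓝[>] 0) (𝓝 (∫ x, ‖h s x‖ ^ 2)) := by
    intro s
    rw [← tendsto_sub_nhds_zero_iff, tendsto_zero_iff_enorm_tendsto_zero]
    have h0 : Tendsto (fun ε => 3 * (ENNReal.ofReal (2 * C) * meanOsc 2 ε (h s) ^ 2))
        (𝓝[>] 0) (𝓝 0) := by
      have h1 := (ENNReal.continuous_pow 2).tendsto 0 |>.comp (tendsto_meanOsc_two (h s))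
      have h2 := ENNReal.Tendsto.const_mul (a := 3) (ENNReal.Tendsto.const_mul
        (a := ENNReal.ofReal (2 * C)) h1 (Or.inr ENNReal.ofReal_ne_top))
        (Or.inr ENNReal.ofNat_ne_top)
      simpa using h2
    refine tendsto_of_tendsto_of_tendsto_of_le_of_le' tendsto_const_nhds h0
      (Eventually.of_forall fun _ => zero_le) ?_
    filter_upwards [hev] with ε hε
    rw [← enorm_neg, neg_sub]
    exact enorm_mollEnergy_sub_le hε.1 hC hε.2 (Lp.memLp (h s))
  have h1 := (hlim t).sub (hlim 0)
  have h2 : Tendsto (fun ε => mollEnergy (η ε) (h t) - mollEnergy (η ε) (h 0)) (𝓝[>] 0) (𝓝 0) := by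
    rw [tendsto_zero_iff_enorm_tendsto_zero]
    have h0 : Tendsto (fun ε => 2 * ∫⁻ t in Ioo 0 T, ‖scaleFlux (η ε) (h t)‖ₑ) (𝓝[>] 0) (𝓝 0) := by
      simpa using ENNReal.Tendsto.const_mul (a := 2) hflux (Or.inr ENNReal.ofNat_ne_top)
    refine tendsto_of_tendsto_of_tendsto_of_le_of_le' tendsto_const_nhds h0
      (Eventually.of_forall fun _ => zero_le) ?_
    filter_upwards [hev] with ε hε
    rw [energy_identity hT hsol hε.1.smooth hε.1.even t ht, intervalIntegral.integral_const_mul,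
      enorm_mul, intervalIntegral.integral_of_le ht.1]
    have e2 : ‖(2 : ℝ)‖ₑ = 2 := by
      rw [Real.enorm_eq_ofReal zero_le_two]; simp
    rw [e2]
    gcongr
    refine (enorm_integral_le_lintegral_enorm _).trans ?_
    rw [Measure.restrict_congr_set (Ioo_ae_eq_Ioc (μ := volume) (a := (0 : ℝ)) (b := T))]
    exact lintegral_mono_set (Ioc_subset_Ioc_right ht.2)
  exact sub_eq_zero.1 (tendsto_nhds_unique h1 h2)

end FluxCriterion

/-! ### Energy conservation from bounds on oscillations -/

section Criteria

variable {d : ℕ}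

/-- Needed for measurability in time only. The exponent `q` is unrelated to `m`, so the oscillation
may be infinite and need not be continuous; Fatou along an almost everywhere convergent subsequence
still gives closed sublevel sets. -/
theorem lowerSemicontinuous_meanOsc (m : ℝ≥0∞) [Fact (1 ≤ m)] (q : ℝ≥0∞) (ε : ℝ) :
    LowerSemicontinuous fun f : Lp E3 m (volume : Measure (Torus d)) => meanOsc q ε f := by
  rw [lowerSemicontinuous_iff_isClosed_preimage]
  intro c
  refine IsSeqClosed.isClosed fun f g hf hfg => ?_
  simp only [mem_preimage, mem_Iic] at hf ⊢
  have hm : m ≠ 0 := (zero_lt_one.trans_le (Fact.out : 1 ≤ m)).ne'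
  obtain ⟨ns, -, hns⟩ := (tendstoInMeasure_of_tendsto_Lp hfg).exists_seq_tendsto_ae
  have h1 : ∀ᵐ z ∂((volume : Measure (Torus d)).prod (ballMeasure d ε)),
      Tendsto (fun n => f (ns n) z.1 - f (ns n) (z.1 - z.2)) atTop (𝓝 (g z.1 - g (z.1 - z.2))) := by
    filter_upwards [Measure.quasiMeasurePreserving_fst.ae hns,
      (quasiMeasurePreserving_sub_ballMeasure ε).ae hns] with z h1 h2
    exact h1.sub h2
  refine (Lp.eLpNorm_lim_le_liminf_eLpNorm
    (fun n => aestronglyMeasurable_diff (Lp.aestronglyMeasurable (f (ns n))) ε) _ h1).trans ?_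
  refine liminf_le_of_le (by isBoundedDefault) fun b hb => ?_
  obtain ⟨n, hn⟩ := hb.exists
  exact hn.trans (hf (ns n))

theorem aemeasurable_meanOsc {m : ℝ≥0∞} [Fact (1 ≤ m)] {μ : Measure ℝ}
    {f : ℝ → Lp E3 m (volume : Measure (Torus d))} (hf : AEStronglyMeasurable f μ) (q : ℝ≥0∞)
    (ε : ℝ) : AEMeasurable (fun t => meanOsc q ε (f t)) μ := by
  let _ : MeasurableSpace (Lp E3 m (volume : Measure (Torus d))) := borel _
  have : BorelSpace (Lp E3 m (volume : Measure (Torus d))) := ⟨rfl⟩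
  exact (lowerSemicontinuous_meanOsc m q ε).measurable.comp_aemeasurable hf.aemeasurable

theorem ae_eLpNorm_shift_le_besovNorm (s : ℝ) (q : ℝ≥0∞) (f : Torus d → E3) :
    ∀ᵐ y : Torus d, eLpNorm (fun x => f (x - y) - f x) q volume ≤
      ENNReal.ofReal (torusLength y ^ s) * besovNorm s q f := by
  filter_upwards [ENNReal.ae_le_essSup (μ := (volume : Measure (Torus d))) (fun y : Torus d =>
    ENNReal.ofReal (torusLength y ^ (-s)) *
      eLpNorm (fun x => f (x - y) - f x) q volume)] with y hy
  by_cases hy0 : torusLength y = 0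
  · have : y = 0 := by
      ext i
      have := norm_apply_le_torusLength y i
      rw [hy0] at this
      simpa using this
    subst this
    simp
  · have hpos : 0 < torusLength y := lt_of_le_of_ne (Real.sqrt_nonneg _) (Ne.symm hy0)
    have e1 : ENNReal.ofReal (torusLength y ^ s) * ENNReal.ofReal (torusLength y ^ (-s)) = 1 := by
      rw [← ENNReal.ofReal_mul (by positivity), ← Real.rpow_add hpos, add_neg_cancel,
        Real.rpow_zero, ENNReal.ofReal_one]
    calc eLpNorm (fun x => f (x - y) - f x) q volume
        = ENNReal.ofReal (torusLength y ^ s) * (ENNReal.ofReal (torusLength y ^ (-s)) *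
          eLpNorm (fun x => f (x - y) - f x) q volume) := by rw [← mul_assoc, e1, one_mul]
      _ ≤ ENNReal.ofReal (torusLength y ^ s) * besovNorm s q f := by
        gcongr
        exact hy.trans le_add_self

/-- For `s > 0` the difference quotient is used. For `s ≤ 0` the weight is useless near zero, but
then `1 ≤ ε ^ s` and the `L^q` part of the norm suffices; this case causes the factor `2` and the
restriction `ε ≤ 1`. -/
theorem meanOsc_le_besovNorm {ε : ℝ} (hε : 0 < ε) (hε1 : ε ≤ 1) {q : ℝ≥0∞} (hq : 1 ≤ q) (s : ℝ)
    {f : Torus d → E3} (hf : AEStronglyMeasurable f) :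
    meanOsc q ε f ≤ 2 * ENNReal.ofReal (ε ^ s) * besovNorm s q f := by
  have hsub : ∀ y : Torus d, AEStronglyMeasurable fun x => f (x - y) := fun y =>
    hf.comp_measurePreserving (measurePreserving_sub_right volume y)
  have htwo : ∀ y : Torus d, eLpNorm (fun x => f (x - y) - f x) q volume ≤
      2 * eLpNorm f q volume := by
    intro y
    refine (eLpNorm_sub_le (hsub y) hf hq).trans_eq ?_
    rw [two_mul]
    congr 1
    exact eLpNorm_comp_measurePreserving hf (measurePreserving_sub_right volume y)
  by_cases hs : s ≤ 0
  · refine meanOsc_le hε hf (Eventually.of_forall fun y _ => (htwo y).trans ?_)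
    have h1 : 1 ≤ ENNReal.ofReal (ε ^ s) := by
      rw [← ENNReal.ofReal_one]
      exact ENNReal.ofReal_le_ofReal (Real.one_le_rpow_of_pos_of_le_one_of_nonpos hε hε1 hs)
    calc 2 * eLpNorm f q volume ≤ 2 * 1 * besovNorm s q f := by
          rw [mul_one]; gcongr; exact le_self_add
      _ ≤ _ := by gcongr
  · push Not at hs
    refine meanOsc_le hε hf ?_
    filter_upwards [ae_eLpNorm_shift_le_besovNorm s q f] with y hy hyε
    refine hy.trans ?_
    have h1 : torusLength y ^ s ≤ ε ^ s := Real.rpow_le_rpow (Real.sqrt_nonneg _) hyε.le hs.le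
    rw [mul_assoc]
    refine le_trans ?_ (le_mul_of_one_le_left zero_le one_le_two)
    gcongr

theorem timeNorm_mono {T : ℝ} {r : ℝ≥0∞} {M N : ℝ → ℝ≥0∞} (h : ∀ t, M t ≤ N t) :
    timeNorm T r M ≤ timeNorm T r N :=
  eLpNorm_mono_enorm fun t => by simpa using h t

theorem timeNorm_const_mul_le {T : ℝ} {r c : ℝ≥0∞} (hc : c ≠ ⊤) (N : ℝ → ℝ≥0∞) :
    timeNorm T r (fun t => c * N t) ≤ c * timeNorm T r N := by
  lift c to NNReal using hc
  exact eLpNorm_le_nnreal_smul_eLpNorm_of_ae_le_mul' (Eventually.of_forall fun t => by simp) r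

theorem one_le_of_holder {p q : ℝ≥0∞} (hpq : p⁻¹ + 2 * q⁻¹ = 1) : 1 ≤ p ∧ 1 ≤ q := by
  have h1 : p⁻¹ ≤ 1 := hpq ▸ le_self_add
  have h2 : q⁻¹ ≤ 1 := by
    refine le_trans ?_ (hpq ▸ le_add_self : 2 * q⁻¹ ≤ 1)
    exact le_mul_of_one_le_left zero_le one_le_two
  exact ⟨by simpa using h1, by simpa using h2⟩

/-- The relation between the time exponents has the same shape as that between the space exponents,
so the same Hölder inequality is applied once more. -/
theorem lintegral_scaleFlux_le {T : ℝ} {h : ℝ → Lp E3 2 (volume : Measure (Torus d))}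
    (hsol : IsEMHDWeakSolution T h) {C ε A : ℝ} {η : Torus d → ℝ} (hη : IsMollifier C ε η)
    (hC : 0 ≤ C) (hε : 0 < ε) {m : ℝ≥0∞} [Fact (1 ≤ m)]
    {g : ℝ → Lp E3 m (volume : Measure (Torus d))}
    (hg : AEStronglyMeasurable g (volume.restrict (Ioo 0 T)))
    (hD : ∀ᵐ t ∂(volume.restrict (Ioo 0 T)), ∀ a b x,
      ‖pd a (scurl (fun c => conv η fun y => h t y c) b) x‖ₑ ≤
      ENNReal.ofReal A * ∫⁻ z, ‖g t x - g t (x - z)‖ₑ ∂(ballMeasure d ε))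
    {p q r₁ r₂ : ℝ≥0∞} (hpq : p⁻¹ + 2 * q⁻¹ = 1) (hr : r₁⁻¹ + 2 * r₂⁻¹ = 1) :
    ∫⁻ t in Ioo 0 T, ‖scaleFlux η (h t)‖ₑ ≤ ENNReal.ofReal (18 * C) * (ENNReal.ofReal A *
      (timeNorm T r₁ (fun t => meanOsc p ε (g t)) *
        timeNorm T r₂ (fun t => meanOsc q ε (h t)) ^ 2)) := by
  have hh : AEStronglyMeasurable h (volume.restrict (Ioo 0 T)) :=
    (hsol.continuousOn.mono Ioo_subset_Icc_self).aestronglyMeasurable measurableSet_Ioo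
  refine le_trans ?_ (mul_le_mul_right (mul_le_mul_right (lintegral_mul_sq_le
    (aemeasurable_meanOsc hg p ε) (aemeasurable_meanOsc hh q ε) hr) _) _)
  rw [← lintegral_const_mul' _ _ ENNReal.ofReal_ne_top, ← lintegral_const_mul' _ _ ENNReal.ofReal_ne_top]
  refine lintegral_mono_ae ?_
  filter_upwards [hD, ae_restrict_mem measurableSet_Ioo] with t ht htT
  rw [← mul_assoc]
  exact enorm_scaleFlux_le hη hC hε (Lp.memLp (h t)) (hsol.div_free t (Ioo_subset_Icc_self htT))
    (Lp.aestronglyMeasurable (g t)) ht hpq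

/-- Bookkeeping of powers: the loss `ε^{-κ}` from derivatives is absorbed by one factor `ε^a` and
two factors `ε^b`. Smallness is asked only of the product of the normalized quantities, so a single
vanishing factor is enough when the other stays bounded. -/
theorem tendsto_scaled_product {a b κ K L : ℝ} (hκ : κ ≤ a + 2 * b) {P Q X Y : ℝ → ℝ≥0∞}
    (hP : ∀ᶠ ε in 𝓝[>] 0, P ε ≤ ENNReal.ofReal (ε ^ a) * X ε)
    (hQ : ∀ᶠ ε in 𝓝[>] 0, Q ε ≤ ENNReal.ofReal (ε ^ b) * Y ε)
    (hXY : Tendsto (fun ε => X ε * Y ε ^ 2) (𝓝[>] 0) (𝓝 0)) :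
    Tendsto (fun ε : ℝ => ENNReal.ofReal L * (ENNReal.ofReal (K * ε ^ (-κ)) * (P ε * Q ε ^ 2)))
      (𝓝[>] 0) (𝓝 0) := by
  have h0 : Tendsto (fun ε => ENNReal.ofReal L * (ENNReal.ofReal K * (X ε * Y ε ^ 2)))
      (𝓝[>] 0) (𝓝 0) := by
    simpa using ENNReal.Tendsto.const_mul (a := ENNReal.ofReal L)
      (ENNReal.Tendsto.const_mul (a := ENNReal.ofReal K) hXY (Or.inr ENNReal.ofReal_ne_top))
      (Or.inr ENNReal.ofReal_ne_top)
  refine tendsto_of_tendsto_of_tendsto_of_le_of_le' tendsto_const_nhds h0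
    (Eventually.of_forall fun _ => zero_le) ?_
  filter_upwards [hP, hQ, Ioo_mem_nhdsGT (zero_lt_one' ℝ)] with ε h1 h2 hε
  have e1 : ENNReal.ofReal (ε ^ (-κ)) * (ENNReal.ofReal (ε ^ a) * ENNReal.ofReal (ε ^ b) ^ 2) ≤ 1 := by
    rw [← ENNReal.ofReal_pow (Real.rpow_nonneg hε.1.le _), ← ENNReal.ofReal_mul (Real.rpow_nonneg hε.1.le _),
      ← ENNReal.ofReal_mul (Real.rpow_nonneg hε.1.le _), ← ENNReal.ofReal_one, ← Real.rpow_natCast,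
      ← Real.rpow_mul hε.1.le, ← Real.rpow_add hε.1, ← Real.rpow_add hε.1]
    refine ENNReal.ofReal_le_ofReal (Real.rpow_le_one hε.1.le hε.2.le ?_)
    push_cast
    linarith
  rw [ENNReal.ofReal_mul' (Real.rpow_nonneg hε.1.le _)]
  calc _ ≤ ENNReal.ofReal L * (ENNReal.ofReal K * ENNReal.ofReal (ε ^ (-κ)) *
        ((ENNReal.ofReal (ε ^ a) * X ε) * (ENNReal.ofReal (ε ^ b) * Y ε) ^ 2)) := by gcongr
    _ = ENNReal.ofReal L * (ENNReal.ofReal K * (X ε * Y ε ^ 2)) * (ENNReal.ofReal (ε ^ (-κ)) *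
        (ENNReal.ofReal (ε ^ a) * ENNReal.ofReal (ε ^ b) ^ 2)) := by ring
    _ ≤ _ := mul_le_of_le_one_right zero_le e1

theorem timeNorm_meanOsc_le {T ε : ℝ} (hε : 0 < ε) (hε1 : ε ≤ 1) {r q m : ℝ≥0∞} (hq : 1 ≤ q) (s : ℝ)
    (f : ℝ → Lp E3 m (volume : Measure (Torus d))) :
    timeNorm T r (fun t => meanOsc q ε (f t)) ≤
      ENNReal.ofReal (ε ^ s) * (2 * timeNorm T r fun t => besovNorm s q (f t)) := by
  refine (timeNorm_mono fun t => meanOsc_le_besovNorm hε hε1 hq s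
    (Lp.aestronglyMeasurable (f t))).trans ?_
  refine (timeNorm_const_mul_le (ENNReal.mul_ne_top ENNReal.ofNat_ne_top
    ENNReal.ofReal_ne_top) _).trans_eq ?_
  ring

theorem le_rpow_mul_rpow_neg_mul {ε : ℝ} (hε : 0 < ε) (s : ℝ) (x : ℝ≥0∞) :
    x ≤ ENNReal.ofReal (ε ^ s) * (ENNReal.ofReal (ε ^ (-s)) * x) := by
  rw [← mul_assoc, ← ENNReal.ofReal_mul (Real.rpow_nonneg hε.le _), ← Real.rpow_add hε,
    add_neg_cancel, Real.rpow_zero, ENNReal.ofReal_one, one_mul]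

theorem energy_eq_of_oscillation {T : ℝ} (hT : 0 < T)
    {h : ℝ → Lp E3 2 (volume : Measure (Torus d))} (hsol : IsEMHDWeakSolution T h)
    (hosc : Tendsto (fun ε : ℝ => ENNReal.ofReal (ε ^ (-(2 / 3) : ℝ)) *
      timeNorm T 3 (fun t => meanOsc 3 ε (h t))) (𝓝[>] 0) (𝓝 0)) :
    ∀ t ∈ Icc 0 T, ∫ x, ‖h t x‖ ^ 2 = ∫ x, ‖h 0 x‖ ^ 2 := by
  obtain ⟨C, hC, hη⟩ := exists_mollifier d
  choose! η hη using hη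
  refine energy_eq_of_tendsto_flux hT hsol hC hη ?_
  have h3 : (3 : ℝ≥0∞)⁻¹ + 2 * 3⁻¹ = 1 := by
    rw [← one_add_mul, show (1 + 2 : ℝ≥0∞) = 3 by norm_num]
    exact ENNReal.mul_inv_cancel three_ne_zero ENNReal.ofNat_ne_top
  have hh : AEStronglyMeasurable h (volume.restrict (Ioo 0 T)) :=
    (hsol.continuousOn.mono Ioo_subset_Icc_self).aestronglyMeasurable measurableSet_Ioo
  have hev : ∀ᶠ ε : ℝ in 𝓝[>] 0, timeNorm T 3 (fun t => meanOsc 3 ε (h t)) ≤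
      ENNReal.ofReal (ε ^ (2 / 3 : ℝ)) * (ENNReal.ofReal (ε ^ (-(2 / 3) : ℝ)) *
        timeNorm T 3 (fun t => meanOsc 3 ε (h t))) := by
    filter_upwards [self_mem_nhdsWithin] with ε hε
    exact le_rpow_mul_rpow_neg_mul hε _ _
  -- Here `h` plays all three roles: three factors `ε^{2/3}` balance the loss `ε⁻²` exactly.
  have h0 := tendsto_scaled_product (κ := 2) (K := 2 * C) (L := 18 * C) (by norm_num) hev hev (by
    have h1 := (ENNReal.continuous_pow 3).tendsto 0 |>.comp hosc
    simpa [Function.comp_def, ← pow_succ'] using h1)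
  refine tendsto_of_tendsto_of_tendsto_of_le_of_le' tendsto_const_nhds h0
    (Eventually.of_forall fun _ => zero_le) ?_
  filter_upwards [Ioo_mem_nhdsGT (zero_lt_one' ℝ)] with ε hε
  have hm := hη ε hε.1 hε.2.le
  have e1 : 2 * (C * (ε⁻¹ * ε⁻¹)) = 2 * C * ε ^ (-2 : ℝ) := by
    rw [Real.rpow_neg hε.1.le, Real.rpow_two, pow_two, mul_inv]; ring
  rw [← e1]
  exact lintegral_scaleFlux_le hsol hm hC hε.1 hh (Eventually.of_forall fun t a b x =>
    enorm_pd_scurl_le hm hC hε.1 (Lp.memLp (h t)) a b x) h3 h3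

/-- Both mixed criteria are instances: `X` and `Y` are the normalized oscillations of current and
field, one tending to zero and the other bounded by a Besov norm. The loss is `ε⁻¹`, hence the
threshold `1`. -/
theorem energy_eq_of_current {T : ℝ} (hT : 0 < T)
    {h : ℝ → Lp E3 2 (volume : Measure (Torus d))} (hsol : IsEMHDWeakSolution T h)
    {j : ℝ → Lp E3 1 (volume : Measure (Torus d))} (hj : IsCurrent T h j)
    {α β : ℝ} (hαβ : 1 ≤ α + 2 * β) {r₁ r₂ p q : ℝ≥0∞} (hr : r₁⁻¹ + 2 * r₂⁻¹ = 1)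
    (hpq : p⁻¹ + 2 * q⁻¹ = 1) {X Y : ℝ → ℝ≥0∞}
    (hX : ∀ᶠ ε in 𝓝[>] 0, timeNorm T r₁ (fun t => meanOsc p ε (j t)) ≤ ENNReal.ofReal (ε ^ α) * X ε)
    (hY : ∀ᶠ ε in 𝓝[>] 0, timeNorm T r₂ (fun t => meanOsc q ε (h t)) ≤ ENNReal.ofReal (ε ^ β) * Y ε)
    (hXY : Tendsto (fun ε => X ε * Y ε ^ 2) (𝓝[>] 0) (𝓝 0)) :
    ∀ t ∈ Icc 0 T, ∫ x, ‖h t x‖ ^ 2 = ∫ x, ‖h 0 x‖ ^ 2 := by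
  obtain ⟨C, hC, hη⟩ := exists_mollifier d
  choose! η hη using hη
  refine energy_eq_of_tendsto_flux hT hsol hC hη ?_
  have h0 := tendsto_scaled_product (K := C) (L := 18 * C) hαβ hX hY hXY
  refine tendsto_of_tendsto_of_tendsto_of_le_of_le' tendsto_const_nhds h0
    (Eventually.of_forall fun _ => zero_le) ?_
  filter_upwards [Ioo_mem_nhdsGT (zero_lt_one' ℝ)] with ε hε
  have hm := hη ε hε.1 hε.2.le
  rw [Real.rpow_neg_one]
  refine lintegral_scaleFlux_le hsol hm hC hε.1 hj.1 ?_ hpq hr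
  filter_upwards [hj.2] with t ht a b x
  exact enorm_pd_scurl_le_of_curl hm hC hε.1 (Lp.memLp (h t)) (Lp.memLp (j t)) ht a b x

theorem energy_eq_of_current_memBesovVMO {T : ℝ} (hT : 0 < T)
    {h : ℝ → Lp E3 2 (volume : Measure (Torus d))} (hsol : IsEMHDWeakSolution T h)
    {j : ℝ → Lp E3 1 (volume : Measure (Torus d))} (hj : IsCurrent T h j)
    {α β : ℝ} (hαβ : 1 ≤ α + 2 * β) {r₁ r₂ p q : ℝ≥0∞} (hr : r₁⁻¹ + 2 * r₂⁻¹ = 1)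
    (hpq : p⁻¹ + 2 * q⁻¹ = 1) (hjV : MemBesovVMO T r₁ α p (fun t => j t))
    (hhB : MemBesov T r₂ β q (fun t => h t)) :
    ∀ t ∈ Icc 0 T, ∫ x, ‖h t x‖ ^ 2 = ∫ x, ‖h 0 x‖ ^ 2 := by
  refine energy_eq_of_current hT hsol hj hαβ hr hpq
    (X := fun ε => ENNReal.ofReal (ε ^ (-α)) * timeNorm T r₁ (fun t => meanOsc p ε (j t)))
    (Y := fun _ => 2 * timeNorm T r₂ fun t => besovNorm β q (h t)) ?_ ?_ ?_
  · filter_upwards [self_mem_nhdsWithin] with ε hε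
    exact le_rpow_mul_rpow_neg_mul hε _ _
  · filter_upwards [Ioo_mem_nhdsGT (zero_lt_one' ℝ)] with ε hε
    exact timeNorm_meanOsc_le hε.1 hε.2.le (one_le_of_holder hpq).2 β h
  · have := ENNReal.Tendsto.mul_const hjV.2 (b := (2 * timeNorm T r₂ fun t => besovNorm β q (h t)) ^ 2)
      (Or.inr (ENNReal.pow_ne_top (ENNReal.mul_ne_top ENNReal.ofNat_ne_top hhB.ne)))
    simpa using this

theorem energy_eq_of_current_memBesov {T : ℝ} (hT : 0 < T)
    {h : ℝ → Lp E3 2 (volume : Measure (Torus d))} (hsol : IsEMHDWeakSolution T h)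
    {j : ℝ → Lp E3 1 (volume : Measure (Torus d))} (hj : IsCurrent T h j)
    {α β : ℝ} (hαβ : 1 ≤ α + 2 * β) {r₁ r₂ p q : ℝ≥0∞} (hr : r₁⁻¹ + 2 * r₂⁻¹ = 1)
    (hpq : p⁻¹ + 2 * q⁻¹ = 1) (hjB : MemBesov T r₁ α p (fun t => j t))
    (hhV : MemBesovVMO T r₂ β q (fun t => h t)) :
    ∀ t ∈ Icc 0 T, ∫ x, ‖h t x‖ ^ 2 = ∫ x, ‖h 0 x‖ ^ 2 := by
  refine energy_eq_of_current hT hsol hj hαβ hr hpq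
    (X := fun _ => 2 * timeNorm T r₁ fun t => besovNorm α p (j t))
    (Y := fun ε => ENNReal.ofReal (ε ^ (-β)) * timeNorm T r₂ (fun t => meanOsc q ε (h t))) ?_ ?_ ?_
  · filter_upwards [Ioo_mem_nhdsGT (zero_lt_one' ℝ)] with ε hε
    exact timeNorm_meanOsc_le hε.1 hε.2.le (one_le_of_holder hpq).1 α j
  · filter_upwards [self_mem_nhdsWithin] with ε hε
    exact le_rpow_mul_rpow_neg_mul hε _ _
  · have h2 := (ENNReal.continuous_pow 2).tendsto 0 |>.comp hhV.2
    have := ENNReal.Tendsto.const_mul h2 (a := 2 * timeNorm T r₁ fun t => besovNorm α p (j t))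
      (Or.inr (ENNReal.mul_ne_top ENNReal.ofNat_ne_top hjB.ne))
    simpa using this

end Criteria

/-! ### Fourier series on the torus -/

section Fourier

variable {d : ℕ}

open UnitAddTorus (mFourier)

theorem mFourier_toTorus (k : Fin d → ℤ) (v : Fin d → ℝ) :
    mFourier k (toTorus v) = Complex.exp (((2 * Real.pi * ∑ i, (k i : ℝ) * v i : ℝ) : ℂ) * Complex.I) := by
  simp only [mFourier, ContinuousMap.coe_mk, toTorus, fourier_coe_apply]
  rw [← Complex.exp_sum]
  congr 1
  push_cast
  rw [Finset.mul_sum, Finset.sum_mul]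
  exact Finset.sum_congr rfl fun i _ => by ring

theorem norm_mFourier_apply (k : Fin d → ℤ) (x : Torus d) : ‖mFourier k x‖ = 1 := by
  obtain ⟨v, rfl⟩ := toTorus_surjective x
  rw [mFourier_toTorus, Complex.norm_exp_ofReal_mul_I]

theorem mFourier_add_apply (k : Fin d → ℤ) (x y : Torus d) :
    mFourier k (x + y) = mFourier k x * mFourier k y := by
  obtain ⟨v, rfl⟩ := toTorus_surjective x
  obtain ⟨w, rfl⟩ := toTorus_surjective y
  rw [← toTorus_add, mFourier_toTorus, mFourier_toTorus, mFourier_toTorus, ← Complex.exp_add]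
  congr 1
  simp only [Pi.add_apply, mul_add, Finset.sum_add_distrib]
  push_cast
  ring

theorem mFourier_neg_eq (k : Fin d → ℤ) (x : Torus d) : mFourier (-k) x = mFourier k (-x) := by
  obtain ⟨v, rfl⟩ := toTorus_surjective x
  rw [← toTorus_neg, mFourier_toTorus, mFourier_toTorus]
  simp

/-- The Fourier coefficients of a function on the torus. -/
noncomputable def fourierCoeffTorus (f : Torus d → ℂ) (k : Fin d → ℤ) : ℂ :=
  ∫ x, mFourier (-k) x * f x

theorem fourierCoeffTorus_eq (f : Torus d → ℂ) (k : Fin d → ℤ) :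
    fourierCoeffTorus f k = UnitAddTorus.mFourierCoeff f k := by
  rw [fourierCoeffTorus, volume_torus_eq_pi_haar]
  rfl

theorem hasSum_sq_fourierCoeffTorus {f : Torus d → ℂ} (hf : MemLp f 2) :
    HasSum (fun k => ‖fourierCoeffTorus f k‖ ^ 2) (∫ x, ‖f x‖ ^ 2) := by
  simp only [fourierCoeffTorus_eq]
  rw [volume_torus_eq_pi_haar] at hf ⊢
  have h1 := UnitAddTorus.hasSum_sq_mFourierCoeff (hf.toLp f)
  have h2 : ∀ k, UnitAddTorus.mFourierCoeff (hf.toLp f) k = UnitAddTorus.mFourierCoeff f k :=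
    fun k => by
      refine integral_congr_ae ?_
      filter_upwards [hf.coeFn_toLp] with x hx
      rw [hx]
  simp only [h2] at h1
  convert h1 using 1
  refine integral_congr_ae ?_
  filter_upwards [hf.coeFn_toLp] with x hx
  rw [hx]

theorem fourierCoeffTorus_mFourier (l k : Fin d → ℤ) :
    fourierCoeffTorus (mFourier l) k = if k = l then 1 else 0 := by
  rw [fourierCoeffTorus_eq, ← UnitAddTorus.mFourierCoeff_toLp, ← UnitAddTorus.mFourierBasis_repr]
  have h := UnitAddTorus.mFourierBasis.repr_self l
  rw [UnitAddTorus.coe_mFourierBasis] at h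
  rw [h]
  classical
  rw [lp.single_apply, Pi.single_apply]

theorem integrable_mFourier_mul {f : Torus d → ℂ} (hf : Integrable f) (k : Fin d → ℤ) :
    Integrable fun x => mFourier k x * f x :=
  hf.bdd_mul (mFourier k).continuous.aestronglyMeasurable
    (Eventually.of_forall fun x => (norm_mFourier_apply k x).le)

/-- A trigonometric polynomial. -/
noncomputable def trigPoly (S : Finset (Fin d → ℤ)) (c : (Fin d → ℤ) → ℂ) (x : Torus d) : ℂ :=
  ∑ k ∈ S, c k * mFourier k x

theorem continuous_trigPoly (S : Finset (Fin d → ℤ)) (c : (Fin d → ℤ) → ℂ) :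
    Continuous (trigPoly S c) :=
  continuous_finsetSum _ fun k _ => continuous_const.mul (mFourier k).continuous

theorem Continuous.memLp_torus {E : Type*} [NormedAddCommGroup E] {f : Torus d → E}
    (hf : Continuous f) (p : ℝ≥0∞) : MemLp f p := by
  obtain ⟨C, hC⟩ := isCompact_univ.exists_bound_of_continuousOn hf.continuousOn
  exact MemLp.of_bound hf.aestronglyMeasurable C (Eventually.of_forall fun x => hC x (mem_univ x))

theorem fourierCoeffTorus_trigPoly (S : Finset (Fin d → ℤ)) (c : (Fin d → ℤ) → ℂ)
    (k : Fin d → ℤ) : fourierCoeffTorus (trigPoly S c) k = if k ∈ S then c k else 0 := by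
  have h1 : ∀ x, mFourier (-k) x * trigPoly S c x = ∑ l ∈ S, c l * (mFourier (-k) x * mFourier l x) := by
    intro x
    rw [trigPoly, Finset.mul_sum]
    exact Finset.sum_congr rfl fun l _ => by ring
  simp only [fourierCoeffTorus, h1]
  rw [integral_finsetSum]
  · simp only [integral_const_mul]
    have h2 : ∀ l, ∫ x : Torus d, mFourier (-k) x * mFourier l x = if k = l then 1 else 0 :=
      fun l => fourierCoeffTorus_mFourier l k
    simp only [h2, mul_ite, mul_one, mul_zero]
    rw [Finset.sum_ite_eq]
  · intro l _
    exact ((integrable_mFourier_mul (memLp_one_iff_integrable.1 ((mFourier l).continuous.memLp_torus 1)) _)).const_mul _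

theorem lintegral_sq_trigPoly (S : Finset (Fin d → ℤ)) (c : (Fin d → ℤ) → ℂ) :
    ∫⁻ x, ‖trigPoly S c x‖ₑ ^ 2 = ∑ k ∈ S, ‖c k‖ₑ ^ 2 := by
  have hm := (continuous_trigPoly S c).memLp_torus 2
  have h1 := hasSum_sq_fourierCoeffTorus hm
  simp only [fourierCoeffTorus_trigPoly] at h1
  have h2 : HasSum (fun k => ‖if k ∈ S then c k else 0‖ ^ 2) (∑ k ∈ S, ‖c k‖ ^ 2) := by
    have := hasSum_sum_of_ne_finset_zero (f := fun k => ‖if k ∈ S then c k else 0‖ ^ 2) (s := S)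
      (L := SummationFilter.unconditional _) fun k hk => by simp [hk]
    convert this using 1
    exact Finset.sum_congr rfl fun k hk => by simp [hk]
  have h3 := h1.unique h2
  have h4 := ofReal_integral_eq_lintegral_ofReal (hm.integrable_norm_pow two_ne_zero)
    (Eventually.of_forall fun x => by positivity)
  rw [h3, ENNReal.ofReal_sum_of_nonneg fun k _ => by positivity] at h4
  simpa [ENNReal.ofReal_pow, ofReal_norm] using h4.symm

theorem enorm_trigPoly_sq_le (S : Finset (Fin d → ℤ)) (c : (Fin d → ℤ) → ℂ) (x : Torus d) :
    ‖trigPoly S c x‖ₑ ^ 2 ≤ S.card * ∑ k ∈ S, ‖c k‖ₑ ^ 2 := by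
  have h1 : ‖trigPoly S c x‖ ≤ ∑ k ∈ S, ‖c k‖ := by
    refine (norm_sum_le _ _).trans_eq (Finset.sum_congr rfl fun k _ => ?_)
    rw [norm_mul, norm_mFourier_apply, mul_one]
  have h2 : ‖trigPoly S c x‖ ^ 2 ≤ S.card * ∑ k ∈ S, ‖c k‖ ^ 2 :=
    (pow_le_pow_left₀ (norm_nonneg _) h1 2).trans sq_sum_le_card_mul_sum_sq
  have h3 := ENNReal.ofReal_le_ofReal h2
  rw [ENNReal.ofReal_mul (by positivity), ENNReal.ofReal_sum_of_nonneg fun k _ => by positivity] at h3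
  simpa [ENNReal.ofReal_pow, ofReal_norm] using h3

/-- Interpolation with the sup norm. Both Bernstein inequalities and the convolution estimate from
`L^p` to `L²` rest on it. -/
theorem lintegral_rpow_le_of_le {α : Type*} [MeasurableSpace α] {μ : Measure α} {g : α → ℝ≥0∞}
    {M : ℝ≥0∞} (hM : M ≠ ⊤) (hg : ∀ x, g x ≤ M) {p r : ℝ} (hp : 0 ≤ p) (hpr : p ≤ r) :
    ∫⁻ x, g x ^ r ∂μ ≤ M ^ (r - p) * ∫⁻ x, g x ^ p ∂μ := by
  rw [← lintegral_const_mul' _ _ (ENNReal.rpow_ne_top_of_nonneg (by linarith) hM)]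
  refine lintegral_mono fun x => ?_
  calc g x ^ r = g x ^ (r - p) * g x ^ p := by
        rw [← ENNReal.rpow_add_of_nonneg _ _ (by linarith) hp, sub_add_cancel]
    _ ≤ _ := by
      gcongr ?_ * _
      exact ENNReal.rpow_le_rpow (hg x) (by linarith)

/-- Bernstein's inequality from `L²` to `L³`: Cauchy–Schwarz bounds the supremum by `card^{1/2}`
times the `L²` norm, and interpolation leaves the exponent `1/2 − 1/3 = 1/6`. -/
theorem eLpNorm_trigPoly_three_le (S : Finset (Fin d → ℤ)) (c : (Fin d → ℤ) → ℂ) :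
    eLpNorm (trigPoly S c) 3 volume ≤
      (S.card : ℝ≥0∞) ^ (1 / 6 : ℝ) * (∑ k ∈ S, ‖c k‖ₑ ^ 2) ^ (1 / 2 : ℝ) := by
  set σ := ∑ k ∈ S, ‖c k‖ₑ ^ 2 with hσ
  have hσt : σ ≠ ⊤ := by
    rw [hσ]; exact ENNReal.sum_ne_top.2 fun k _ => ENNReal.pow_ne_top enorm_ne_top
  have hM : ∀ x, ‖trigPoly S c x‖ₑ ≤ (S.card * σ) ^ (1 / 2 : ℝ) := fun x => by
    rw [one_div, ENNReal.le_rpow_inv_iff two_pos, ENNReal.rpow_two]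
    exact enorm_trigPoly_sq_le S c x
  have h1 := lintegral_rpow_le_of_le (μ := (volume : Measure (Torus d)))
    (ENNReal.rpow_ne_top_of_nonneg (by norm_num)
      (ENNReal.mul_ne_top (ENNReal.natCast_ne_top _) hσt)) hM
    (p := 2) (r := 3) (by norm_num) (by norm_num)
  simp only [ENNReal.rpow_two] at h1
  rw [lintegral_sq_trigPoly, ← hσ] at h1
  rw [eLpNorm_eq_lintegral_rpow_enorm_toReal (by norm_num) (by norm_num), ENNReal.toReal_ofNat]
  refine (ENNReal.rpow_le_rpow h1 (by norm_num)).trans_eq ?_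
  rw [← ENNReal.rpow_mul, ENNReal.mul_rpow_of_nonneg _ _ (by norm_num),
    ENNReal.mul_rpow_of_nonneg _ _ (by norm_num), ENNReal.mul_rpow_of_nonneg _ _ (by norm_num),
    ← ENNReal.rpow_mul, ← ENNReal.rpow_mul, mul_assoc, ← ENNReal.rpow_add_of_nonneg _ _ (by norm_num) (by norm_num)]
  norm_num

/-- Bernstein's inequality from `L^p` to `L²`. Interpolating `L²` between `L^p` and the supremum,
which is itself bounded by the `L²` norm, puts a power of that norm on both sides; it is cancelled
at the end, so the zero case is removed first. -/
theorem rpow_half_le_of_trigPoly (S : Finset (Fin d → ℤ)) (c : (Fin d → ℤ) → ℂ) {p : ℝ≥0∞}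
    (hp1 : 1 ≤ p) (hp2 : p ≤ 2) :
    (∑ k ∈ S, ‖c k‖ₑ ^ 2) ^ (1 / 2 : ℝ) ≤
      (S.card : ℝ≥0∞) ^ (1 / p.toReal - 1 / 2) * eLpNorm (trigPoly S c) p volume := by
  set σ := ∑ k ∈ S, ‖c k‖ₑ ^ 2 with hσ
  by_cases hσ0 : σ = 0
  · rw [hσ0, ENNReal.zero_rpow_of_pos (by norm_num)]; exact zero_le
  have hσt : σ ≠ ⊤ := by
    rw [hσ]; exact ENNReal.sum_ne_top.2 fun k _ => ENNReal.pow_ne_top enorm_ne_top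
  have hpt : p ≠ ⊤ := (hp2.trans_lt ENNReal.ofNat_lt_top).ne
  have hp0 : p ≠ 0 := (zero_lt_one.trans_le hp1).ne'
  have hP1 : 1 ≤ p.toReal := by simpa using ENNReal.toReal_mono hpt hp1
  have hP2 : p.toReal ≤ 2 := by simpa using ENNReal.toReal_mono ENNReal.ofNat_ne_top hp2
  have hM : ∀ x, ‖trigPoly S c x‖ₑ ≤ (S.card * σ) ^ (1 / 2 : ℝ) := fun x => by
    rw [one_div, ENNReal.le_rpow_inv_iff two_pos, ENNReal.rpow_two]
    exact enorm_trigPoly_sq_le S c x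
  have h1 := lintegral_rpow_le_of_le (μ := (volume : Measure (Torus d)))
    (ENNReal.rpow_ne_top_of_nonneg (by norm_num)
      (ENNReal.mul_ne_top (ENNReal.natCast_ne_top _) hσt)) hM
    (p := p.toReal) (r := 2) (by positivity) hP2
  simp only [ENNReal.rpow_two] at h1
  rw [lintegral_sq_trigPoly, ← hσ, ← ENNReal.rpow_mul, ENNReal.mul_rpow_of_nonneg _ _ (by linarith)] at h1
  have h2 := ENNReal.rpow_le_rpow h1 (by positivity : (0 : ℝ) ≤ 1 / p.toReal)
  rw [ENNReal.mul_rpow_of_nonneg _ _ (by positivity), ENNReal.mul_rpow_of_nonneg _ _ (by positivity),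
    ← ENNReal.rpow_mul, ← ENNReal.rpow_mul, ← eLpNorm_eq_lintegral_rpow_enorm_toReal hp0 hpt] at h2
  have e1 : 1 / 2 * (2 - p.toReal) * (1 / p.toReal) = 1 / p.toReal - 1 / 2 := by
    field_simp
  rw [e1, mul_right_comm] at h2
  have h3 : σ ^ (1 / p.toReal) = σ ^ (1 / 2 : ℝ) * σ ^ (1 / p.toReal - 1 / 2) := by
    rw [← ENNReal.rpow_add _ _ hσ0 hσt]; congr 1; ring
  rw [h3] at h2
  exact (ENNReal.mul_le_mul_iff_left (by simp [ENNReal.rpow_eq_zero_iff, hσ0, hσt])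
    (ENNReal.rpow_ne_top_of_ne_zero hσ0 hσt)).1 h2

end Fourier

/-! ### Fourier coefficients of the current -/

section FourierCurl

variable {d : ℕ}

open UnitAddTorus (mFourier)

/-- A frequency, extended by zero to three components. -/
def freq (k : Fin d → ℤ) (a : Fin 3) : ℝ := if ha : (a : ℕ) < d then (k ⟨a, ha⟩ : ℝ) else 0

theorem sum_freq_sq (hd : d ≤ 3) (k : Fin d → ℤ) : ∑ a, freq k a ^ 2 = ∑ i, (k i : ℝ) ^ 2 := by
  have h1 : ∀ i : Fin d, (k i : ℝ) ^ 2 = freq k (Fin.castLE hd i) ^ 2 := fun i => by simp [freq]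
  simp only [h1]
  refine Eq.trans ?_ (Finset.sum_map Finset.univ (Fin.castLEEmb hd) fun a => freq k a ^ 2)
  refine (Finset.sum_subset (Finset.subset_univ _) fun a _ ha => ?_).symm
  have : ¬ (a : ℕ) < d := fun h => ha (by
    rw [Finset.mem_map]
    exact ⟨⟨a, h⟩, Finset.mem_univ _, rfl⟩)
  simp [freq, this]

theorem hasDerivAt_mFourier (k : Fin d → ℤ) (i : Fin d) (x : Torus d) :
    HasDerivAt (fun s : ℝ => mFourier k (x + Pi.single i (s : UnitAddCircle)))
      (mFourier k x * ((2 * Real.pi * k i : ℝ) * Complex.I)) 0 := by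
  have h1 : ∀ s : ℝ, mFourier k (x + Pi.single i (s : UnitAddCircle)) =
      mFourier k x * Complex.exp ((s : ℂ) * ((2 * Real.pi * k i : ℝ) * Complex.I)) := by
    intro s
    rw [mFourier_add_apply, ← toTorus_single, mFourier_toTorus]
    congr 2
    simp only [Pi.single_apply, mul_ite, mul_zero, Finset.sum_ite_eq', Finset.mem_univ, if_true]
    push_cast
    ring
  simp only [h1]
  have h2 : HasDerivAt (fun s : ℝ => Complex.exp ((s : ℂ) * ((2 * Real.pi * k i : ℝ) * Complex.I)))
      (Complex.exp (((0 : ℝ) : ℂ) * ((2 * Real.pi * k i : ℝ) * Complex.I)) *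
        (1 * ((2 * Real.pi * k i : ℝ) * Complex.I))) 0 :=
    (((hasDerivAt_id (((0 : ℝ) : ℂ))).comp_ofReal.mul_const _)).cexp
  simpa using h2.const_mul (mFourier k x)

theorem pd_re_mFourier (k : Fin d → ℤ) (a : Fin 3) :
    pd a (fun x : Torus d => (mFourier k x).re) =
      fun x => -(2 * Real.pi * freq k a) * (mFourier k x).im := by
  ext x
  by_cases ha : (a : ℕ) < d
  · have h := Complex.reCLM.hasFDerivAt.comp_hasDerivAt (0 : ℝ) (hasDerivAt_mFourier k ⟨a, ha⟩ x)
    rw [pd_of_lt ha, pdi]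
    refine h.deriv.trans ?_
    simp [freq, ha]
    ring
  · rw [pd_of_not_lt ha]; simp [freq, ha]

theorem pd_im_mFourier (k : Fin d → ℤ) (a : Fin 3) :
    pd a (fun x : Torus d => (mFourier k x).im) =
      fun x => (2 * Real.pi * freq k a) * (mFourier k x).re := by
  ext x
  by_cases ha : (a : ℕ) < d
  · have h := Complex.imCLM.hasFDerivAt.comp_hasDerivAt (0 : ℝ) (hasDerivAt_mFourier k ⟨a, ha⟩ x)
    rw [pd_of_lt ha, pdi]
    refine h.deriv.trans ?_
    simp [freq, ha]
    ring
  · rw [pd_of_not_lt ha]; simp [freq, ha]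

theorem smooth_mFourier (k : Fin d → ℤ) : SmoothOnTorus fun x : Torus d => mFourier k x := by
  simp only [SmoothOnTorus, mFourier_toTorus]
  have h : ContDiff ℝ ∞ fun v : Fin d → ℝ => 2 * Real.pi * ∑ i, (k i : ℝ) * v i := by fun_prop
  exact ((Complex.ofRealCLM.contDiff.comp h).mul contDiff_const).cexp

theorem smooth_re_mFourier (k : Fin d → ℤ) : SmoothOnTorus fun x : Torus d => (mFourier k x).re :=
  Complex.reCLM.contDiff.comp (smooth_mFourier k)

theorem smooth_im_mFourier (k : Fin d → ℤ) : SmoothOnTorus fun x : Torus d => (mFourier k x).im :=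
  Complex.imCLM.contDiff.comp (smooth_mFourier k)

/-- The Fourier coefficients of a real function. -/
noncomputable def rfc (f : Torus d → ℝ) (k : Fin d → ℤ) : ℂ :=
  fourierCoeffTorus (fun x => (f x : ℂ)) k

theorem integrable_rfc {f : Torus d → ℝ} (hf : Integrable f) (k : Fin d → ℤ) :
    Integrable fun x => mFourier (-k) x * (f x : ℂ) :=
  integrable_mFourier_mul hf.ofReal _

theorem conv_re_mFourier {f : Torus d → ℝ} (hf : Integrable f) (k : Fin d → ℤ) :
    conv (fun x => (mFourier k x).re) f 0 = (rfc f k).re := by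
  have := integral_re (𝕜 := ℂ) (integrable_rfc hf k)
  rw [rfc, fourierCoeffTorus]
  refine Eq.trans ?_ this
  rw [conv]
  congr 1
  ext y
  simp [mFourier_neg_eq]

theorem conv_im_mFourier {f : Torus d → ℝ} (hf : Integrable f) (k : Fin d → ℤ) :
    conv (fun x => (mFourier k x).im) f 0 = (rfc f k).im := by
  have := integral_im (𝕜 := ℂ) (integrable_rfc hf k)
  rw [rfc, fourierCoeffTorus]
  refine Eq.trans ?_ this
  rw [conv]
  congr 1
  ext y
  simp [mFourier_neg_eq]

theorem conv_const_mul_left (c : ℝ) (K f : Torus d → ℝ) (x : Torus d) :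
    conv (fun y => c * K y) f x = c * conv K f x := by
  rw [conv, conv, ← integral_const_mul]
  congr 1; ext y; ring

/-- Lagrange's identity `|κ × w|² = |κ|²|w|² − (κ · w)²`. -/
theorem cross_sq_of_orthogonal {κ w g : Fin 3 → ℝ} (h : ∑ a, κ a * w a = 0)
    (h0 : g 0 = κ 1 * w 2 - κ 2 * w 1) (h1 : g 1 = κ 2 * w 0 - κ 0 * w 2)
    (h2 : g 2 = κ 0 * w 1 - κ 1 * w 0) : ∑ a, g a ^ 2 = (∑ a, κ a ^ 2) * ∑ a, w a ^ 2 := by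
  simp only [Fin.sum_univ_three] at h ⊢
  rw [h0, h1, h2]
  linear_combination (-(κ 0 * w 0 + κ 1 * w 1 + κ 2 * w 2)) * h

/-- Real and imaginary parts of a Fourier coefficient are values at `0` of convolutions with the
smooth kernels `Re e_k` and `Im e_k`. The identities for mollified fields thus yield `κ · v̂ = 0`
and `ĵ = i κ × v̂`, and orthogonality turns the cross product into a product of lengths. No
frequency is lost in passing to three components because `d ≤ 3`. -/
theorem sum_norm_rfc_curl (hd : d ≤ 3) {v j : Torus d → E3} (hv : ∀ a, Integrable fun y => v y a)
    (hj : ∀ a, Integrable fun y => j y a) (hdiv : WeaklyDivFree v) (hcurl : IsWeakCurl v j)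
    (k : Fin d → ℤ) :
    ∑ a, ‖rfc (fun x => j x a) k‖ ^ 2 =
      (2 * Real.pi) ^ 2 * (∑ i, (k i : ℝ) ^ 2) * ∑ a, ‖rfc (fun x => v x a) k‖ ^ 2 := by
  set κ : Fin 3 → ℝ := fun a => 2 * Real.pi * freq k a with hκ
  have pre : ∀ a b, pd a (conv (fun x => (mFourier k x).re) fun y => v y b) 0 =
      -(κ a * (rfc (fun x => v x b) k).im) := fun a b => by
    rw [pd_conv (smooth_re_mFourier k) (hv b), pd_re_mFourier, conv_const_mul_left,
      conv_im_mFourier (hv b)]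
    ring
  have pim : ∀ a b, pd a (conv (fun x => (mFourier k x).im) fun y => v y b) 0 =
      κ a * (rfc (fun x => v x b) k).re := fun a b => by
    rw [pd_conv (smooth_im_mFourier k) (hv b), pd_im_mFourier, conv_const_mul_left,
      conv_re_mFourier (hv b)]
  have dre := sum_pd_conv_eq_zero (smooth_re_mFourier k) hv hdiv 0
  have dim := sum_pd_conv_eq_zero (smooth_im_mFourier k) hv hdiv 0
  simp only [pre, Finset.sum_neg_distrib, neg_eq_zero] at dre
  simp only [pim] at dim
  have cre := fun b => scurl_conv (smooth_re_mFourier k) hv hcurl b 0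
  have cim := fun b => scurl_conv (smooth_im_mFourier k) hv hcurl b 0
  simp only [conv_re_mFourier (hj _)] at cre
  simp only [conv_im_mFourier (hj _)] at cim
  -- The minus sign is that of `Re ĵ = −κ × Im v̂`.
  have s1 := cross_sq_of_orthogonal (g := fun b => -(rfc (fun x => j x b) k).re) dre
    (by rw [← cre 0, scurl_zero]; simp only [pre]; ring)
    (by rw [← cre 1, scurl_one]; simp only [pre]; ring)
    (by rw [← cre 2, scurl_two]; simp only [pre]; ring)
  have s2 := cross_sq_of_orthogonal (g := fun b => (rfc (fun x => j x b) k).im) dim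
    (by rw [← cim 0, scurl_zero]; simp only [pim])
    (by rw [← cim 1, scurl_one]; simp only [pim])
    (by rw [← cim 2, scurl_two]; simp only [pim])
  have e : ∀ z : ℂ, ‖z‖ ^ 2 = z.re ^ 2 + z.im ^ 2 := fun z => by
    rw [Complex.sq_norm, Complex.normSq_apply]; ring
  have eκ : ∑ a, κ a ^ 2 = (2 * Real.pi) ^ 2 * ∑ i, (k i : ℝ) ^ 2 := by
    rw [← sum_freq_sq hd, Finset.mul_sum]
    exact Finset.sum_congr rfl fun a _ => by simp only [hκ]; ring
  simp only [e, Finset.sum_add_distrib]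
  rw [← eκ, mul_add, ← s1, ← s2, add_comm]
  simp only [neg_sq]

theorem rfc_conv {K f : Torus d → ℝ} (hK : Continuous K) (hf : Integrable f) (k : Fin d → ℤ) :
    rfc (conv K f) k = rfc K k * rfc f k := by
  have hKi : Integrable K := SmoothOnTorus.integrable_kernel hK
  have hint : Integrable (fun z : Torus d × Torus d =>
      mFourier (-k) z.1 * ((K (z.1 - z.2) * f z.2 : ℝ) : ℂ)) (volume.prod volume) := by
    obtain ⟨C, hC⟩ := isCompact_univ.exists_bound_of_continuousOn hK.continuousOn
    have h1 : Integrable (fun z : Torus d × Torus d => K (z.1 - z.2) * f z.2)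
        (volume.prod volume) :=
      (hf.comp_snd (μ := (volume : Measure (Torus d)))).bdd_mul
        (f := fun z : Torus d × Torus d => K (z.1 - z.2))
        (by fun_prop) (Eventually.of_forall fun z => hC _ (mem_univ _))
    exact h1.ofReal.bdd_mul (f := fun z : Torus d × Torus d => mFourier (-k) z.1) (c := 1)
      (by fun_prop) (Eventually.of_forall fun z => (norm_mFourier_apply _ _).le)
  have h2 : ∀ x, mFourier (-k) x * ((conv K f x : ℝ) : ℂ) =
      ∫ y, mFourier (-k) x * ((K (x - y) * f y : ℝ) : ℂ) := fun x => by
    rw [integral_const_mul, integral_complex_ofReal, conv]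
  rw [rfc, fourierCoeffTorus]
  simp only [h2]
  rw [integral_integral_swap hint]
  have h3 : ∀ y, ∫ x, mFourier (-k) x * ((K (x - y) * f y : ℝ) : ℂ) =
      rfc K k * (mFourier (-k) y * (f y : ℂ)) := by
    intro y
    rw [← integral_add_right_eq_self _ y, rfc, fourierCoeffTorus, ← integral_mul_const]
    congr 1
    ext x
    rw [mFourier_add_apply, add_sub_cancel_right]
    push_cast
    ring
  simp only [h3]
  rw [integral_const_mul]
  rfl

theorem rfc_shift (f : Torus d → ℝ) (y : Torus d) (k : Fin d → ℤ) :
    rfc (fun x => f (x - y)) k = mFourier (-k) y * rfc f k := by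
  rw [rfc, fourierCoeffTorus, ← integral_add_right_eq_self _ y, rfc, fourierCoeffTorus,
    ← integral_const_mul]
  congr 1
  ext x
  rw [mFourier_add_apply, add_sub_cancel_right]
  ring

theorem rfc_sub {f g : Torus d → ℝ} (hf : Integrable f) (hg : Integrable g) (k : Fin d → ℤ) :
    rfc (fun x => f x - g x) k = rfc f k - rfc g k := by
  rw [rfc, rfc, rfc, fourierCoeffTorus, fourierCoeffTorus, fourierCoeffTorus,
    ← integral_sub (integrable_rfc hf k) (integrable_rfc hg k)]
  congr 1
  ext x
  push_cast
  ring

theorem sum_sq_rfc_le {f : Torus d → ℝ} (hf : MemLp f 2) (S : Finset (Fin d → ℤ)) :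
    ∑ k ∈ S, ‖rfc f k‖ₑ ^ 2 ≤ ∫⁻ x, ‖f x‖ₑ ^ 2 := by
  have h1 := hasSum_sq_fourierCoeffTorus (f := fun x => (f x : ℂ)) hf.ofReal
  have h2 := sum_le_hasSum S (fun k _ => by positivity) h1
  have h4 := ofReal_integral_eq_lintegral_ofReal (hf.integrable_norm_pow two_ne_zero)
    (Eventually.of_forall fun x => by positivity)
  simp only [Complex.norm_real] at h2
  have h3 := ENNReal.ofReal_le_ofReal h2
  rw [ENNReal.ofReal_sum_of_nonneg fun k _ => by positivity] at h3
  simp only [ENNReal.ofReal_pow (norm_nonneg _), ofReal_norm] at h3 h4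
  exact h3.trans_eq h4

end FourierCurl

/-! ### Littlewood-Paley blocks as trigonometric polynomials -/

section Blocks

variable {d : ℕ}

open UnitAddTorus (mFourier)

theorem abs_torusRep (x : Torus d) (i : Fin d) : |torusRep x i| = ‖x i‖ := by
  have h := congrFun (toTorus_torusRep x) i
  have h2 : ‖((torusRep x i : ℝ) : UnitAddCircle)‖ = |torusRep x i| :=
    (AddCircle.norm_coe_eq_abs_iff (1 : ℝ) one_ne_zero).2 (by simpa using abs_torusRep_le x i)
  rw [← h2]
  exact congrArg _ h

theorem norm_mFourier_sub_one_le {k : Fin d → ℤ} {R : ℝ} (hk : ∀ i, |(k i : ℝ)| ≤ R) (y : Torus d) :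
    ‖mFourier k y - 1‖ ≤ 2 * Real.pi * (d * R) * torusLength y := by
  have hR : ∀ i, |(k i : ℝ) * torusRep y i| ≤ R * torusLength y := fun i => by
    rw [abs_mul, abs_torusRep]
    exact mul_le_mul (hk i) (norm_apply_le_torusLength y i) (norm_nonneg _)
      ((abs_nonneg _).trans (hk i))
  conv_lhs => rw [← toTorus_torusRep y]
  rw [mFourier_toTorus, mul_comm _ Complex.I]
  refine (Real.norm_exp_I_mul_ofReal_sub_one_le).trans ?_
  rw [Real.norm_eq_abs, abs_mul, abs_of_pos Real.two_pi_pos, mul_assoc (2 * Real.pi)]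
  refine mul_le_mul_of_nonneg_left ?_ Real.two_pi_pos.le
  refine (Finset.abs_sum_le_sum_abs _ _).trans ((Finset.sum_le_sum fun i _ => hR i).trans_eq ?_)
  simp
  ring

theorem le_norm_exp_sub_one {θ : ℝ} (hθ : |θ| ≤ 1 / 2) :
    4 * |θ| ≤ ‖Complex.exp (((2 * Real.pi * θ : ℝ) : ℂ) * Complex.I) - 1‖ := by
  rw [mul_comm _ Complex.I, Complex.norm_exp_I_mul_ofReal_sub_one, norm_mul, Real.norm_two,
    Real.norm_eq_abs, show 2 * Real.pi * θ / 2 = Real.pi * θ by ring]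
  have h1 : |Real.pi * θ| ≤ Real.pi / 2 := by
    rw [abs_mul, abs_of_pos Real.pi_pos]
    nlinarith [Real.pi_pos]
  -- Jordan's inequality for the sine, valid up to `π/2`, which is where `|θ| ≤ 1/2` is used.
  have h2 := Real.mul_abs_le_abs_sin h1
  rw [abs_mul, abs_of_pos Real.pi_pos] at h2
  have h3 : 2 / Real.pi * (Real.pi * |θ|) = 2 * |θ| := by field_simp
  linarith

/-- The symbol of the `n`-th Littlewood-Paley block. -/
noncomputable def lpSymbol (n : ℕ) (k : Fin d → ℤ) : ℝ :=
  lpCutoff (√(∑ i, (k i : ℝ) ^ 2) / 2 ^ n) - lpCutoff (2 * √(∑ i, (k i : ℝ) ^ 2) / 2 ^ n)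

/-- The set of frequencies of the `n`-th Littlewood-Paley block. -/
noncomputable def lpBox (d n : ℕ) : Finset (Fin d → ℤ) :=
  Fintype.piFinset fun _ => Finset.Icc (-(2 : ℤ) ^ (n + 1)) (2 ^ (n + 1))

theorem lpCutoff_of_le_one {ρ : ℝ} (h0 : 0 ≤ ρ) (h : ρ ≤ 1) : lpCutoff ρ = 1 :=
  Real.smoothTransition.one_of_one_le (by nlinarith)

theorem lpCutoff_of_two_le {ρ : ℝ} (h : 2 ≤ ρ) : lpCutoff ρ = 0 :=
  Real.smoothTransition.zero_of_nonpos (by nlinarith)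

theorem lpCutoff_nonneg (ρ : ℝ) : 0 ≤ lpCutoff ρ := Real.smoothTransition.nonneg _

theorem lpCutoff_le_one (ρ : ℝ) : lpCutoff ρ ≤ 1 := Real.smoothTransition.le_one _

theorem abs_lpSymbol_le (n : ℕ) (k : Fin d → ℤ) : |lpSymbol n k| ≤ 1 := by
  rw [lpSymbol, abs_le]
  constructor <;> linarith [lpCutoff_nonneg (√(∑ i, (k i : ℝ) ^ 2) / 2 ^ n),
    lpCutoff_nonneg (2 * √(∑ i, (k i : ℝ) ^ 2) / 2 ^ n), lpCutoff_le_one (√(∑ i, (k i : ℝ) ^ 2) / 2 ^ n),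
    lpCutoff_le_one (2 * √(∑ i, (k i : ℝ) ^ 2) / 2 ^ n)]

theorem le_of_lpSymbol_ne_zero {n : ℕ} {k : Fin d → ℤ} (h : lpSymbol n k ≠ 0) :
    2 ^ n ≤ 2 * √(∑ i, (k i : ℝ) ^ 2) := by
  by_contra! h1
  refine h ?_
  have h2 : (0 : ℝ) < 2 ^ n := by positivity
  have h3 := Real.sqrt_nonneg (∑ i, (k i : ℝ) ^ 2)
  rw [lpSymbol, lpCutoff_of_le_one (by positivity) (by rw [div_le_one h2]; linarith),
    lpCutoff_of_le_one (by positivity) (by rw [div_le_one h2]; linarith), sub_self]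

theorem abs_le_sqrt_sum (k : Fin d → ℤ) (i : Fin d) : |(k i : ℝ)| ≤ √(∑ i, (k i : ℝ) ^ 2) := by
  refine Real.le_sqrt_of_sq_le ?_
  rw [sq_abs]
  exact Finset.single_le_sum (f := fun i => (k i : ℝ) ^ 2) (fun i _ => sq_nonneg _) (Finset.mem_univ i)

theorem mem_lpBox {n : ℕ} {k : Fin d → ℤ} : k ∈ lpBox d n ↔ ∀ i, |(k i : ℝ)| ≤ 2 * 2 ^ n := by
  simp only [lpBox, Fintype.mem_piFinset, Finset.mem_Icc]
  refine forall_congr' fun i => ?_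
  rw [abs_le, pow_succ]
  constructor
  · rintro ⟨h1, h2⟩
    have h1' : -((2 : ℝ) ^ n * 2) ≤ k i := by exact_mod_cast h1
    have h2' : (k i : ℝ) ≤ (2 : ℝ) ^ n * 2 := by exact_mod_cast h2
    constructor <;> linarith
  · rintro ⟨h1, h2⟩
    have h1' : -((2 : ℝ) ^ n * 2) ≤ k i := by linarith
    have h2' : (k i : ℝ) ≤ (2 : ℝ) ^ n * 2 := by linarith
    exact ⟨by exact_mod_cast h1', by exact_mod_cast h2'⟩

theorem lpSymbol_eq_zero_of_notMem {n : ℕ} {k : Fin d → ℤ} (h : k ∉ lpBox d n) : lpSymbol n k = 0 := by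
  rw [mem_lpBox] at h
  push Not at h
  obtain ⟨i, hi⟩ := h
  have h1 := hi.le.trans (abs_le_sqrt_sum k i)
  have h2 : (0 : ℝ) < 2 ^ n := by positivity
  rw [lpSymbol, lpCutoff_of_two_le (by rw [le_div_iff₀ h2]; linarith),
    lpCutoff_of_two_le (by rw [le_div_iff₀ h2]; linarith), sub_self]

theorem lpSymbol_neg (n : ℕ) (k : Fin d → ℤ) : lpSymbol n (-k) = lpSymbol n k := by
  simp [lpSymbol]

theorem card_lpBox_le (d n : ℕ) : (lpBox d n).card ≤ (5 * 2 ^ n) ^ d := by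
  rw [lpBox, Fintype.card_piFinset]
  simp only [Int.card_Icc, Finset.prod_const, Finset.card_univ, Fintype.card_fin]
  refine Nat.pow_le_pow_left ?_ d
  have h : (2 : ℤ) ^ (n + 1) + 1 - -2 ^ (n + 1) = ((4 * 2 ^ n + 1 : ℕ) : ℤ) := by
    push_cast; ring
  rw [h, Int.toNat_natCast]
  have := Nat.one_le_two_pow (n := n)
  omega

/-- Symbol and box are invariant under `k ↦ -k`, so the imaginary parts cancel in pairs. -/
theorem ofReal_lpKernel (n : ℕ) (x : Torus d) :
    (lpKernel n x : ℂ) = trigPoly (lpBox d n) (fun k => (lpSymbol n k : ℂ)) x := by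
  have h0 : lpKernel n x = ∑ k ∈ lpBox d n, lpSymbol n k * (mFourier k x).re := rfl
  have h1 : ∑ k ∈ lpBox d n, lpSymbol n k * (mFourier k x).im = 0 := by
    have h2 : ∑ k ∈ lpBox d n, lpSymbol n k * (mFourier k x).im =
        ∑ k ∈ lpBox d n, -(lpSymbol n k * (mFourier k x).im) := by
      refine Finset.sum_bij' (fun k _ => -k) (fun k _ => -k) ?_ ?_ ?_ ?_ ?_
      · intro k hk; rw [mem_lpBox] at hk ⊢; simpa using hk
      · intro k hk; rw [mem_lpBox] at hk ⊢; simpa using hk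
      · intro k _; simp
      · intro k _; simp
      · intro k _
        rw [lpSymbol_neg, UnitAddTorus.mFourier_neg]
        simp
    rw [Finset.sum_neg_distrib] at h2
    linarith
  refine Complex.ext ?_ ?_
  · simp [h0, trigPoly]
  · simp [trigPoly, h1]

theorem lpBlock_apply {f : Torus d → E3} (hf : Integrable f) (n : ℕ) (a : Fin 3) (x : Torus d) :
    (lpBlock n f x a : ℂ) =
      trigPoly (lpBox d n) (fun k => (lpSymbol n k : ℂ) * rfc (fun y => f y a) k) x := by
  have hK : Continuous (lpKernel n : Torus d → ℝ) := by
    unfold lpKernel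
    fun_prop
  have hint : Integrable fun y => lpKernel n (x - y) • f y := by
    obtain ⟨C, hC⟩ := isCompact_univ.exists_bound_of_continuousOn hK.continuousOn
    exact hf.bdd_smul C (by fun_prop) (Eventually.of_forall fun y => hC _ (mem_univ _))
  have hfa : Integrable fun y => f y a := (EuclideanSpace.proj a : E3 →L[ℝ] ℝ).integrable_comp hf
  have h1 : lpBlock n f x a = ∫ y, lpKernel n (x - y) * f y a :=
    ((EuclideanSpace.proj a : E3 →L[ℝ] ℝ).integral_comp_comm hint).symm
  rw [h1, ← integral_complex_ofReal]
  have h2 : ∀ y, ((lpKernel n (x - y) * f y a : ℝ) : ℂ) = ∑ k ∈ lpBox d n,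
      (lpSymbol n k * mFourier k x) * (mFourier (-k) y * (f y a : ℂ)) := by
    intro y
    push_cast
    rw [ofReal_lpKernel, trigPoly, Finset.sum_mul]
    refine Finset.sum_congr rfl fun k _ => ?_
    rw [sub_eq_add_neg, mFourier_add_apply, ← mFourier_neg_eq]
    ring
  simp only [h2]
  rw [integral_finsetSum _ fun k _ => (integrable_rfc hfa k).const_mul _]
  simp only [integral_const_mul]
  rw [trigPoly]
  refine Finset.sum_congr rfl fun k _ => ?_
  rw [rfc, fourierCoeffTorus]
  ring

/-- The square of the `L²` norm of the `n`-th Littlewood-Paley block. -/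
noncomputable def blockEnergy (n : ℕ) (f : Torus d → E3) : ℝ≥0∞ :=
  ∑ a, ∑ k ∈ lpBox d n, ‖(lpSymbol n k : ℂ) * rfc (fun y => f y a) k‖ₑ ^ 2

theorem blockEnergy_rpow_half_le {f : Torus d → E3} (hf : Integrable f) (n : ℕ) {p : ℝ≥0∞}
    (hp1 : 1 ≤ p) (hp2 : p ≤ 2) :
    blockEnergy n f ^ (1 / 2 : ℝ) ≤
      3 * (((lpBox d n).card : ℝ≥0∞) ^ (1 / p.toReal - 1 / 2) * eLpNorm (lpBlock n f) p volume) := by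
  have h1 : ∀ a, (∑ k ∈ lpBox d n, ‖(lpSymbol n k : ℂ) * rfc (fun y => f y a) k‖ₑ ^ 2) ^ (1 / 2 : ℝ) ≤
      ((lpBox d n).card : ℝ≥0∞) ^ (1 / p.toReal - 1 / 2) * eLpNorm (lpBlock n f) p volume := by
    intro a
    refine (rpow_half_le_of_trigPoly _ _ hp1 hp2).trans ?_
    gcongr
    refine eLpNorm_mono_enorm fun x => ?_
    rw [← lpBlock_apply hf]
    refine le_trans (le_of_eq ?_) (enorm_apply_le (lpBlock n f x) a)
    rw [← ofReal_norm, Complex.norm_real, ofReal_norm]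
  rw [blockEnergy]
  have h2 : ∀ x y z : ℝ≥0∞, (x + y + z) ^ (1 / 2 : ℝ) ≤
      x ^ (1 / 2 : ℝ) + y ^ (1 / 2 : ℝ) + z ^ (1 / 2 : ℝ) := fun x y z =>
    (ENNReal.rpow_add_le_add_rpow _ _ (by norm_num) (by norm_num)).trans
      (add_le_add_left (ENNReal.rpow_add_le_add_rpow _ _ (by norm_num) (by norm_num)) _)
  rw [Fin.sum_univ_three]
  refine (h2 _ _ _).trans ((add_le_add (add_le_add (h1 0) (h1 1)) (h1 2)).trans_eq ?_)
  ring

/-- On the support of the symbol `2^n ≤ 2|k| ≤ 2π|k|`, so the curl enlarges each Fourier coefficient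
vector by at least `2^n`. This is the inverse of the curl, with its gain of one derivative, at the
level of `L²`. -/
theorem blockEnergy_curl (hd : d ≤ 3) {v j : Torus d → E3} (hv : ∀ a, Integrable fun y => v y a)
    (hj : ∀ a, Integrable fun y => j y a) (hdiv : WeaklyDivFree v) (hcurl : IsWeakCurl v j) (n : ℕ) :
    ((2 : ℝ≥0∞) ^ n) ^ 2 * blockEnergy n v ≤ blockEnergy n j := by
  rw [blockEnergy, blockEnergy, Finset.sum_comm, Finset.sum_comm (s := Finset.univ), Finset.mul_sum]
  refine Finset.sum_le_sum fun k _ => ?_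
  by_cases h0 : lpSymbol n k = 0
  · simp [h0]
  have h1 := le_of_lpSymbol_ne_zero h0
  have hs := Real.sq_sqrt (Finset.sum_nonneg fun i (_ : i ∈ Finset.univ) => sq_nonneg (k i : ℝ))
  have h2 : ((2 : ℝ) ^ n) ^ 2 ≤ (2 * Real.pi) ^ 2 * ∑ i, (k i : ℝ) ^ 2 := by
    rw [← hs, ← mul_pow]
    refine pow_le_pow_left₀ (by positivity) (h1.trans ?_) 2
    have : (1 : ℝ) ≤ Real.pi := by linarith [Real.pi_gt_three]
    nlinarith [Real.sqrt_nonneg (∑ i, (k i : ℝ) ^ 2)]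
  have h3 : ((2 : ℝ) ^ n) ^ 2 * ∑ a, ‖rfc (fun x => v x a) k‖ ^ 2 ≤
      ∑ a, ‖rfc (fun x => j x a) k‖ ^ 2 := by
    rw [sum_norm_rfc_curl hd hv hj hdiv hcurl]
    gcongr
  have h4 := ENNReal.ofReal_le_ofReal h3
  rw [ENNReal.ofReal_mul (by positivity), ENNReal.ofReal_sum_of_nonneg fun k _ => by positivity,
    ENNReal.ofReal_sum_of_nonneg fun k _ => by positivity] at h4
  simp only [ENNReal.ofReal_pow (norm_nonneg _), ofReal_norm] at h4
  rw [ENNReal.ofReal_pow (by positivity), ENNReal.ofReal_pow (by positivity), ENNReal.ofReal_ofNat] at h4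
  simp only [enorm_mul, mul_pow, ← Finset.mul_sum]
  rw [mul_left_comm]
  gcongr

end Blocks

/-! ### Oscillations from Littlewood-Paley blocks -/

section BlockOscillation

variable {d : ℕ}

open UnitAddTorus (mFourier)

theorem torusLength_neg (y : Torus d) : torusLength (-y) = torusLength y := by
  simp [torusLength]

/-- The coefficients of a component of the `n`-th Littlewood-Paley block. -/
noncomputable def blockCoeff (n : ℕ) (f : Torus d → ℝ) (k : Fin d → ℤ) : ℂ :=
  (lpSymbol n k : ℂ) * rfc f k

theorem trigPoly_sub_shift (S : Finset (Fin d → ℤ)) (c : (Fin d → ℤ) → ℂ) (x y : Torus d) :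
    trigPoly S c (x - y) - trigPoly S c x = trigPoly S (fun k => c k * (mFourier k (-y) - 1)) x := by
  rw [trigPoly, trigPoly, trigPoly, ← Finset.sum_sub_distrib]
  refine Finset.sum_congr rfl fun k _ => ?_
  rw [sub_eq_add_neg x y, mFourier_add_apply]
  ring

/-- A shift multiplies the coefficient at `k` by a character, and the deviation of the character
from `1` is at most `2` and at most of order `2^n ε`. The minimum is what later makes the sum over
`n` converge in both directions. -/
theorem eLpNorm_block_shift_le {ε : ℝ} (n : ℕ) (v : Torus d → E3) (a : Fin 3) {y : Torus d}
    (hy : torusLength y ≤ ε) :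
    eLpNorm (fun x => trigPoly (lpBox d n) (blockCoeff n fun z => v z a) (x - y) -
      trigPoly (lpBox d n) (blockCoeff n fun z => v z a) x) 3 volume ≤
      ((lpBox d n).card : ℝ≥0∞) ^ (1 / 6 : ℝ) *
        (ENNReal.ofReal (min 2 (4 * Real.pi * d * 2 ^ n * ε)) * blockEnergy n v ^ (1 / 2 : ℝ)) := by
  simp only [trigPoly_sub_shift]
  refine (eLpNorm_trigPoly_three_le _ _).trans ?_
  gcongr
  have hm : ∀ k ∈ lpBox d n, ‖mFourier k (-y) - 1‖ₑ ≤
      ENNReal.ofReal (min 2 (4 * Real.pi * d * 2 ^ n * ε)) := by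
    intro k hk
    rw [← ofReal_norm]
    refine ENNReal.ofReal_le_ofReal (le_min ?_ ?_)
    · refine (norm_sub_le _ _).trans ?_
      rw [norm_mFourier_apply, norm_one]
      norm_num
    · refine (norm_mFourier_sub_one_le (mem_lpBox.1 hk) _).trans ?_
      rw [torusLength_neg]
      calc 2 * Real.pi * (d * (2 * 2 ^ n)) * torusLength y
          = 4 * Real.pi * d * 2 ^ n * torusLength y := by ring
        _ ≤ _ := by gcongr
  set M := ENNReal.ofReal (min 2 (4 * Real.pi * d * 2 ^ n * ε))
  calc (∑ k ∈ lpBox d n, ‖blockCoeff n (fun z => v z a) k * (mFourier k (-y) - 1)‖ₑ ^ 2) ^ (1 / 2 : ℝ)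
      ≤ (M ^ 2 * blockEnergy n v) ^ (1 / 2 : ℝ) := by
        gcongr
        calc _ ≤ ∑ k ∈ lpBox d n, M ^ 2 * ‖blockCoeff n (fun z => v z a) k‖ₑ ^ 2 := by
              refine Finset.sum_le_sum fun k hk => ?_
              rw [enorm_mul, mul_pow, mul_comm]
              gcongr
              exact hm k hk
          _ = M ^ 2 * ∑ k ∈ lpBox d n, ‖blockCoeff n (fun z => v z a) k‖ₑ ^ 2 := by
              rw [Finset.mul_sum]
          _ ≤ _ := by
              gcongr
              exact Finset.single_le_sum
                (f := fun a => ∑ k ∈ lpBox d n, ‖blockCoeff n (fun z => v z a) k‖ₑ ^ 2)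
                (fun _ _ => zero_le) (Finset.mem_univ a)
    _ = M * blockEnergy n v ^ (1 / 2 : ℝ) := by
        rw [ENNReal.mul_rpow_of_nonneg _ _ (by norm_num), ← ENNReal.rpow_two, ← ENNReal.rpow_mul]
        norm_num

theorem sum_range_lpSymbol (N : ℕ) (k : Fin d → ℤ) :
    ∑ n ∈ Finset.range (N + 1), lpSymbol n k =
      lpCutoff (√(∑ i, (k i : ℝ) ^ 2) / 2 ^ N) - lpCutoff (2 * √(∑ i, (k i : ℝ) ^ 2)) := by
  induction N with
  | zero => simp [lpSymbol]
  | succ N ih =>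
    rw [Finset.sum_range_succ, ih, lpSymbol]
    have : 2 * √(∑ i, (k i : ℝ) ^ 2) / 2 ^ (N + 1) = √(∑ i, (k i : ℝ) ^ 2) / 2 ^ N := by
      rw [pow_succ]; field_simp
    rw [this]
    ring

theorem one_le_sqrt_sum {k : Fin d → ℤ} (hk : k ≠ 0) : 1 ≤ √(∑ i, (k i : ℝ) ^ 2) := by
  obtain ⟨i, hi⟩ := Function.ne_iff.1 hk
  refine le_trans ?_ (abs_le_sqrt_sum k i)
  exact_mod_cast Int.one_le_abs hi

/-- The multiplier of the remainder after summing Littlewood-Paley blocks. -/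
noncomputable def tailSymbol (N : ℕ) (k : Fin d → ℤ) : ℝ :=
  ∑ n ∈ Finset.range (N + 1), lpSymbol n k + (if k = 0 then 1 else 0) - 1

/-- The blocks telescope, and the low-frequency remainder `lpCutoff (2|k|)` vanishes for every
nonzero integer frequency since `|k| ≥ 1`. The zero mode belongs to no block and is restored by the
indicator. -/
theorem tailSymbol_eq (N : ℕ) (k : Fin d → ℤ) :
    tailSymbol N k = lpCutoff (√(∑ i, (k i : ℝ) ^ 2) / 2 ^ N) - 1 := by
  rw [tailSymbol, sum_range_lpSymbol]
  by_cases hk : k = 0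
  · subst hk
    simp [lpCutoff_of_le_one le_rfl zero_le_one]
  · rw [lpCutoff_of_two_le (ρ := 2 * √(∑ i, (k i : ℝ) ^ 2)) (by linarith [one_le_sqrt_sum hk])]
    simp [hk]

theorem abs_tailSymbol_le (N : ℕ) (k : Fin d → ℤ) : |tailSymbol N k| ≤ 1 := by
  rw [tailSymbol_eq, abs_le]
  constructor <;> linarith [lpCutoff_nonneg (√(∑ i, (k i : ℝ) ^ 2) / 2 ^ N),
    lpCutoff_le_one (√(∑ i, (k i : ℝ) ^ 2) / 2 ^ N)]

theorem tendsto_tailSymbol (k : Fin d → ℤ) :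
    Tendsto (fun N => tailSymbol N k) atTop (𝓝 0) := by
  refine tendsto_const_nhds.congr' ?_
  have h := (tendsto_pow_atTop_atTop_of_one_lt (one_lt_two (α := ℝ))).eventually_ge_atTop
    (√(∑ i, (k i : ℝ) ^ 2))
  filter_upwards [h] with N hN
  rw [tailSymbol_eq, lpCutoff_of_le_one (by positivity) (by
    rw [div_le_one (by positivity)]; exact hN), sub_self]

theorem fourierCoeffTorus_add {f g : Torus d → ℂ} (hf : Integrable f) (hg : Integrable g)
    (k : Fin d → ℤ) : fourierCoeffTorus (fun x => f x + g x) k =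
      fourierCoeffTorus f k + fourierCoeffTorus g k := by
  rw [fourierCoeffTorus, fourierCoeffTorus, fourierCoeffTorus,
    ← integral_add (integrable_mFourier_mul hf _) (integrable_mFourier_mul hg _)]
  simp only [mul_add]

theorem fourierCoeffTorus_sub {f g : Torus d → ℂ} (hf : Integrable f) (hg : Integrable g)
    (k : Fin d → ℤ) : fourierCoeffTorus (fun x => f x - g x) k =
      fourierCoeffTorus f k - fourierCoeffTorus g k := by
  rw [fourierCoeffTorus, fourierCoeffTorus, fourierCoeffTorus,
    ← integral_sub (integrable_mFourier_mul hf _) (integrable_mFourier_mul hg _)]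
  simp only [mul_sub]

theorem fourierCoeffTorus_sum {ι : Type*} (s : Finset ι) {f : ι → Torus d → ℂ}
    (hf : ∀ i ∈ s, Integrable (f i)) (k : Fin d → ℤ) :
    fourierCoeffTorus (fun x => ∑ i ∈ s, f i x) k = ∑ i ∈ s, fourierCoeffTorus (f i) k := by
  simp only [fourierCoeffTorus, Finset.mul_sum]
  exact integral_finsetSum _ fun i hi => integrable_mFourier_mul (hf i hi) _

/-- By Parseval the error is a sum of `|tailSymbol|² |f̂(k)|²`; the multiplier is at most `1` and
tends to `0` for each `k`, so dominated convergence applies. -/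
theorem tendsto_eLpNorm_sum_blocks {f : Torus d → ℝ} (hf : MemLp f 2) :
    Tendsto (fun N => eLpNorm (fun x => ((∑ n ∈ Finset.range (N + 1),
      trigPoly (lpBox d n) (blockCoeff n f) x) + rfc f 0) - (f x : ℂ)) 2 volume) atTop (𝓝 0) := by
  have hfi : Integrable fun x => (f x : ℂ) := (hf.integrable one_le_two).ofReal
  set P : ℕ → Torus d → ℂ := fun n => trigPoly (lpBox d n) (blockCoeff n f) with hP
  have hPc : ∀ n, Continuous (P n) := fun n => continuous_trigPoly _ _
  have hPi : ∀ n, Integrable (P n) := fun n => memLp_one_iff_integrable.1 ((hPc n).memLp_torus 1)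
  have hSc : ∀ N, Continuous fun x => ∑ n ∈ Finset.range (N + 1), P n x := fun N =>
    continuous_finsetSum _ fun n _ => hPc n
  have hSi : ∀ N, Integrable fun x => ∑ n ∈ Finset.range (N + 1), P n x := fun N =>
    integrable_finsetSum _ fun n _ => hPi n
  set g : ℕ → Torus d → ℂ := fun N x =>
    ((∑ n ∈ Finset.range (N + 1), P n x) + rfc f 0) - (f x : ℂ) with hg
  have hgm : ∀ N, MemLp (g N) 2 := fun N =>
    (((hSc N).add continuous_const).memLp_torus 2).sub hf.ofReal
  have hconst : ∀ k : Fin d → ℤ, fourierCoeffTorus (fun _ : Torus d => rfc f 0) k =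
      if k = 0 then rfc f 0 else 0 := by
    intro k
    have h1 : (fun _ : Torus d => rfc f 0) = trigPoly {0} fun _ => rfc f 0 := by
      ext x; simp [trigPoly, UnitAddTorus.mFourier_zero]
    rw [h1, fourierCoeffTorus_trigPoly]
    simp
  have hgk : ∀ N k, fourierCoeffTorus (g N) k = (tailSymbol N k : ℂ) * rfc f k := by
    intro N k
    rw [hg]
    simp only
    have hSi' : Integrable fun x => (∑ n ∈ Finset.range (N + 1), P n x) + rfc f 0 :=
      (hSi N).add (integrable_const _)
    rw [fourierCoeffTorus_sub hSi' hfi,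
      fourierCoeffTorus_add (hSi N) (integrable_const _), fourierCoeffTorus_sum _ fun n _ => hPi n,
      hconst]
    have h1 : ∀ n, fourierCoeffTorus (P n) k = (lpSymbol n k : ℂ) * rfc f k := by
      intro n
      rw [hP, fourierCoeffTorus_trigPoly]
      by_cases hk : k ∈ lpBox d n
      · rw [if_pos hk, blockCoeff]
      · rw [if_neg hk, lpSymbol_eq_zero_of_notMem hk]; simp
    simp only [h1]
    rw [← Finset.sum_mul, tailSymbol]
    change _ - rfc f k = _
    by_cases hk : k = 0
    · subst hk; simp
    · simp [hk]; ring
  have h2 : ∀ N, ∫ x, ‖g N x‖ ^ 2 = ∑' k, ‖(tailSymbol N k : ℂ) * rfc f k‖ ^ 2 := fun N => by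
    rw [← (hasSum_sq_fourierCoeffTorus (hgm N)).tsum_eq]
    simp only [hgk]
  have hsum : Summable fun k => ‖rfc f k‖ ^ 2 :=
    (hasSum_sq_fourierCoeffTorus (f := fun x => (f x : ℂ)) hf.ofReal).summable
  have h3 : Tendsto (fun N => ∫ x, ‖g N x‖ ^ 2) atTop (𝓝 0) := by
    simp only [h2]
    have := tendsto_tsum_of_dominated_convergence (𝓕 := atTop)
      (f := fun N k => ‖(tailSymbol N k : ℂ) * rfc f k‖ ^ 2) (g := fun _ => 0) hsum (fun k => ?_)
      (Eventually.of_forall fun N k => ?_)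
    · simpa using this
    · have h4 := ((tendsto_tailSymbol k).norm.mul_const ‖rfc f k‖).pow 2
      simpa using h4
    · rw [norm_pow, norm_norm, norm_mul, Complex.norm_real]
      gcongr
      exact mul_le_of_le_one_left (norm_nonneg _) (abs_tailSymbol_le N k)
  have h5 : ∀ N, eLpNorm (g N) 2 volume = ENNReal.ofReal (∫ x, ‖g N x‖ ^ 2) ^ (1 / 2 : ℝ) := by
    intro N
    rw [eLpNorm_eq_lintegral_rpow_enorm_toReal (by norm_num) (by norm_num), ENNReal.toReal_ofNat,
      ofReal_integral_eq_lintegral_ofReal ((hgm N).integrable_norm_pow two_ne_zero)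
      (Eventually.of_forall fun x => by positivity)]
    simp only [ENNReal.ofReal_pow (norm_nonneg _), ofReal_norm, ENNReal.rpow_two]
  refine Tendsto.congr (fun N => (h5 N).symm) ?_
  have h6 := (ENNReal.continuous_rpow_const (y := 1 / 2)).tendsto 0 |>.comp
    (by simpa using (ENNReal.continuous_ofReal.tendsto 0).comp h3)
  simpa [Function.comp_def] using h6

/-- The block expansion is known to converge only in `L²`. Passing to an almost everywhere
convergent subsequence, Fatou in `L³` and the triangle inequality give the bound; the constant mode
cancels in differences. -/
theorem eLpNorm_shift_le_tsum {f : Torus d → ℝ} (hf : MemLp f 2) (y : Torus d) :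
    eLpNorm (fun x => f (x - y) - f x) 3 volume ≤ ∑' n, eLpNorm (fun x =>
      trigPoly (lpBox d n) (blockCoeff n f) (x - y) - trigPoly (lpBox d n) (blockCoeff n f) x)
      3 volume := by
  set P : ℕ → Torus d → ℂ := fun n => trigPoly (lpBox d n) (blockCoeff n f) with hP
  have hPc : ∀ n, Continuous (P n) := fun n => continuous_trigPoly _ _
  set Q : ℕ → Torus d → ℂ := fun N x => (∑ n ∈ Finset.range (N + 1), P n x) + rfc f 0 with hQ
  have hQc : ∀ N, Continuous (Q N) := fun N =>
    (continuous_finsetSum _ fun n _ => hPc n).add continuous_const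
  have hlim := tendstoInMeasure_of_tendsto_eLpNorm (μ := (volume : Measure (Torus d))) (p := 2)
    (f := Q) (g := fun x => (f x : ℂ)) two_ne_zero (fun N => (hQc N).aestronglyMeasurable)
    hf.ofReal.1 (tendsto_eLpNorm_sum_blocks hf)
  obtain ⟨ns, -, hns⟩ := hlim.exists_seq_tendsto_ae
  have hae : ∀ᵐ x, Tendsto (fun i => Q (ns i) (x - y) - Q (ns i) x) atTop
      (𝓝 ((f (x - y) : ℂ) - f x)) := by
    filter_upwards [hns, (measurePreserving_sub_right volume y).quasiMeasurePreserving.ae hns]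
      with x h1 h2
    exact h2.sub h1
  have h1 : eLpNorm (fun x => f (x - y) - f x) 3 volume =
      eLpNorm (fun x => (f (x - y) : ℂ) - f x) 3 volume := by
    refine eLpNorm_congr_norm_ae (Eventually.of_forall fun x => ?_)
    rw [← Complex.ofReal_sub, Complex.norm_real]
  rw [h1]
  have hD : ∀ N, AEStronglyMeasurable (fun x => Q N (x - y) - Q N x) volume := fun N =>
    (((hQc N).comp (continuous_id.sub continuous_const)).sub (hQc N)).aestronglyMeasurable
  refine (Lp.eLpNorm_lim_le_liminf_eLpNorm (fun i => hD (ns i)) _ hae).trans ?_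
  refine liminf_le_of_le (by isBoundedDefault) fun b hb => ?_
  obtain ⟨i, hi⟩ := hb.exists
  refine hi.trans ?_
  have h2 : (fun x => Q (ns i) (x - y) - Q (ns i) x) =
      ∑ n ∈ Finset.range (ns i + 1), fun x => P n (x - y) - P n x := by
    ext x
    simp only [hQ, Finset.sum_apply, Finset.sum_sub_distrib]
    ring
  rw [h2]
  refine (eLpNorm_sum_le (fun n _ => ?_) (by norm_num)).trans (ENNReal.sum_le_tsum _)
  exact (((hPc n).comp (continuous_id.sub continuous_const)).sub (hPc n)).aestronglyMeasurable

theorem eLpNorm_le_sum_apply {w : Torus d → E3} (hw : AEStronglyMeasurable w) {p : ℝ≥0∞} (hp : 1 ≤ p) :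
    eLpNorm w p volume ≤ ∑ a, eLpNorm (fun x => w x a) p volume := by
  have h1 : ∀ x, ‖w x‖ ≤ ‖∑ a, ‖w x a‖‖ := fun x => by
    rw [Real.norm_of_nonneg (Finset.sum_nonneg fun _ _ => norm_nonneg _)]
    calc ‖w x‖ = ‖∑ a, EuclideanSpace.single a (w x a)‖ := by
          congr 1
          ext b
          simp [Finset.sum_apply]
      _ ≤ _ := (norm_sum_le _ _).trans_eq (by simp)
  refine (eLpNorm_mono h1).trans ?_
  have h2 : (fun x => ∑ a, ‖w x a‖) = ∑ a : Fin 3, fun x => ‖w x a‖ := by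
    ext x; simp
  rw [h2]
  refine (eLpNorm_sum_le (fun a _ => ?_) hp).trans_eq ?_
  · exact ((EuclideanSpace.proj a : E3 →L[ℝ] ℝ).continuous.comp_aestronglyMeasurable hw).norm
  · exact Finset.sum_congr rfl fun a _ => eLpNorm_norm _

theorem meanOsc_three_le_tsum {ε : ℝ} (hε : 0 < ε) {v : Torus d → E3} (hv : MemLp v 2) :
    meanOsc 3 ε v ≤ ∑' n, 3 * (((lpBox d n).card : ℝ≥0∞) ^ (1 / 6 : ℝ) *
      (ENNReal.ofReal (min 2 (4 * Real.pi * d * 2 ^ n * ε)) * blockEnergy n v ^ (1 / 2 : ℝ))) := by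
  refine meanOsc_le hε hv.1 (Eventually.of_forall fun y hy => ?_)
  have hm : AEStronglyMeasurable fun x => v (x - y) - v x :=
    (hv.1.comp_measurePreserving (measurePreserving_sub_right volume y)).sub hv.1
  refine (eLpNorm_le_sum_apply hm (by norm_num)).trans ?_
  have h1 : ∀ a, eLpNorm (fun x => (v (x - y) - v x) a) 3 volume ≤
      ∑' n, (((lpBox d n).card : ℝ≥0∞) ^ (1 / 6 : ℝ) *
      (ENNReal.ofReal (min 2 (4 * Real.pi * d * 2 ^ n * ε)) * blockEnergy n v ^ (1 / 2 : ℝ))) :=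
    fun a => (eLpNorm_shift_le_tsum (memLp_apply hv a) y).trans
      (ENNReal.tsum_le_tsum fun n => eLpNorm_block_shift_le n v a hy.le)
  refine (Finset.sum_le_sum fun a _ => h1 a).trans_eq ?_
  rw [ENNReal.tsum_mul_left]
  simp

end BlockOscillation

/-! ### Littlewood-Paley blocks of Besov functions -/

section BesovBlocks

variable {d : ℕ}

open UnitAddTorus (mFourier)

theorem inv_volume_torusBall_le {ε : ℝ} (hε : 0 < ε) (hε1 : ε ≤ 1) :
    (volume (torusBall d ε))⁻¹ ≤ ENNReal.ofReal ((d + 1) / ε) ^ d := by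
  have hr : 0 < ε / (d + 1) := by positivity
  have h1 : (univ.pi fun _ => Metric.closedBall (0 : UnitAddCircle) (ε / (d + 1) / 2)) ⊆
      torusBall d ε := by
    intro x hx
    have h2 : torusLength x ≤ (d + 1) * (ε / (d + 1) / 2) :=
      torusLength_le (fun i => by simpa using hx i (mem_univ i)) (by positivity)
    refine h2.trans_lt ?_
    have : (d + 1) * (ε / (d + 1) / 2) = ε / 2 := by field_simp
    linarith
  have h3 : ENNReal.ofReal (ε / (d + 1)) ^ d ≤ volume (torusBall d ε) := by
    refine le_trans (le_of_eq ?_) (measure_mono h1)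
    rw [volume_pi_pi]
    simp only [AddCircle.volume_closedBall, Finset.prod_const, Finset.card_univ, Fintype.card_fin]
    rw [mul_div_cancel₀ _ two_ne_zero, min_eq_right]
    rw [div_le_one (by positivity)]
    have : (0 : ℝ) ≤ d := Nat.cast_nonneg d
    linarith
  refine (ENNReal.inv_le_inv.2 h3).trans_eq ?_
  rw [ENNReal.inv_pow, ← ENNReal.ofReal_inv_of_pos hr, inv_div]

/-- A form of Young's inequality. The ball average `N` of `|g|` satisfies `∫ N^P ≤ ∫ |g|^P` by
Jensen and Tonelli, and `N^P ≤ |B_ε|⁻¹ ∫ |g|^P` pointwise; interpolating between the two bounds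
gives `L²`. -/
theorem lintegral_sq_conv_le {ε A : ℝ} {K g : Torus d → ℝ} (hK : KernelBound ε A K) (hε : 0 < ε)
    (hA : 0 ≤ A) (hg : AEStronglyMeasurable g) {p : ℝ≥0∞} (hp1 : 1 ≤ p) (hp2 : p ≤ 2)
    (hgp : eLpNorm g p volume ≠ ⊤) :
    ∫⁻ x, ‖conv K g x‖ₑ ^ 2 ≤ ENNReal.ofReal A ^ 2 *
      ((volume (torusBall d ε))⁻¹ ^ (2 / p.toReal - 1) * eLpNorm g p volume ^ 2) := by
  have := isProbabilityMeasure_ballMeasure (d := d) hε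
  have hpt : p ≠ ⊤ := (hp2.trans_lt ENNReal.ofNat_lt_top).ne
  have hp0 : p ≠ 0 := (zero_lt_one.trans_le hp1).ne'
  have hP1 : 1 ≤ p.toReal := by simpa using ENNReal.toReal_mono hpt hp1
  have hP2 : p.toReal ≤ 2 := by simpa using ENNReal.toReal_mono ENNReal.ofNat_ne_top hp2
  set P := p.toReal with hP
  set ν := ballMeasure d ε with hν
  set V := volume (torusBall d ε) with hV
  have hV0 : V⁻¹ ≠ ⊤ := by
    rw [ENNReal.inv_ne_top]
    exact ((isOpen_torusBall ε).measure_pos _ ⟨0, by rwa [torusBall, mem_ofPred_eq, torusLength_zero]⟩).ne'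
  set G := ∫⁻ x, ‖g x‖ₑ ^ P with hG
  have hnorm : eLpNorm g p volume = G ^ (1 / P) :=
    eLpNorm_eq_lintegral_rpow_enorm_toReal hp0 hpt
  have hGt : G ≠ ⊤ := by
    intro h
    rw [hnorm, h, ENNReal.top_rpow_of_pos (by positivity)] at hgp
    exact hgp rfl
  set N : Torus d → ℝ≥0∞ := fun x => ∫⁻ z, ‖g (x - z)‖ₑ ∂ν with hN
  have hconv : ∀ x, ‖conv K g x‖ₑ ≤ ENNReal.ofReal A * N x := fun x => by
    rw [conv_eq_integral_shift]
    refine (enorm_integral_le_lintegral_enorm _).trans ?_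
    simp only [enorm_mul]
    exact hK.lintegral_le hε hA _
  have hac : ν ≪ volume := ProbabilityTheory.cond_absolutelyContinuous
  have hgx : ∀ x, AEStronglyMeasurable (fun z => g (x - z)) ν := fun x =>
    (hg.comp_quasiMeasurePreserving
      (quasiMeasurePreserving_sub_left volume x)).mono_ac hac
  have hNP : ∀ x, N x ^ P ≤ ∫⁻ z, ‖g (x - z)‖ₑ ^ P ∂ν := fun x => by
    have h1 := eLpNorm_le_eLpNorm_of_exponent_le hp1 (hgx x)
    rw [eLpNorm_one_eq_lintegral_enorm, eLpNorm_eq_lintegral_rpow_enorm_toReal hp0 hpt, one_div,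
      ENNReal.le_rpow_inv_iff (by positivity)] at h1
    exact h1
  have hI : ∀ x, ∫⁻ z, ‖g (x - z)‖ₑ ^ P ∂ν ≤ V⁻¹ * G := fun x => by
    rw [hν, ballMeasure, ProbabilityTheory.cond, lintegral_smul_measure, smul_eq_mul]
    gcongr
    refine (lintegral_mono' Measure.restrict_le_self le_rfl).trans_eq ?_
    exact lintegral_sub_left_eq_self (fun z => ‖g z‖ₑ ^ P) x
  have hswap : ∫⁻ x, ∫⁻ z, ‖g (x - z)‖ₑ ^ P ∂ν = G := by
    rw [lintegral_lintegral_swap]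
    · have : ∀ z : Torus d, ∫⁻ x, ‖g (x - z)‖ₑ ^ P = G := fun z =>
        lintegral_sub_right_eq_self (fun x => ‖g x‖ₑ ^ P) z
      simp only [this]
      simp
    · exact ((hg.comp_quasiMeasurePreserving
        (quasiMeasurePreserving_sub_ballMeasure ε)).enorm.pow_const P)
  have hNM : ∀ x, N x ≤ (V⁻¹ * G) ^ (1 / P) := fun x => by
    rw [one_div, ENNReal.le_rpow_inv_iff (by positivity)]
    exact (hNP x).trans (hI x)
  have h1 := lintegral_rpow_le_of_le (μ := (volume : Measure (Torus d))) (r := 2) (p := P)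
    (ENNReal.rpow_ne_top_of_nonneg (by positivity) (ENNReal.mul_ne_top hV0 hGt)) hNM (by positivity) hP2
  simp only [ENNReal.rpow_two] at h1
  calc ∫⁻ x, ‖conv K g x‖ₑ ^ 2 ≤ ∫⁻ x, ENNReal.ofReal A ^ 2 * N x ^ 2 :=
        lintegral_mono fun x => by
          rw [← mul_pow]
          gcongr
          exact hconv x
    _ = ENNReal.ofReal A ^ 2 * ∫⁻ x, N x ^ 2 :=
        lintegral_const_mul' _ _ (ENNReal.pow_ne_top ENNReal.ofReal_ne_top)
    _ ≤ ENNReal.ofReal A ^ 2 * (((V⁻¹ * G) ^ (1 / P)) ^ (2 - P) * G) := by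
        gcongr
        refine h1.trans ?_
        gcongr
        exact (lintegral_mono hNP).trans_eq hswap
    _ = _ := by
        congr 1
        have hPpos : 0 < P := by positivity
        have e1 : 1 / P * (2 - P) = 2 / P - 1 := by field_simp
        have e2 : 0 ≤ 2 / P - 1 := by
          rw [sub_nonneg, le_div_iff₀ hPpos]; linarith
        rw [← ENNReal.rpow_mul, e1, ENNReal.mul_rpow_of_nonneg _ _ e2, mul_assoc, hnorm,
          ← ENNReal.rpow_two, ← ENNReal.rpow_mul]
        congr 1
        nth_rewrite 2 [← ENNReal.rpow_one G]
        rw [← ENNReal.rpow_add_of_nonneg _ _ e2 zero_le_one]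
        congr 1
        ring

/-- For frequencies whose largest coordinate is the `i`-th, a shift of size about `2^{-n}` along
that axis moves the character away from `1`. The Besov bound holds for almost every shift only, so
the shift is picked from a small open ball around the ideal one. -/
theorem exists_shift (hd : d ≤ 3) {p : Torus d → Prop} (hp : ∀ᵐ y, p y) (n : ℕ) (i : Fin d) :
    ∃ y, p y ∧ torusLength y ≤ (2 ^ n)⁻¹ ∧ ∀ k ∈ lpBox d n, lpSymbol n k ≠ 0 →
      (∀ l, |(k l : ℝ)| ≤ |(k i : ℝ)|) → 1 / 32 ≤ ‖mFourier (-k) y - 1‖ := by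
  have hd' : (d : ℝ) ≤ 3 := by exact_mod_cast hd
  set lam : ℝ := (2 ^ n)⁻¹ with hlam
  have hlam0 : 0 < lam := by positivity
  set w : Fin d → ℝ := Pi.single i (3 / 32 * lam) with hw
  have hopen : IsOpen (toTorus '' Metric.ball w (lam / 64)) :=
    isOpenQuotientMap_toTorus.isOpenMap _ Metric.isOpen_ball
  have hne : (toTorus '' Metric.ball w (lam / 64)).Nonempty :=
    ⟨_, w, Metric.mem_ball_self (by positivity), rfl⟩
  obtain ⟨_, hpy, v, hv, rfl⟩ := (Measure.dense_of_ae hp).exists_mem_open hopen hne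
  have hvw : ∀ l, |v l - w l| ≤ lam / 64 := fun l => by
    rw [mem_ball_iff_norm] at hv
    exact (norm_le_pi_norm (v - w) l).trans hv.le
  refine ⟨_, hpy, ?_, fun k hk hsym hmax => ?_⟩
  · refine (torusLength_toTorus_le v).trans ?_
    have h1 : ‖v‖ ≤ 7 / 64 * lam := by
      have h2 : ‖w‖ ≤ 3 / 32 * lam := by
        rw [hw, Pi.norm_single, Real.norm_of_nonneg (by positivity)]
      have h3 : ‖v - w‖ ≤ lam / 64 := (mem_ball_iff_norm.1 hv).le
      have h4 := norm_sub_norm_le v w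
      linarith
    calc (d + 1 : ℝ) * ‖v‖ ≤ (3 + 1) * (7 / 64 * lam) := by gcongr
      _ ≤ lam := by linarith
  · have hki := mem_lpBox.1 hk i
    -- The Euclidean length is at most `√d ≤ 2` times the largest coordinate.
    have hlow : 2 ^ n ≤ 4 * |(k i : ℝ)| := by
      have h1 := le_of_lpSymbol_ne_zero hsym
      have h2 : √(∑ l, (k l : ℝ) ^ 2) ≤ 2 * |(k i : ℝ)| := by
        refine Real.sqrt_le_iff.2 ⟨by positivity, ?_⟩
        calc ∑ l, (k l : ℝ) ^ 2 ≤ ∑ _l : Fin d, |(k i : ℝ)| ^ 2 :=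
              Finset.sum_le_sum fun l _ => by
                rw [← sq_abs (k l : ℝ)]
                exact pow_le_pow_left₀ (abs_nonneg _) (hmax l) 2
          _ = d * |(k i : ℝ)| ^ 2 := by simp
          _ ≤ (2 * |(k i : ℝ)|) ^ 2 := by nlinarith [sq_nonneg |(k i : ℝ)|]
      linarith
    have hsum : |(∑ l, (k l : ℝ) * v l) - (k i : ℝ) * (3 / 32 * lam)| ≤ 3 * (|(k i : ℝ)| * (lam / 64)) := by
      have e1 : (k i : ℝ) * (3 / 32 * lam) = ∑ l, (k l : ℝ) * w l := by
        simp [hw, Pi.single_apply]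
      rw [e1, ← Finset.sum_sub_distrib]
      refine (Finset.abs_sum_le_sum_abs _ _).trans ?_
      calc _ ≤ ∑ _l : Fin d, |(k i : ℝ)| * (lam / 64) := by
            refine Finset.sum_le_sum fun l _ => ?_
            rw [← mul_sub, abs_mul]
            exact mul_le_mul (hmax l) (hvw l) (abs_nonneg _) (abs_nonneg _)
        _ = d * (|(k i : ℝ)| * (lam / 64)) := by simp
        _ ≤ _ := by gcongr
    have hkl : 1 / 4 ≤ |(k i : ℝ)| * lam := by
      rw [hlam, le_mul_inv_iff₀ (by positivity)]; linarith
    have hku : |(k i : ℝ)| * lam ≤ 2 := by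
      rw [hlam, mul_inv_le_iff₀ (by positivity)]; linarith
    have habs : |(k i : ℝ) * (3 / 32 * lam)| = 3 / 32 * (|(k i : ℝ)| * lam) := by
      rw [abs_mul, abs_of_pos (by positivity : 0 < 3 / 32 * lam)]; ring
    set θ := ∑ l, (k l : ℝ) * v l with hθ
    have h1 := abs_sub_abs_le_abs_sub θ ((k i : ℝ) * (3 / 32 * lam))
    have h2 := abs_sub_abs_le_abs_sub ((k i : ℝ) * (3 / 32 * lam)) θ
    rw [abs_sub_comm] at h2
    -- The perturbation is at most half the main term `(3/32)|k i| lam`, and `|k i| lam` lies in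
    -- `[1/4, 2]`. So `θ` stays in the range of Jordan's inequality and off zero, and `4 · 1/128 =
    -- 1/32`.
    have h3 : |θ| ≤ 1 / 2 := by linarith
    have h4 : 1 / 128 ≤ |θ| := by linarith
    have h5 := le_norm_exp_sub_one (θ := -θ) (by rwa [abs_neg])
    rw [abs_neg] at h5
    have h6 : mFourier (-k) (toTorus v) =
        Complex.exp (((2 * Real.pi * (-θ) : ℝ) : ℂ) * Complex.I) := by
      rw [mFourier_toTorus]
      simp [hθ]
    rw [h6]
    linarith

/-- At a scale well below `2^{-n}` the characters of the box are within `1/2` of `1` on the support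
of `η`, which has mass `1`. Mollification is thus invertible on these frequencies. -/
theorem half_le_norm_rfc_mollifier {C ε : ℝ} {η : Torus d → ℝ} (hη : IsMollifier C ε η) {n : ℕ}
    (hε : 2 * Real.pi * (d * (2 * 2 ^ n)) * ε ≤ 1 / 2) {k : Fin d → ℤ} (hk : k ∈ lpBox d n) :
    1 / 2 ≤ ‖rfc η k‖ := by
  have hηi := hη.smooth.integrable
  have h1 : rfc η k - 1 = ∫ x, (mFourier (-k) x - 1) * (η x : ℂ) := by
    have h2 : (1 : ℂ) = ∫ x, (η x : ℂ) := by
      rw [integral_complex_ofReal, hη.integral_eq_one]; simp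
    rw [rfc, fourierCoeffTorus]
    nth_rewrite 1 [h2]
    refine (integral_sub (integrable_rfc hηi k) hηi.ofReal).symm.trans ?_
    simp only [sub_mul, one_mul]
    rfl
  have h3 : ‖rfc η k - 1‖ ≤ 1 / 2 := by
    rw [h1]
    calc _ ≤ ∫ x, 1 / 2 * η x := by
          refine norm_integral_le_of_norm_le (hηi.const_mul _) (Eventually.of_forall fun x => ?_)
          rw [norm_mul, Complex.norm_real, Real.norm_of_nonneg (hη.nonneg x)]
          by_cases hx : x ∈ torusBall d ε
          · refine mul_le_mul_of_nonneg_right ?_ (hη.nonneg x)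
            rw [mFourier_neg_eq]
            refine (norm_mFourier_sub_one_le (mem_lpBox.1 hk) _).trans (le_trans ?_ hε)
            rw [torusLength_neg]
            gcongr
            exact le_of_lt hx
          · simp [hη.bound.support x hx]
      _ = 1 / 2 := by rw [integral_const_mul, hη.integral_eq_one, mul_one]
  have h4 := norm_sub_norm_le (1 : ℂ) (1 - rfc η k)
  rw [sub_sub_cancel, norm_one, norm_sub_rev] at h4
  linarith

end BesovBlocks

section BesovDomination

variable {d : ℕ}

open UnitAddTorus (mFourier)

/-- Bounds for the Littlewood–Paley kernels in `L¹` are bypassed. The function is differenced along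
`d` suitable shifts of size `2^{-n}` and mollified at a comparable scale: at each frequency of the
block one of the resulting coefficients controls the original. The differences are small in `L^p` by
the Besov norm, and mollification carries them to `L²` at the Bernstein price. -/
theorem exists_blockEnergy_le_besovNorm (hd0 : 0 < d) (hd : d ≤ 3) {s : ℝ} (hs : 0 ≤ s) {p : ℝ≥0∞}
    (hp1 : 1 ≤ p) (hp2 : p ≤ 2) : ∃ C : ℝ≥0∞, C ≠ ⊤ ∧ ∀ (n : ℕ) (f : Torus d → E3), Integrable f →
      besovNorm s p f ≠ ⊤ → blockEnergy n f ^ (1 / 2 : ℝ) ≤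
        C * ((((2 : ℝ≥0∞) ^ n) ^ d) ^ (1 / p.toReal - 1 / 2) *
          (ENNReal.ofReal ((2 ^ n)⁻¹ ^ s) * besovNorm s p f)) := by
  obtain ⟨A, hA, hη⟩ := exists_mollifier d
  have hpt : p ≠ ⊤ := (hp2.trans_lt ENNReal.ofNat_lt_top).ne
  have hP1 : 1 ≤ p.toReal := by simpa using ENNReal.toReal_mono hpt hp1
  have hP2 : p.toReal ≤ 2 := by simpa using ENNReal.toReal_mono ENNReal.ofNat_ne_top hp2
  have he : 0 ≤ 1 / p.toReal - 1 / 2 := by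
    rw [sub_nonneg]; exact one_div_le_one_div_of_le (by linarith) hP2
  set L : ℝ≥0∞ := ENNReal.ofReal (32 * (d + 1) ^ 2) ^ d with hL
  set M : ℝ≥0∞ := 3 * d * (64 ^ 2 * ENNReal.ofReal A ^ 2) with hM
  have hMt : M ≠ ⊤ := by
    refine ENNReal.mul_ne_top (ENNReal.mul_ne_top (by simp) (by simp)) (ENNReal.mul_ne_top (by simp) ?_)
    exact ENNReal.pow_ne_top ENNReal.ofReal_ne_top
  have hLt : L ≠ ⊤ := ENNReal.pow_ne_top ENNReal.ofReal_ne_top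
  refine ⟨M ^ (1 / 2 : ℝ) * L ^ (1 / p.toReal - 1 / 2), ENNReal.mul_ne_top
    (ENNReal.rpow_ne_top_of_nonneg (by norm_num) hMt) (ENNReal.rpow_ne_top_of_nonneg he hLt),
    fun n f hf hB => ?_⟩
  have h2n : (1 : ℝ) ≤ 2 ^ n := one_le_pow₀ one_le_two
  have h2n0 : (0 : ℝ) < 2 ^ n := by positivity
  have hd1 : (1 : ℝ) ≤ d + 1 := by linarith [(Nat.cast_nonneg d : (0 : ℝ) ≤ d)]
  -- Chosen so that `4π d 2^n ε ≤ π/8 ≤ 1/2`, as `half_le_norm_rfc_mollifier` requires.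
  set ε : ℝ := 1 / (32 * (d + 1) * 2 ^ n) with hε
  have hε0 : 0 < ε := by positivity
  have hε1 : ε ≤ 1 := by
    rw [hε, div_le_one (by positivity)]
    nlinarith
  obtain ⟨η, hη⟩ := hη ε hε0 hε1
  have hεn : 2 * Real.pi * (d * (2 * 2 ^ n)) * ε ≤ 1 / 2 := by
    have e1 : 2 * Real.pi * (d * (2 * 2 ^ n)) * ε = Real.pi * (d / (d + 1)) / 8 := by
      rw [hε]; field_simp; ring
    have e2 : (d : ℝ) / (d + 1) ≤ 1 := by rw [div_le_one (by linarith)]; linarith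
    rw [e1]
    nlinarith [Real.pi_le_four, Real.pi_pos]
  choose y hyB hyl hyk using fun i => exists_shift hd (ae_eLpNorm_shift_le_besovNorm s p f) n i
  have hfa : ∀ a, Integrable fun x => f x a := fun a =>
    (EuclideanSpace.proj a : E3 →L[ℝ] ℝ).integrable_comp hf
  set g : Fin d → Fin 3 → Torus d → ℝ := fun i a x => f (x - y i) a - f x a with hg
  have hgi : ∀ i a, Integrable (g i a) := fun i a => ((hfa a).comp_sub_right (y i)).sub (hfa a)
  set D := ENNReal.ofReal ((2 ^ n)⁻¹ ^ s) * besovNorm s p f with hD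
  have hDt : D ≠ ⊤ := ENNReal.mul_ne_top ENNReal.ofReal_ne_top hB
  have hgD : ∀ i a, eLpNorm (g i a) p volume ≤ D := fun i a => by
    refine le_trans (eLpNorm_mono_enorm fun x => enorm_apply_le (f (x - y i) - f x) a) ?_
    refine (hyB i).trans ?_
    rw [hD]
    gcongr
    exacts [Real.sqrt_nonneg _, hyl i]
  set V := (volume (torusBall d ε))⁻¹ with hV
  have hVL : V ≤ L * ((2 : ℝ≥0∞) ^ n) ^ d := by
    refine (inv_volume_torusBall_le hε0 hε1).trans_eq ?_
    rw [hL, ← mul_pow]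
    congr 1
    have e1 : ((d : ℝ) + 1) / ε = 32 * (d + 1) ^ 2 * 2 ^ n := by
      rw [hε]; field_simp
    rw [e1, ENNReal.ofReal_mul (by positivity), ENNReal.ofReal_pow zero_le_two, ENNReal.ofReal_ofNat]
  have hrfc : ∀ i a k, rfc (conv η (g i a)) k =
      rfc η k * ((mFourier (-k) (y i) - 1) * rfc (fun x => f x a) k) := fun i a k => by
    rw [rfc_conv hη.smooth.continuous (hgi i a), hg]
    simp only
    rw [rfc_sub ((hfa a).comp_sub_right (y i)) (hfa a), rfc_shift (fun x => f x a)]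
    ring
  have hk : ∀ a, ∀ k ∈ lpBox d n, ‖(lpSymbol n k : ℂ) * rfc (fun x => f x a) k‖ₑ ^ 2 ≤
      ∑ i, 64 ^ 2 * ‖rfc (conv η (g i a)) k‖ₑ ^ 2 := by
    intro a k hk
    by_cases h0 : lpSymbol n k = 0
    · simp [h0]
    obtain ⟨i, -, hi⟩ := Finset.exists_max_image Finset.univ (fun i => |(k i : ℝ)|)
      ⟨⟨0, hd0⟩, Finset.mem_univ _⟩
    have h1 := hyk i k hk h0 fun l => hi l (Finset.mem_univ l)
    have h2 := half_le_norm_rfc_mollifier hη hεn hk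
    -- `64` is the inverse of `1/2` from the mollifier times `1/32` from the shift.
    have h3 : ‖(lpSymbol n k : ℂ) * rfc (fun x => f x a) k‖ ≤ 64 * ‖rfc (conv η (g i a)) k‖ := by
      rw [hrfc, norm_mul, norm_mul, norm_mul, Complex.norm_real, Real.norm_eq_abs]
      have h4 : |lpSymbol n k| ≤ 64 * (‖rfc η k‖ * ‖mFourier (-k) (y i) - 1‖) := by
        have h5 : (1 / 2 : ℝ) * (1 / 32) ≤ ‖rfc η k‖ * ‖mFourier (-k) (y i) - 1‖ :=
          mul_le_mul h2 h1 (by norm_num) (norm_nonneg _)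
        linarith [abs_lpSymbol_le n k]
      calc _ ≤ 64 * (‖rfc η k‖ * ‖mFourier (-k) (y i) - 1‖) * ‖rfc (fun x => f x a) k‖ := by gcongr
        _ = _ := by ring
    have h6 : ‖(lpSymbol n k : ℂ) * rfc (fun x => f x a) k‖ₑ ≤ 64 * ‖rfc (conv η (g i a)) k‖ₑ := by
      have := ENNReal.ofReal_le_ofReal h3
      rw [ENNReal.ofReal_mul (by norm_num), ofReal_norm, ofReal_norm, ENNReal.ofReal_ofNat] at this
      exact this
    calc _ ≤ (64 * ‖rfc (conv η (g i a)) k‖ₑ) ^ 2 := by gcongr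
      _ = 64 ^ 2 * ‖rfc (conv η (g i a)) k‖ₑ ^ 2 := mul_pow _ _ _
      _ ≤ _ := Finset.single_le_sum (f := fun i => 64 ^ 2 * ‖rfc (conv η (g i a)) k‖ₑ ^ 2)
        (fun _ _ => zero_le) (Finset.mem_univ i)
  have hE : blockEnergy n f ≤ M * (V ^ (2 / p.toReal - 1) * D ^ 2) := by
    calc blockEnergy n f ≤ ∑ a : Fin 3, ∑ k ∈ lpBox d n, ∑ i, 64 ^ 2 * ‖rfc (conv η (g i a)) k‖ₑ ^ 2 :=
          Finset.sum_le_sum fun a _ => Finset.sum_le_sum fun k hk' => hk a k hk'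
      _ = ∑ a : Fin 3, ∑ i, 64 ^ 2 * ∑ k ∈ lpBox d n, ‖rfc (conv η (g i a)) k‖ₑ ^ 2 := by
          refine Finset.sum_congr rfl fun a _ => ?_
          rw [Finset.sum_comm]
          exact Finset.sum_congr rfl fun i _ => (Finset.mul_sum _ _ _).symm
      _ ≤ ∑ _a : Fin 3, ∑ _i : Fin d, 64 ^ 2 * (ENNReal.ofReal A ^ 2 *
            (V ^ (2 / p.toReal - 1) * D ^ 2)) := by
          refine Finset.sum_le_sum fun a _ => Finset.sum_le_sum fun i _ => ?_
          gcongr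
          refine (sum_sq_rfc_le ((hη.smooth.conv (hgi i a)).continuous.memLp_torus 2) _).trans ?_
          refine (lintegral_sq_conv_le hη.bound hε0 hA (hgi i a).1 hp1 hp2
            ((hgD i a).trans_lt hDt.lt_top).ne).trans ?_
          gcongr
          exact hgD i a
      _ = _ := by
          simp only [Finset.sum_const, Finset.card_univ, Fintype.card_fin, nsmul_eq_mul, hM]
          push_cast
          ring
  have e2 : (2 / p.toReal - 1) * (1 / 2) = 1 / p.toReal - 1 / 2 := by ring
  calc blockEnergy n f ^ (1 / 2 : ℝ) ≤ (M * (V ^ (2 / p.toReal - 1) * D ^ 2)) ^ (1 / 2 : ℝ) := by gcongr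
    _ = M ^ (1 / 2 : ℝ) * (V ^ (1 / p.toReal - 1 / 2) * D) := by
        rw [ENNReal.mul_rpow_of_nonneg M _ (by norm_num),
          ENNReal.mul_rpow_of_nonneg (V ^ _) _ (by norm_num), ← ENNReal.rpow_mul, e2, ← ENNReal.rpow_two, ← ENNReal.rpow_mul]
        norm_num
    _ ≤ M ^ (1 / 2 : ℝ) * ((L * ((2 : ℝ≥0∞) ^ n) ^ d) ^ (1 / p.toReal - 1 / 2) * D) := by gcongr
    _ = _ := by
        rw [ENNReal.mul_rpow_of_nonneg L _ he]
        ring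

end BesovDomination

/-! ### Oscillations of the field controlled by the blocks of its current -/

theorem ofReal_two_rpow (x : ℝ) : ENNReal.ofReal (2 ^ x) = (2 : ℝ≥0∞) ^ x := by
  rw [← ENNReal.ofReal_rpow_of_pos two_pos, ENNReal.ofReal_ofNat]

theorem two_rpow_add (x y : ℝ) : (2 : ℝ≥0∞) ^ (x + y) = 2 ^ x * 2 ^ y :=
  ENNReal.rpow_add _ _ two_ne_zero ENNReal.ofNat_ne_top

/-- The weight with which frequencies of size `2^n` contribute to oscillations at scale `ε`. -/
noncomputable def scaleWeight (s : ℝ) : ℝ := min 1 s * s ^ (-(2 / 3) : ℝ)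

theorem scaleWeight_le_rpow {s : ℝ} (hs : 0 < s) : scaleWeight s ≤ s ^ (1 / 3 : ℝ) := by
  have h := mul_le_mul_of_nonneg_right (min_le_right 1 s) (Real.rpow_nonneg hs.le (-(2 / 3)))
  refine h.trans_eq ?_
  nth_rewrite 1 [← Real.rpow_one s]
  rw [← Real.rpow_add hs]
  norm_num

theorem scaleWeight_le_rpow_neg {s : ℝ} (hs : 0 < s) : scaleWeight s ≤ s ^ (-(1 / 3) : ℝ) := by
  rcases le_total s 1 with h1 | h1
  · refine (scaleWeight_le_rpow hs).trans ((Real.rpow_le_one hs.le h1 (by norm_num)).trans ?_)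
    exact Real.one_le_rpow_of_pos_of_le_one_of_nonpos hs h1 (by norm_num)
  · have h := mul_le_mul_of_nonneg_right (min_le_left 1 s) (Real.rpow_nonneg hs.le (-(2 / 3)))
    refine h.trans ?_
    rw [one_mul]
    exact Real.rpow_le_rpow_of_exponent_le h1 (by norm_num)

theorem two_pow_rpow (m : ℕ) (x : ℝ) : ((2 : ℝ) ^ m) ^ x = (2 ^ x) ^ m := by
  rw [← Real.rpow_natCast, ← Real.rpow_natCast, ← Real.rpow_mul zero_le_two,
    ← Real.rpow_mul zero_le_two, mul_comm]

theorem ENNReal.tsum_eq_sum_range_add (f : ℕ → ℝ≥0∞) (N : ℕ) :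
    ∑' n, f n = ∑ n ∈ Finset.range N, f n + ∑' i, f (i + N) :=
  (Summable.sum_add_tsum_nat_add' (f := f) (k := N) ENNReal.summable).symm

/-- The weight decays like `s^{1/3}` for small `s` and `s^{-1/3}` up to its size for large `s` (it
is exactly `s^{-2/3}` there), so the sum is bounded by two geometric series, one on each side of the
index `m` where `2^m ε` is about `1`. -/
theorem exists_tsum_scaleWeight_le : ∃ S : ℝ≥0∞, S ≠ ⊤ ∧ ∀ ε : ℝ, 0 < ε → ε ≤ 1 →
    ∑' n : ℕ, ENNReal.ofReal (scaleWeight (2 ^ n * ε)) ≤ S := by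
  set r : ℝ := 2 ^ (-(1 / 3) : ℝ) with hr
  have hr0 : 0 < r := by positivity
  have hr1 : r < 1 := Real.rpow_lt_one_of_one_lt_of_neg one_lt_two (by norm_num)
  set R : ℝ≥0∞ := ∑' i : ℕ, ENNReal.ofReal r ^ i with hR
  have hRt : R ≠ ⊤ := by
    rw [hR, ENNReal.tsum_geometric, ENNReal.inv_ne_top]
    exact (tsub_pos_of_lt (by simpa using hr1)).ne'
  refine ⟨R + R, ENNReal.add_ne_top.2 ⟨hRt, hRt⟩, fun ε hε hε1 => ?_⟩
  obtain ⟨m, hm1, hm2⟩ := exists_nat_pow_near_of_lt_one hε hε1 (by norm_num : (0 : ℝ) < 1 / 2)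
    (by norm_num)
  rw [one_div, inv_pow] at hm1 hm2
  have hlow : ∀ n ≤ m, ENNReal.ofReal (scaleWeight (2 ^ n * ε)) ≤ ENNReal.ofReal r ^ (m - n) := by
    intro n hn
    rw [← ENNReal.ofReal_pow hr0.le]
    refine ENNReal.ofReal_le_ofReal ((scaleWeight_le_rpow (by positivity)).trans ?_)
    have h1 : 2 ^ n * ε ≤ ((2 : ℝ) ^ (m - n))⁻¹ := by
      calc (2 : ℝ) ^ n * ε ≤ 2 ^ n * (2 ^ m)⁻¹ := by gcongr
        _ = _ := by rw [pow_sub₀ _ two_ne_zero hn, mul_inv, inv_inv, mul_comm]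
    refine (Real.rpow_le_rpow (by positivity) h1 (by norm_num)).trans_eq ?_
    rw [Real.inv_rpow (by positivity), ← Real.rpow_neg (by positivity), two_pow_rpow]
  have hhigh : ∀ i, ENNReal.ofReal (scaleWeight (2 ^ (i + (m + 1)) * ε)) ≤ ENNReal.ofReal r ^ i := by
    intro i
    rw [← ENNReal.ofReal_pow hr0.le]
    refine ENNReal.ofReal_le_ofReal ((scaleWeight_le_rpow_neg (by positivity)).trans ?_)
    have h1 : (2 : ℝ) ^ i ≤ 2 ^ (i + (m + 1)) * ε := by
      calc (2 : ℝ) ^ i = 2 ^ (i + (m + 1)) * (2 ^ (m + 1))⁻¹ := by rw [pow_add]; field_simp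
        _ ≤ _ := by gcongr
    refine (Real.rpow_le_rpow_of_nonpos (by positivity) h1 (by norm_num)).trans_eq ?_
    rw [two_pow_rpow]
  rw [ENNReal.tsum_eq_sum_range_add _ (m + 1)]
  refine add_le_add ?_ (ENNReal.tsum_le_tsum hhigh)
  calc _ ≤ ∑ n ∈ Finset.range (m + 1), ENNReal.ofReal r ^ (m - n) :=
        Finset.sum_le_sum fun n hn => hlow n (Nat.lt_succ_iff.1 (Finset.mem_range.1 hn))
    _ = ∑ n ∈ Finset.range (m + 1), ENNReal.ofReal r ^ n := by
        rw [← Finset.sum_range_reflect (fun n => ENNReal.ofReal r ^ n)]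
        exact Finset.sum_congr rfl fun n _ => by simp
    _ ≤ R := ENNReal.sum_le_tsum _

/-- A Toeplitz argument: the tail is small because `b` is small and the total weight bounded, and
the finitely many remaining terms vanish in the limit one by one. -/
theorem tendsto_tsum_mul_zero {α : Type*} {l : Filter α} {K : α → ℕ → ℝ≥0∞} {b : ℕ → ℝ≥0∞}
    {S : ℝ≥0∞} (hS : S ≠ ⊤) (hKS : ∀ᶠ x in l, ∑' n, K x n ≤ S)
    (hK : ∀ n, Tendsto (fun x => K x n) l (𝓝 0)) (hb : ∀ n, b n ≠ ⊤) (hb0 : Tendsto b atTop (𝓝 0)) :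
    Tendsto (fun x => ∑' n, K x n * b n) l (𝓝 0) := by
  rw [ENNReal.tendsto_nhds_zero]
  intro δ hδ
  have h1 : Tendsto (fun n => b n * S) atTop (𝓝 0) := by
    simpa using ENNReal.Tendsto.mul_const hb0 (Or.inr hS)
  have hδ2 : 0 < δ / 2 := ENNReal.half_pos hδ.ne'
  obtain ⟨c, hc, hcS⟩ : ∃ c : ℝ≥0∞, 0 < c ∧ c * S ≤ δ / 2 := by
    by_cases hS0 : S = 0
    · exact ⟨1, one_pos, by simp [hS0]⟩
    · exact ⟨δ / 2 / S, ENNReal.div_pos hδ2.ne' hS, (ENNReal.div_mul_cancel hS0 hS).le⟩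
  obtain ⟨N, hN⟩ := eventually_atTop.1 (ENNReal.tendsto_nhds_zero.1 hb0 c hc)
  have h2 : Tendsto (fun x => ∑ n ∈ Finset.range N, K x n * b n) l (𝓝 0) := by
    have := tendsto_finsetSum (Finset.range N) fun n (_ : n ∈ Finset.range N) =>
      ENNReal.Tendsto.mul_const (hK n) (Or.inr (hb n))
    simpa using this
  filter_upwards [hKS, ENNReal.tendsto_nhds_zero.1 h2 _ hδ2] with x hx1 hx2
  rw [ENNReal.tsum_eq_sum_range_add _ N, ← ENNReal.add_halves δ]
  refine add_le_add hx2 ?_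
  calc ∑' i, K x (i + N) * b (i + N) ≤ ∑' i, K x (i + N) * c :=
        ENNReal.tsum_le_tsum fun i => by gcongr; exact hN _ (Nat.le_add_left N i)
    _ = (∑' i, K x (i + N)) * c := ENNReal.tsum_mul_right
    _ ≤ S * c := by
        gcongr
        refine le_trans ?_ hx1
        rw [ENNReal.tsum_eq_sum_range_add (K x) N]
        exact le_add_self
    _ = c * S := mul_comm _ _
    _ ≤ _ := hcS

/-! ### Rescaled blocks of the current and oscillations of the field. -/

section CurrentBlocks

variable {d : ℕ}

/-- The `L²` norm of the `n`-th Littlewood-Paley block, scaled so that it is bounded in terms of the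
`B^{1/3}_{3d/(d+2),∞}` norm. -/
noncomputable def scaledBlock (n : ℕ) (f : Torus d → E3) : ℝ≥0∞ :=
  2 ^ ((n : ℝ) * (d / 6 - 1 / 3)) * blockEnergy n f ^ (1 / 2 : ℝ)

theorem scaledBlock_ne_top (n : ℕ) (f : Torus d → E3) : scaledBlock n f ≠ ⊤ := by
  refine ENNReal.mul_ne_top (ENNReal.rpow_ne_top_of_ne_zero two_ne_zero ENNReal.ofNat_ne_top)
    (ENNReal.rpow_ne_top_of_nonneg (by norm_num) ?_)
  exact ENNReal.sum_ne_top.2 fun _ _ => ENNReal.sum_ne_top.2 fun _ _ =>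
    ENNReal.pow_ne_top enorm_ne_top

theorem card_lpBox_rpow_le (n : ℕ) {e : ℝ} (he : 0 ≤ e) :
    ((lpBox d n).card : ℝ≥0∞) ^ e ≤ ((5 : ℝ≥0∞) ^ d) ^ e * 2 ^ ((n : ℝ) * (d * e)) := by
  have h1 : ((lpBox d n).card : ℝ≥0∞) ≤ 5 ^ d * (2 ^ n) ^ d := by
    rw [← mul_pow]
    exact_mod_cast card_lpBox_le d n
  refine (ENNReal.rpow_le_rpow h1 he).trans_eq ?_
  rw [ENNReal.mul_rpow_of_nonneg _ _ he]
  congr 1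
  rw [← pow_mul, ← ENNReal.rpow_natCast, ← ENNReal.rpow_mul]
  congr 1
  push_cast
  ring

theorem blockEnergy_rpow_half_curl_le (hd : d ≤ 3) {v j : Torus d → E3} (hv : ∀ a, Integrable fun y => v y a)
    (hj : ∀ a, Integrable fun y => j y a) (hdiv : WeaklyDivFree v) (hcurl : IsWeakCurl v j) (n : ℕ) :
    blockEnergy n v ^ (1 / 2 : ℝ) ≤ 2 ^ (-(n : ℝ)) * blockEnergy n j ^ (1 / 2 : ℝ) := by
  have h1 := ENNReal.rpow_le_rpow (blockEnergy_curl hd hv hj hdiv hcurl n)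
    (by norm_num : (0 : ℝ) ≤ 1 / 2)
  rw [ENNReal.mul_rpow_of_nonneg _ _ (by norm_num), ← ENNReal.rpow_two, ← ENNReal.rpow_mul] at h1
  norm_num at h1
  rw [← ENNReal.rpow_natCast] at h1
  norm_num
  calc blockEnergy n v ^ (1 / 2 : ℝ)
      = 2 ^ (-(n : ℝ)) * (2 ^ (n : ℝ) * blockEnergy n v ^ (1 / 2 : ℝ)) := by
        rw [← mul_assoc, ← two_rpow_add, neg_add_cancel, ENNReal.rpow_zero, one_mul]
    _ ≤ _ := by gcongr

/-- Count of powers of `2^n`: `d/6` from Bernstein into `L³`, `−1` from inverting the curl, and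
`2/3` from extracting `ε^{-2/3}` as a weight in `2^n ε`. The total `d/6 − 1/3` is the exponent in
`scaledBlock`. -/
theorem exists_meanOsc_le_tsum_scaledBlock (hd : d ≤ 3) : ∃ C : ℝ≥0∞, C ≠ ⊤ ∧
    ∀ v j : Torus d → E3, MemLp v 2 → Integrable j → WeaklyDivFree v → IsWeakCurl v j →
      ∀ ε : ℝ, 0 < ε → ENNReal.ofReal (ε ^ (-(2 / 3) : ℝ)) * meanOsc 3 ε v ≤
        C * ∑' n : ℕ, ENNReal.ofReal (scaleWeight (2 ^ n * ε)) * scaledBlock n j := by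
  refine ⟨3 * (((5 : ℝ≥0∞) ^ d) ^ (1 / 6 : ℝ) * ENNReal.ofReal (4 * Real.pi * (d + 1))),
    ENNReal.mul_ne_top (by simp) (ENNReal.mul_ne_top
      (ENNReal.rpow_ne_top_of_nonneg (by norm_num) (by simp)) ENNReal.ofReal_ne_top),
    fun v j hv hj hdiv hcurl ε hε => ?_⟩
  have hva : ∀ a, Integrable fun x => v x a := fun a => integrable_comp hv one_le_two a
  have hja : ∀ a, Integrable fun x => j x a := fun a =>
    (EuclideanSpace.proj a : E3 →L[ℝ] ℝ).integrable_comp hj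
  rw [← ENNReal.tsum_mul_left]
  refine (mul_le_mul_right (meanOsc_three_le_tsum hε hv) _).trans ?_
  rw [← ENNReal.tsum_mul_left]
  refine ENNReal.tsum_le_tsum fun n => ?_
  have hs : 0 < 2 ^ n * ε := by positivity
  have h1 : ENNReal.ofReal (ε ^ (-(2 / 3) : ℝ)) * ENNReal.ofReal (min 2 (4 * Real.pi * d * 2 ^ n * ε)) ≤
      ENNReal.ofReal (4 * Real.pi * (d + 1)) *
        (2 ^ ((n : ℝ) * (2 / 3)) * ENNReal.ofReal (scaleWeight (2 ^ n * ε))) := by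
    rw [← ofReal_two_rpow, ← ENNReal.ofReal_mul (by positivity), ← ENNReal.ofReal_mul (by positivity),
      ← ENNReal.ofReal_mul (by positivity)]
    refine ENNReal.ofReal_le_ofReal ?_
    have e1 : (2 ^ n * ε) ^ (-(2 / 3) : ℝ) * 2 ^ ((n : ℝ) * (2 / 3)) = ε ^ (-(2 / 3) : ℝ) := by
      rw [Real.mul_rpow (by positivity) hε.le, ← Real.rpow_natCast, ← Real.rpow_mul zero_le_two,
        mul_right_comm, ← Real.rpow_add two_pos]
      simp
    have e2 : min 2 (4 * Real.pi * d * 2 ^ n * ε) ≤ 4 * Real.pi * (d + 1) * min 1 (2 ^ n * ε) := by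
      have hd0 : (0 : ℝ) ≤ d := Nat.cast_nonneg d
      rcases le_total 1 (2 ^ n * ε) with h | h
      · rw [min_eq_left h]
        refine (min_le_left _ _).trans ?_
        nlinarith [Real.pi_gt_three]
      · rw [min_eq_right h]
        refine (min_le_right _ _).trans ?_
        calc 4 * Real.pi * d * 2 ^ n * ε = 4 * Real.pi * d * (2 ^ n * ε) := by ring
          _ ≤ _ := by gcongr; linarith
    calc ε ^ (-(2 / 3) : ℝ) * min 2 (4 * Real.pi * d * 2 ^ n * ε)
        ≤ ε ^ (-(2 / 3) : ℝ) * (4 * Real.pi * (d + 1) * min 1 (2 ^ n * ε)) := by gcongr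
      _ = _ := by rw [← e1, scaleWeight]; ring
  have h2 := card_lpBox_rpow_le (d := d) n (e := 1 / 6) (by norm_num)
  have h3 := blockEnergy_rpow_half_curl_le hd hva hja hdiv hcurl n
  have e3 : (2 : ℝ≥0∞) ^ ((n : ℝ) * (d * (1 / 6))) * 2 ^ (-(n : ℝ)) * 2 ^ ((n : ℝ) * (2 / 3)) =
      2 ^ ((n : ℝ) * (d / 6 - 1 / 3)) := by
    rw [← two_rpow_add, ← two_rpow_add]
    congr 1
    ring
  calc _ = 3 * (((lpBox d n).card : ℝ≥0∞) ^ (1 / 6 : ℝ) * (ENNReal.ofReal (ε ^ (-(2 / 3) : ℝ)) *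
        ENNReal.ofReal (min 2 (4 * Real.pi * d * 2 ^ n * ε))) * blockEnergy n v ^ (1 / 2 : ℝ)) := by ring
    _ ≤ 3 * ((((5 : ℝ≥0∞) ^ d) ^ (1 / 6 : ℝ) * 2 ^ ((n : ℝ) * (d * (1 / 6)))) *
        (ENNReal.ofReal (4 * Real.pi * (d + 1)) *
        (2 ^ ((n : ℝ) * (2 / 3)) * ENNReal.ofReal (scaleWeight (2 ^ n * ε)))) *
        (2 ^ (-(n : ℝ)) * blockEnergy n j ^ (1 / 2 : ℝ))) := by gcongr
    _ = _ := by rw [scaledBlock, ← e3]; ring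

end CurrentBlocks

/-! ### The critical integrability exponent and the limit in time. -/

section CurrentCriterion

variable {d : ℕ}

theorem toReal_current_exponent (d : ℕ) :
    (3 * d / (d + 2) : ℝ≥0∞).toReal = 3 * d / (d + 2) := by
  rw [ENNReal.toReal_div, ENNReal.toReal_mul, ENNReal.toReal_add (by simp) (by simp)]
  simp

theorem current_exponent_mem (hd : d = 2 ∨ d = 3) :
    1 ≤ (3 * d / (d + 2) : ℝ≥0∞) ∧ (3 * d / (d + 2) : ℝ≥0∞) ≤ 2 := by
  have ht : (3 * d / (d + 2) : ℝ≥0∞) ≠ ⊤ :=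
    ENNReal.div_ne_top (ENNReal.mul_ne_top (by simp) (by simp)) (by simp)
  have h := toReal_current_exponent d
  constructor
  · rw [← ENNReal.toReal_le_toReal ENNReal.one_ne_top ht, h]
    rcases hd with rfl | rfl <;> norm_num
  · rw [← ENNReal.toReal_le_toReal ht ENNReal.ofNat_ne_top, h]
    rcases hd with rfl | rfl <;> norm_num

/-- The Bernstein loss from `L^p` to `L²`. Added to the exponent `d/6 − 1/3` of `scaledBlock` it
gives exactly `1/3`, which is why `p = 3d/(d+2)` pairs with one third of a derivative. -/
theorem mul_current_exponent (hd0 : 0 < d) :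
    (d : ℝ) * (1 / (3 * d / (d + 2) : ℝ≥0∞).toReal - 1 / 2) = 2 / 3 - d / 6 := by
  have : (0 : ℝ) < d := by exact_mod_cast hd0
  rw [toReal_current_exponent]
  field_simp
  ring

theorem current_exponent_nonneg (hd : d = 2 ∨ d = 3) :
    0 ≤ 1 / (3 * d / (d + 2) : ℝ≥0∞).toReal - 1 / 2 := by
  rw [toReal_current_exponent]
  rcases hd with rfl | rfl <;> norm_num

theorem exists_scaledBlock_le_lpBlock (hd : d = 2 ∨ d = 3) : ∃ C : ℝ≥0∞, C ≠ ⊤ ∧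
    ∀ (n : ℕ) (f : Torus d → E3), Integrable f → scaledBlock n f ≤
      C * (ENNReal.ofReal (2 ^ ((1 / 3 : ℝ) * n)) * eLpNorm (lpBlock n f) (3 * d / (d + 2)) volume) := by
  have hd0 : 0 < d := by omega
  obtain ⟨hp1, hp2⟩ := current_exponent_mem hd
  have he := current_exponent_nonneg hd
  have hde := mul_current_exponent hd0
  set p : ℝ≥0∞ := 3 * d / (d + 2)
  refine ⟨3 * ((5 : ℝ≥0∞) ^ d) ^ (1 / p.toReal - 1 / 2), ENNReal.mul_ne_top (by simp)
    (ENNReal.rpow_ne_top_of_nonneg he (by simp)), fun n f hf => ?_⟩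
  have h1 := blockEnergy_rpow_half_le hf n hp1 hp2
  have h2 := card_lpBox_rpow_le (d := d) n he
  rw [hde] at h2
  have e1 : (2 : ℝ≥0∞) ^ ((n : ℝ) * (d / 6 - 1 / 3)) * 2 ^ ((n : ℝ) * (2 / 3 - d / 6)) =
      ENNReal.ofReal (2 ^ ((1 / 3 : ℝ) * n)) := by
    rw [ofReal_two_rpow, ← two_rpow_add]
    congr 1
    ring
  calc scaledBlock n f ≤ 2 ^ ((n : ℝ) * (d / 6 - 1 / 3)) *
        (3 * ((((5 : ℝ≥0∞) ^ d) ^ (1 / p.toReal - 1 / 2) * 2 ^ ((n : ℝ) * (2 / 3 - d / 6))) *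
          eLpNorm (lpBlock n f) p volume)) := by
        rw [scaledBlock]
        gcongr
        refine h1.trans ?_
        gcongr
    _ = _ := by rw [← e1]; ring

theorem exists_scaledBlock_le_besovNorm (hd : d = 2 ∨ d = 3) : ∃ C : ℝ≥0∞, C ≠ ⊤ ∧
    ∀ (n : ℕ) (f : Torus d → E3), Integrable f → besovNorm (1 / 3) (3 * d / (d + 2)) f ≠ ⊤ →
      scaledBlock n f ≤ C * besovNorm (1 / 3) (3 * d / (d + 2)) f := by
  have hd0 : 0 < d := by omega
  obtain ⟨hp1, hp2⟩ := current_exponent_mem hd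
  have he := current_exponent_nonneg hd
  have hde := mul_current_exponent hd0
  set p : ℝ≥0∞ := 3 * d / (d + 2)
  obtain ⟨C, hC, h⟩ := exists_blockEnergy_le_besovNorm hd0 (by omega) (s := 1 / 3) (by norm_num) hp1 hp2
  refine ⟨C, hC, fun n f hf hB => ?_⟩
  have h1 := h n f hf hB
  have e0 : (((2 : ℝ≥0∞) ^ n) ^ d) ^ (1 / p.toReal - 1 / 2) = 2 ^ ((n : ℝ) * (2 / 3 - d / 6)) := by
    rw [← hde, ← pow_mul, ← ENNReal.rpow_natCast, ← ENNReal.rpow_mul]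
    congr 1
    push_cast
    ring
  have e1 : ENNReal.ofReal (((2 : ℝ) ^ n)⁻¹ ^ (1 / 3 : ℝ)) = (2 : ℝ≥0∞) ^ (-((n : ℝ) * (1 / 3))) := by
    rw [← ofReal_two_rpow, Real.inv_rpow (by positivity), Real.rpow_neg zero_le_two,
      ← Real.rpow_natCast, ← Real.rpow_mul zero_le_two]
  rw [e0, e1] at h1
  have e2 : (2 : ℝ≥0∞) ^ ((n : ℝ) * (d / 6 - 1 / 3)) * (2 ^ ((n : ℝ) * (2 / 3 - d / 6)) *
      2 ^ (-((n : ℝ) * (1 / 3)))) = 1 := by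
    rw [← two_rpow_add, ← two_rpow_add, ← ENNReal.rpow_zero (x := 2)]
    congr 1
    ring
  calc scaledBlock n f ≤ 2 ^ ((n : ℝ) * (d / 6 - 1 / 3)) * (C * (2 ^ ((n : ℝ) * (2 / 3 - d / 6)) *
        (2 ^ (-((n : ℝ) * (1 / 3))) * besovNorm (1 / 3) p f))) := by
        rw [scaledBlock]
        gcongr
    _ = (2 ^ ((n : ℝ) * (d / 6 - 1 / 3)) * (2 ^ ((n : ℝ) * (2 / 3 - d / 6)) *
          2 ^ (-((n : ℝ) * (1 / 3))))) * (C * besovNorm (1 / 3) p f) := by ring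
    _ = _ := by rw [e2, one_mul]

theorem tendsto_scaleWeight (n : ℕ) :
    Tendsto (fun ε : ℝ => ENNReal.ofReal (scaleWeight (2 ^ n * ε))) (𝓝[>] 0) (𝓝 0) := by
  have h1 : Tendsto (fun ε : ℝ => ENNReal.ofReal ((2 ^ n * ε) ^ (1 / 3 : ℝ))) (𝓝[>] 0) (𝓝 0) := by
    have hc : Continuous fun ε : ℝ => ENNReal.ofReal ((2 ^ n * ε) ^ (1 / 3 : ℝ)) :=
      ENNReal.continuous_ofReal.comp ((Real.continuous_rpow_const (by norm_num)).comp (by fun_prop))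
    have := (hc.tendsto 0).mono_left (nhdsWithin_le_nhds (s := Ioi 0))
    simpa using this
  refine tendsto_of_tendsto_of_tendsto_of_le_of_le' tendsto_const_nhds h1
    (Eventually.of_forall fun _ => zero_le) ?_
  filter_upwards [self_mem_nhdsWithin] with ε hε
  exact ENNReal.ofReal_le_ofReal (scaleWeight_le_rpow (mul_pos (by positivity) hε))

/-- Dominated convergence in time. The two halves of the hypothesis have separate roles: decay of
the blocks gives convergence at almost every time, and the `L³`-in-time Besov norm gives a majorant
independent of `ε`. -/
theorem tendsto_oscillation_of_memBesovC (hd : d = 2 ∨ d = 3) {T : ℝ}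
    {h : ℝ → Lp E3 2 (volume : Measure (Torus d))} (hsol : IsEMHDWeakSolution T h)
    {j : ℝ → Lp E3 1 (volume : Measure (Torus d))} (hj : IsCurrent T h j)
    (hjC : MemBesovC T 3 (1 / 3) (3 * d / (d + 2)) (fun t => j t)) :
    Tendsto (fun ε : ℝ => ENNReal.ofReal (ε ^ (-(2 / 3) : ℝ)) *
      timeNorm T 3 (fun t => meanOsc 3 ε (h t))) (𝓝[>] 0) (𝓝 0) := by
  have hd3 : d ≤ 3 := by omega
  obtain ⟨C₁, hC₁, h₁⟩ := exists_meanOsc_le_tsum_scaledBlock hd3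
  obtain ⟨C₂, hC₂, h₂⟩ := exists_scaledBlock_le_besovNorm hd
  obtain ⟨C₃, hC₃, h₃⟩ := exists_scaledBlock_le_lpBlock hd
  obtain ⟨S, hS, hSle⟩ := exists_tsum_scaleWeight_le
  set p : ℝ≥0∞ := 3 * d / (d + 2)
  set μ : Measure ℝ := volume.restrict (Ioo 0 T) with hμ
  have hji : ∀ t, Integrable (j t) := fun t => memLp_one_iff_integrable.1 (Lp.memLp (j t))
  have hh : AEStronglyMeasurable h μ :=
    (hsol.continuousOn.mono Ioo_subset_Icc_self).aestronglyMeasurable measurableSet_Ioo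
  set B : ℝ → ℝ≥0∞ := fun t => besovNorm (1 / 3) p (j t) with hB
  set F : ℝ → ℝ → ℝ≥0∞ := fun ε t => ENNReal.ofReal (ε ^ (-(2 / 3) : ℝ)) * meanOsc 3 ε (h t) with hF
  -- The `1` keeps the constant nonzero, so that the majorant is infinite at times where the Besov
  -- norm is infinite and the bound holds there trivially.
  set C := C₁ * (S * C₂) + 1 with hCdef
  have hCt : C ≠ ⊤ := ENNReal.add_ne_top.2
    ⟨ENNReal.mul_ne_top hC₁ (ENNReal.mul_ne_top hS hC₂), ENNReal.one_ne_top⟩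
  have hgood : ∀ᵐ t ∂μ, ∀ ε : ℝ, 0 < ε → F ε t ≤
      C₁ * ∑' n : ℕ, ENNReal.ofReal (scaleWeight (2 ^ n * ε)) * scaledBlock n (j t) := by
    filter_upwards [hj.2, ae_restrict_mem measurableSet_Ioo] with t ht htT ε hε
    exact h₁ (h t) (j t) (Lp.memLp (h t)) (hji t) (hsol.div_free t (Ioo_subset_Icc_self htT)) ht ε hε
  have hbound : ∀ᶠ ε in 𝓝[>] (0 : ℝ), ∀ᵐ t ∂μ, F ε t ^ (3 : ℝ) ≤ (C * B t) ^ (3 : ℝ) := by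
    filter_upwards [Ioo_mem_nhdsGT (zero_lt_one' ℝ)] with ε hε
    filter_upwards [hgood] with t ht
    gcongr
    by_cases hBt : B t = ⊤
    · rw [hBt, ENNReal.mul_top (by simp [hCdef])]
      exact le_top
    calc F ε t ≤ C₁ * ∑' n : ℕ, ENNReal.ofReal (scaleWeight (2 ^ n * ε)) * (C₂ * B t) := by
          refine (ht ε hε.1).trans ?_
          gcongr with n
          exact h₂ n (j t) (hji t) hBt
      _ ≤ C₁ * (S * (C₂ * B t)) := by
          rw [ENNReal.tsum_mul_right]
          gcongr
          exact hSle ε hε.1 hε.2.le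
      _ = C₁ * (S * C₂) * B t := by ring
      _ ≤ C * B t := by gcongr; exact le_self_add
  have hlim : ∀ᵐ t ∂μ, Tendsto (fun ε => F ε t ^ (3 : ℝ)) (𝓝[>] 0) (𝓝 0) := by
    filter_upwards [hgood, hjC.2] with t ht hjt
    have hb0 : Tendsto (fun n => scaledBlock n (j t)) atTop (𝓝 0) := by
      have h0 := ENNReal.Tendsto.const_mul hjt (a := C₃) (Or.inr hC₃)
      rw [mul_zero] at h0
      exact tendsto_of_tendsto_of_tendsto_of_le_of_le tendsto_const_nhds h0
        (fun _ => zero_le) fun n => h₃ n (j t) (hji t)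
    have h0 := tendsto_tsum_mul_zero hS
      (K := fun (ε : ℝ) n => ENNReal.ofReal (scaleWeight (2 ^ n * ε))) (l := 𝓝[>] 0) (by
        filter_upwards [Ioo_mem_nhdsGT (zero_lt_one' ℝ)] with ε hε
        exact hSle ε hε.1 hε.2.le) tendsto_scaleWeight
      (fun n => scaledBlock_ne_top n (j t)) hb0
    have h1 := ENNReal.Tendsto.const_mul h0 (a := C₁) (Or.inr hC₁)
    rw [mul_zero] at h1
    have h2 : Tendsto (fun ε => F ε t) (𝓝[>] 0) (𝓝 0) :=
      tendsto_of_tendsto_of_tendsto_of_le_of_le' tendsto_const_nhds h1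
        (Eventually.of_forall fun _ => zero_le) (by
          filter_upwards [self_mem_nhdsWithin] with ε hε
          exact ht ε hε)
    have h3 := (ENNReal.continuous_rpow_const (y := 3)).tendsto 0 |>.comp h2
    simpa [Function.comp_def] using h3
  have hfin : ∫⁻ t, (C * B t) ^ (3 : ℝ) ∂μ ≠ ⊤ := by
    simp only [ENNReal.mul_rpow_of_nonneg _ _ (by norm_num : (0 : ℝ) ≤ 3)]
    rw [lintegral_const_mul' _ _ (ENNReal.rpow_ne_top_of_nonneg (by norm_num) hCt)]
    refine ENNReal.mul_ne_top (ENNReal.rpow_ne_top_of_nonneg (by norm_num) hCt) ?_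
    have h0 := hjC.1
    rw [MemBesov, timeNorm, eLpNorm_eq_lintegral_rpow_enorm_toReal (by norm_num) (by norm_num)] at h0
    simp only [enorm_eq_self, ENNReal.toReal_ofNat] at h0
    intro htop
    change (∫⁻ t, B t ^ (3 : ℝ) ∂μ) ^ (1 / (3 : ℝ)) < ⊤ at h0
    rw [htop, ENNReal.top_rpow_of_pos (by norm_num)] at h0
    exact lt_irrefl _ h0
  have hmeas : ∀ᶠ ε in 𝓝[>] (0 : ℝ), AEMeasurable (fun t => F ε t ^ (3 : ℝ)) μ :=
    Eventually.of_forall fun ε => ((aemeasurable_meanOsc hh 3 ε).const_mul _).pow_const _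
  have hint := tendsto_lintegral_filter_of_dominated_convergence' _ hmeas hbound hfin hlim
  rw [lintegral_zero] at hint
  have h4 := (ENNReal.continuous_rpow_const (y := 1 / 3)).tendsto 0 |>.comp hint
  rw [ENNReal.zero_rpow_of_pos (by norm_num)] at h4
  refine h4.congr fun ε => ?_
  rw [Function.comp_apply, timeNorm, eLpNorm_eq_lintegral_rpow_enorm_toReal (by norm_num) (by norm_num)]
  simp only [enorm_eq_self, ENNReal.toReal_ofNat, hF,
    ENNReal.mul_rpow_of_nonneg _ _ (by norm_num : (0 : ℝ) ≤ 3)]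
  rw [lintegral_const_mul' _ _ (ENNReal.rpow_ne_top_of_nonneg (by norm_num) ENNReal.ofReal_ne_top),
    ENNReal.mul_rpow_of_nonneg _ _ (by norm_num), ← ENNReal.rpow_mul]
  norm_num
  rfl

end CurrentCriterion

/-! ### Energy conservation under the four criteria. -/

theorem theorem1p1 (d : ℕ) (hd : d = 2 ∨ d = 3) (T : ℝ) (hT : 0 < T)
    (h : ℝ → Lp E3 2 (volume : Measure (Torus d))) (hsol : IsEMHDWeakSolution T h)
    (hcond :
      MemBesovVMO T 3 (2 / 3) 3 (fun t => h t) ∨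
      (∃ (j : ℝ → Lp E3 1 (volume : Measure (Torus d))) (α β : ℝ) (r₁ r₂ p q : ℝ≥0∞),
        IsCurrent T h j ∧ 1 ≤ α + 2 * β ∧ r₁⁻¹ + 2 * r₂⁻¹ = 1 ∧ p⁻¹ + 2 * q⁻¹ = 1 ∧
        MemBesovVMO T r₁ α p (fun t => j t) ∧ MemBesov T r₂ β q (fun t => h t)) ∨
      (∃ (j : ℝ → Lp E3 1 (volume : Measure (Torus d))) (α β : ℝ) (r₁ r₂ p q : ℝ≥0∞),
        IsCurrent T h j ∧ 1 ≤ α + 2 * β ∧ r₁⁻¹ + 2 * r₂⁻¹ = 1 ∧ p⁻¹ + 2 * q⁻¹ = 1 ∧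
        MemBesov T r₁ α p (fun t => j t) ∧ MemBesovVMO T r₂ β q (fun t => h t)) ∨
      (∃ j : ℝ → Lp E3 1 (volume : Measure (Torus d)),
        IsCurrent T h j ∧ MemBesovC T 3 (1 / 3) (3 * d / (d + 2)) (fun t => j t))) :
    ∀ t ∈ Icc 0 T, (1 / 2 : ℝ) * ∫ x, ‖h t x‖ ^ 2 = (1 / 2 : ℝ) * ∫ x, ‖h 0 x‖ ^ 2 := by
  intro t ht
  refine congrArg _ ?_
  revert t
  rcases hcond with hV | ⟨j, α, β, r₁, r₂, p, q, hj, hαβ, hr, hpq, hjV, hhB⟩ |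
    ⟨j, α, β, r₁, r₂, p, q, hj, hαβ, hr, hpq, hjB, hhV⟩ | ⟨j, hj, hjC⟩
  · exact energy_eq_of_oscillation hT hsol hV.2
  · exact energy_eq_of_current_memBesovVMO hT hsol hj hαβ hr hpq hjV hhB
  · exact energy_eq_of_current_memBesov hT hsol hj hαβ hr hpq hjB hhV
  · exact energy_eq_of_oscillation hT hsol (tendsto_oscillation_of_memBesovC hd hsol hj hjC)
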